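/- **Setting.** Let $\mathfrak g$ be a finite-dimensional Lie algebra of compact type with basis $\xi_a$ of (linearly independent) hermitean matrices, $i[\xi_a,\xi_b]=\sum_e f_{abe}\xi_e$ with real, completely antisymmetric $f_{abe}$, and $\langle\xi_a|\xi_b\rangle=\delta_{ab}$. Let $c^\mu$ be a real vector-valued distribution on $\mathbb R^{1,3}$ with $\partial_\mu c^\mu=\delta$, supported in a closed convex cone $C$ containing no line, and let $(I_c^\mu f)(x)=\int d^4y\,c^\mu(y)f(x+y)$; then $I_c^\mu\partial_\mu=-\mathrm{id}$. Fields are functionals $X[A](x)$ of the $\mathfrak g$-valued potential $A_\mu$, whose components are real smooth functions with support meeting $K+C$ in a compact set for every compact $K$; the (commutative) Wick product is the pointwise product, and $\mathrm{ad}_{iX}(Y)=i[X,Y]$. Field identities are understood configuration by configuration, hence in particular on solutions of the wave equation. Put $F_{\mu\nu}=\partial_\mu A_\nu-\partial_\nu A_\mu$ and $A_\mu(c)=I_c^\nu F_{\mu\nu}$. Let $\mathcal S^{\mathfrak g}$ be the smallest real space of $\mathfrak g$-valued fields that contains $I_c^\nu(\mathrm{ad}_{is_k}\cdots\mathrm{ad}_{is_1}A_\nu)$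 ($k\ge0$) and $I_c^\nu(\mathrm{ad}_{is_k}\cdots\mathrm{ad}_{is_1}\partial_\nu s_0)$ ($k\ge1$) for all $s_0,\dots,s_k\in\mathcal S^{\mathfrak g}$, and let $\mathcal V^{\mathfrak g}$ be the real span of the vector fields $\mathrm{ad}_{is_k}\cdots\mathrm{ad}_{is_1}A_\nu$ and $\mathrm{ad}_{is_k}\cdots\mathrm{ad}_{is_1}\partial_\nu s_0$ ($k\ge0$, $s_i\in\mathcal S^{\mathfrak g}$). The coupling constant $g$ is a formal variable. For $\alpha\in g\mathcal V^{\mathfrak g}[[g]]$ and $U^\mu=\langle F^{\mu\nu}|\alpha_\nu\rangle$ let $\omega_U(X)(x)=i\int dx'\,\langle\alpha_\nu(x')|O_\mu(F^{\mu\nu}(x'),X(x))\rangle$ be the tree-level obstruction map (with $\alpha$ inert): it is the derivation which replaces, one at a time, each factor $A_{\kappa}(x)$ of $X$ by $i\int dx'\,\langle\alpha_\nu(x')|O_\mu(F^{\mu\nu}(x'),A_{\kappa}(x))\rangle$ with $$O_\mu(F_a^{\mu\nu}(x'),A_{\kappa,b}(x))=-\partial'^\nu\langle T N_a(x')A_{\kappa,b}(x)\rangle-\partial'_\mu\langle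 T F_a^{\mu\nu}(x')A_{\kappa,b}(x)\rangle,\qquad N=\partial^\mu A_\mu ,$$ computed from $\langle TA_{\nu,a}(x')A_{\kappa,b}(x)\rangle=-\delta_{ab}\eta_{\nu\kappa}T_0(x'-x)$, where $T_0$ is a complex distribution with $\square T_0=-i\delta$, and $\eta=\mathrm{diag}(1,-1,-1,-1)$. Let $F(\omega)=\sum_{k\ge0}\omega^k/(k+1)!$. For $\gamma\in g\mathcal S^{\mathfrak g}[[g]]$ let $W=e^{i\gamma}$ and $$\Sigma_\mu(\gamma)=\sum_{n\ge1}\tfrac1{n!}\,\mathrm{ad}_{i\gamma}^n\big(A_\mu+\tfrac{g^{-1}}{n+1}\partial_\mu\gamma\big).$$ **Proposition.** (i) If $\gamma\in g\mathcal S^{\mathfrak g}[[g]]$ and $\alpha\in g\mathcal V^{\mathfrak g}[[g]]$ satisfy the dressing ansatz $$e^{\omega_U}(A_\mu(c))=W\big(A_\mu+ig^{-1}\partial_\mu\big)W^{-1},\tag{1}$$ then $$I_c^\mu\big(W(gA_\mu+i\partial_\mu)W^{-1}\big)=0.\tag{2}$$ This holds configuration by configuration: if (1) holds at $A$, then so does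 (2). (ii) Equation (2) has exactly one solution $\gamma\in g\mathcal S^{\mathfrak g}[[g]]$, and any $\gamma'\in g\mathcal S^{\mathfrak g}[[g]]$ that satisfies (2) at a configuration $A$ coincides with $\gamma$ at $A$. The solution is given recursively: for every $n$, the coefficient of $g^n$ in $\gamma$ is the coefficient of $g^n$ in $I_c^\mu\big(gA_\mu+g\Sigma_\mu(\gamma^{<n})\big)$, where $\gamma^{<n}$ is the part of $\gamma$ of order less than $n$ in $g$. (iii) Let $\gamma$ be the solution from (ii). There is exactly one $\alpha\in g\mathcal V^{\mathfrak g}[[g]]$ with $F(\omega_U)(\alpha_\mu)=\Sigma_\mu(\gamma)$, $U^\mu=\langle F^{\mu\nu}|\alpha_\nu\rangle$. It satisfies (1), and it is given recursively: the coefficient of $g^n$ in $\alpha_\mu$ is the coefficient of $g^n$ in $\Sigma_\mu(\gamma)+\alpha^{<n}_\mu-F(\omega_{U^{<n}})(\alpha^{<n}_\mu)$, where $\alpha^{<n}$ is the part of order less than $n$ and $U^{<n}$ is formed with $\alpha^{<n}$. If $\mathfrak g\ne0$, then (1) alone does not determine $\alpha\in g\mathcal V^{\mathfrak g}[[g]]$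 uniquely. -/

import Mathlib

open scoped Distributions LineDeriv PowerSeries Pointwise ContDiff Topology

noncomputable section

namespace StringYM

/-! ### Minkowski space and string functions -/

/-- Minkowski space with coordinates `x⁰, …, x³` (the Euclidean norm only serves for topology). -/
abbrev Spacetime : Type := EuclideanSpace ℝ (Fin 4)

/-- The coordinate vector `e_μ`. -/
def dir (μ : Fin 4) : Spacetime := EuclideanSpace.single μ 1

/-- The diagonal entries of the metric, `η = diag(1, -1, -1, -1)`. -/
def eta (μ : Fin 4) : ℝ := if μ = 0 then 1 else -1

/-- The value `T(f)` of a distribution `T` supported in the closed set `S` on a function `f` that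
need not have compact support: `T(f) = T(ψ)` for any test function `ψ` that agrees with `f` in a
neighbourhood of `S`. -/
def evalNear {F : Type*} [AddCommGroup F] [Module ℝ F] [TopologicalSpace F]
    (T : 𝓓'((⊤ : TopologicalSpace.Opens Spacetime), F)) (S : Set Spacetime)
    (f : Spacetime → ℝ) : F := by
  classical
  exact if h : ∃ ψ : 𝓓((⊤ : TopologicalSpace.Opens Spacetime), ℝ), ψ =ᶠ[𝓝ˢ S] f
    then T h.choose else 0

/-- A string function: a real vector-valued distribution `c^μ` with `∂_μ c^μ = δ`, supported in a
closed convex cone that contains no line. -/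
structure StringFunction where
  cone : ProperCone ℝ Spacetime
  salient : ∀ y ∈ cone, -y ∈ cone → y = 0
  c : Fin 4 → 𝓓'((⊤ : TopologicalSpace.Opens Spacetime), ℝ)
  support : ∀ μ, Distribution.IsVanishingOn (c μ) (cone : Set Spacetime)ᶜ
  divergence : ∑ μ, ∂_{dir μ} (c μ) = Distribution.delta 0

/-! ### The gauge Lie algebra -/

/-- A Lie algebra `𝔤` of compact type, given by a basis `ξ_a` of hermitean matrices with
`i[ξ_a, ξ_b] = ∑_c f_{abc} ξ_c`, where the real structure constants are completely antisymmetric.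
The invariant form is `⟨ξ_a | ξ_b⟩ = δ_{ab}`. -/
structure GaugeAlgebra (ι d : Type*) [Fintype ι] [Fintype d] where
  ξ : ι → Matrix d d ℂ
  f : ι → ι → ι → ℝ
  hermitian : ∀ a, (ξ a).IsHermitian
  linearIndependent : LinearIndependent ℝ ξ
  commutator : ∀ a b, Complex.I • (ξ a * ξ b - ξ b * ξ a) = ∑ e, (f a b e : ℂ) • ξ e
  antisymm : ∀ a b e, f b a e = -f a b e
  cyclic : ∀ a b e, f b e a = f a b e

/-! ### Field configurations and the Wick algebra -/

/-- Functions whose support meets every `K + cone` (`K` compact) in a compact set; these are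
the functions that can be integrated along all strings `x + cone`. -/
def StringCompact (C : ProperCone ℝ Spacetime) (u : Spacetime → ℝ) : Prop :=
  ∀ K : Set Spacetime, IsCompact K → IsCompact (tsupport u ∩ (K + (C : Set Spacetime)))

theorem StringCompact.of_tsupport_subset {C : ProperCone ℝ Spacetime} {u : Spacetime → ℝ}
    {B : Set Spacetime} (h : tsupport u ⊆ B)
    (hB : ∀ K : Set Spacetime, IsCompact K → IsCompact (B ∩ (K + (C : Set Spacetime)))) :
    StringCompact C u := by
  intro K hK
  have hcl : IsClosed (K + (C : Set Spacetime)) :=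
    C.isClosed.add_left_of_isCompact hK
  refine (hB K hK).of_isClosed_subset ((isClosed_tsupport u).inter hcl) ?_
  exact Set.inter_subset_inter_left _ h

/-- Configurations `A_{μ,a}(x)` of the `𝔤`-valued vector potential (`μ` is a lower index). -/
def Config (C : ProperCone ℝ Spacetime) (ι : Type*) :
    Submodule ℝ (Fin 4 → ι → Spacetime → ℝ) where
  carrier := {A | ∀ μ a, ContDiff ℝ ∞ (A μ a) ∧ StringCompact C (A μ a)}
  zero_mem' := by
    intro μ a
    refine ⟨contDiff_const, StringCompact.of_tsupport_subset (B := ∅) ?_ (by simp)⟩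
    simp [tsupport]
  add_mem' := by
    intro A B hA hB μ a
    refine ⟨(hA μ a).1.add (hB μ a).1,
      StringCompact.of_tsupport_subset (tsupport_add (A μ a) (B μ a)) ?_⟩
    intro K hK
    rw [Set.union_inter_distrib_right]
    exact ((hA μ a).2 K hK).union ((hB μ a).2 K hK)
  smul_mem' := by
    intro r A hA μ a
    exact ⟨(hA μ a).1.const_smul r,
      StringCompact.of_tsupport_subset
        (tsupport_smul_subset_right (fun _ => r) (A μ a)) (hA μ a).2⟩

/-- Fields, as functionals `X[A](x)` of the field configuration; the Wick product is the
pointwise product. -/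
abbrev WickField (C : ProperCone ℝ Spacetime) (ι : Type*) : Type _ :=
  Config C ι → Spacetime → ℂ

variable {ι d : Type*} {C : ProperCone ℝ Spacetime}

/-- The field `A_μ = ∑_a A_{μ,a} ξ_a`, in components. -/
def potential (μ : Fin 4) (a : ι) : WickField C ι := fun A x => ((A.1 μ a x : ℝ) : ℂ)

/-- The derivative `∂_μ` of fields. -/
def pd (μ : Fin 4) (X : WickField C ι) : WickField C ι :=
  fun A x => fderiv ℝ (X A) x (dir μ)

/-- The string integration `(I_c^μ X)(x) = ∫ d⁴y c^μ(y) X(x + y)`. -/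
def stringInt (s : StringFunction) (μ : Fin 4) (X : WickField s.cone ι) : WickField s.cone ι :=
  fun A x =>
    ((evalNear (s.c μ) (s.cone : Set Spacetime) (fun y => (X A (x + y)).re) : ℝ) : ℂ)
      + Complex.I *
        ((evalNear (s.c μ) (s.cone : Set Spacetime) (fun y => (X A (x + y)).im) : ℝ) : ℂ)

/-- `I_c^ν v_ν` for a `𝔤`-valued vector field `v`. -/
def stringIntVec (s : StringFunction) (v : Fin 4 → ι → WickField s.cone ι) :
    ι → WickField s.cone ι :=
  fun a => ∑ ν, stringInt s ν (v ν a)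

/-- The free field strength `F_{μν} = ∂_μ A_ν - ∂_ν A_μ`. -/
def fieldStrength (μ ν : Fin 4) (a : ι) : WickField C ι :=
  pd μ (potential ν a) - pd ν (potential μ a)

/-- The string-localized potential `A_μ(c) = I_c^ν F_{μν}`. -/
def stringPotential (s : StringFunction) (μ : Fin 4) (a : ι) : WickField s.cone ι :=
  ∑ ν, stringInt s ν (fieldStrength μ ν a)

/-! ### The Lie bracket and the spaces `𝒮` and `𝒱` -/

/-- `ad_{iX}(Y) = i[X, Y] = ∑ f_{abe} X_a Y_b ξ_e` for `𝔤`-valued fields (or power series of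
fields), in components. -/
def ad {R : Type*} [CommRing R] [Algebra ℂ R] [Fintype ι] (f : ι → ι → ι → ℝ) (X Y : ι → R) :
    ι → R :=
  fun e => ∑ a, ∑ b, (f a b e : ℂ) • (X a * Y b)

/-- `ad_{is_k} ⋯ ad_{is_1}(v)` for the list `[s_k, …, s_1]`. -/
def adList [Fintype ι] (f : ι → ι → ι → ℝ) (l : List (ι → WickField C ι))
    (v : Fin 4 → ι → WickField C ι) : Fin 4 → ι → WickField C ι :=
  l.foldr (fun s w μ => ad f s (w μ)) v

/-- The gradient `∂_ν s` of a `𝔤`-valued scalar field. -/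
def grad (s : ι → WickField C ι) : Fin 4 → ι → WickField C ι := fun ν a => pd ν (s a)

/-- Membership in the smallest real subspace `𝒮` that contains
`I_c^ν(ad_{is_k} ⋯ ad_{is_1}(A_ν))` (`k ≥ 0`) and `I_c^ν(ad_{is_k} ⋯ ad_{is_1}(∂_ν s_0))`
(`k ≥ 1`) for `s_0, …, s_k` in `𝒮`. -/
inductive MemS [Fintype ι] (s : StringFunction) (f : ι → ι → ι → ℝ) :
    (ι → WickField s.cone ι) → Prop
  | zero : MemS s f 0
  | add {X Y} : MemS s f X → MemS s f Y → MemS s f (X + Y)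
  | smul (r : ℝ) {X} : MemS s f X → MemS s f (r • X)
  | ofPotential (l : List (ι → WickField s.cone ι)) (hl : ∀ X, X ∈ l → MemS s f X) :
      MemS s f (stringIntVec s (adList f l potential))
  | ofGrad (l : List (ι → WickField s.cone ι)) (hne : l ≠ []) (hl : ∀ X, X ∈ l → MemS s f X)
      {X₀} (h₀ : MemS s f X₀) : MemS s f (stringIntVec s (adList f l (grad X₀)))

/-- The space `𝒮^𝔤` of scalar fields. -/
def spaceS [Fintype ι] (s : StringFunction) (f : ι → ι → ι → ℝ) :
    Submodule ℝ (ι → WickField s.cone ι) where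
  carrier := {X | MemS s f X}
  zero_mem' := MemS.zero
  add_mem' := MemS.add
  smul_mem' := fun r _ h => MemS.smul r h

/-- The space `𝒱^𝔤` of vector fields: the smallest real subspace that contains `A_ν` and `∂_ν s`
(`s ∈ 𝒮`) and is closed under `ad_{is}` (`s ∈ 𝒮`). -/
def spaceV [Fintype ι] (s : StringFunction) (f : ι → ι → ι → ℝ) :
    Submodule ℝ (Fin 4 → ι → WickField s.cone ι) :=
  Submodule.span ℝ
    ({v | ∃ l : List (ι → WickField s.cone ι),
        (∀ X ∈ l, X ∈ spaceS s f) ∧ v = adList f l potential} ∪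
     {v | ∃ l : List (ι → WickField s.cone ι), (∀ X ∈ l, X ∈ spaceS s f) ∧
        ∃ X₀ ∈ spaceS s f, v = adList f l (grad X₀)})

/-- `γ ∈ g 𝒮^𝔤[[g]]`; the power series variable is the coupling constant `g`. -/
def InGS [Fintype ι] (s : StringFunction) (f : ι → ι → ι → ℝ)
    (γ : ι → (WickField s.cone ι)⟦X⟧) : Prop :=
  (∀ a, PowerSeries.coeff 0 (γ a) = 0) ∧
    ∀ n, (fun a => PowerSeries.coeff n (γ a)) ∈ spaceS s f

/-- `α ∈ g 𝒱^𝔤[[g]]`. -/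
def InGV [Fintype ι] (s : StringFunction) (f : ι → ι → ι → ℝ)
    (α : Fin 4 → ι → (WickField s.cone ι)⟦X⟧) : Prop :=
  (∀ μ a, PowerSeries.coeff 0 (α μ a) = 0) ∧
    ∀ n, (fun μ a => PowerSeries.coeff n (α μ a)) ∈ spaceV s f

/-- The coefficientwise extension of an operation on fields to power series in `g`. -/
def mapCoeff {R : Type*} [CommRing R] (φ : R → R) (u : R⟦X⟧) : R⟦X⟧ :=
  PowerSeries.mk fun n => φ (PowerSeries.coeff n u)

/-! ### Propagators, two-point obstructions and the obstruction map

All distributions depend on `z = x' - x`, so that `∂'_μ = ∂_{dir μ}`. -/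

/-- Complex distributions on Minkowski space. -/
abbrev CDist : Type := 𝓓'((⊤ : TopologicalSpace.Opens Spacetime), ℂ)

/-- `T₀` is a time-ordered function of the massless scalar field: `□ T₀ = -i δ`. -/
def IsPropagator (T₀ : CDist) : Prop :=
  ∀ ψ : 𝓓((⊤ : TopologicalSpace.Opens Spacetime), ℝ),
    (∑ μ, eta μ • ∂_{dir μ} (∂_{dir μ} T₀)) ψ = -Complex.I * (ψ 0 : ℂ)

/-- `⟨T A_{ν,a}(x') A_{κ,b}(x)⟩ = -δ_{ab} η_{νκ} T₀(x' - x)`. -/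
def propAA [DecidableEq ι] (T₀ : CDist) (ν : Fin 4) (a : ι) (κ : Fin 4) (b : ι) : CDist :=
  if ν = κ ∧ a = b then -(eta ν • T₀) else 0

/-- `⟨T N_a(x') A_{κ,b}(x)⟩` for the null field `N = ∂^μ A_μ`. -/
def propNA [DecidableEq ι] (T₀ : CDist) (a : ι) (κ : Fin 4) (b : ι) : CDist :=
  ∑ μ, eta μ • ∂_{dir μ} (propAA T₀ μ a κ b)

/-- `⟨T F_a^{μν}(x') A_{κ,b}(x)⟩` for `F^{μν} = ∂^μ A^ν - ∂^ν A^μ`. -/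
def propFA [DecidableEq ι] (T₀ : CDist) (μ ν : Fin 4) (a : ι) (κ : Fin 4) (b : ι) : CDist :=
  (eta μ * eta ν) • (∂_{dir μ} (propAA T₀ ν a κ b) - ∂_{dir ν} (propAA T₀ μ a κ b))

/-- The two-point obstruction `O_μ(F_a^{μν}(x'), A_{κ,b}(x))
= ⟨T ∂'_μ F_a^{μν}(x') A_{κ,b}(x)⟩ - ∂'_μ ⟨T F_a^{μν}(x') A_{κ,b}(x)⟩`, where the equation of motion
`∂_μ F^{μν} = -∂^ν N` is used in the first term. -/
def obstrFA [DecidableEq ι] (T₀ : CDist) (ν : Fin 4) (a : ι) (κ : Fin 4) (b : ι) : CDist :=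
  -(eta ν • ∂_{dir ν} (propNA T₀ a κ b)) - ∑ μ, ∂_{dir μ} (propFA T₀ μ ν a κ b)

/-- `i ∫ dx' ⟨α_ν(x') | O_μ(F^{μν}(x'), A_{κ,b}(x))⟩` at the configuration `A`. The two-point
obstructions are supported at `x' = x`. -/
def contraction [Fintype ι] [DecidableEq ι] (T₀ : CDist) (α : Fin 4 → ι → WickField C ι)
    (A : Config C ι) (κ : Fin 4) (b : ι) (x : Spacetime) : ℂ :=
  Complex.I * ∑ ν, ∑ a,
    (evalNear (obstrFA T₀ ν a κ b) {0} (fun z => (α ν a A (x + z)).re)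
      + Complex.I * evalNear (obstrFA T₀ ν a κ b) {0} (fun z => (α ν a A (x + z)).im))

/-- The contraction as a configuration (it is hermitean and has admissible support; otherwise
the value is `0`). -/
def contractionConfig [Fintype ι] [DecidableEq ι] (T₀ : CDist) (α : Fin 4 → ι → WickField C ι)
    (A : Config C ι) : Config C ι := by
  classical
  exact if h : ∃ B : Config C ι, ∀ κ b x, ((B.1 κ b x : ℝ) : ℂ) = contraction T₀ α A κ b x
    then h.choose else 0

/-- The obstruction map `ω_U(X)(x) = i ∫ dx' O_μ(U^μ(x'), X(x))` of the field
`U^μ = ⟨F^{μν} | α_ν⟩` with `α ∈ 𝒱^𝔤`. By Wick's theorem at tree level, exactly one factor of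
`U^μ` is contracted with one factor of `X`. The factor `α` is inert (it consists of `A_ν` with
`O_{[μ}(A_{ν]}, X) = 0`, and of the inert fields `𝒮^𝔤`), so `F^{μν}` is contracted with the
factors `A` of `X` in turn, that is, `X` is differentiated as a functional of `A` in the direction
in which `A_κ` is replaced by its contraction. -/
def obstruction [Fintype ι] [DecidableEq ι] (T₀ : CDist) (α : Fin 4 → ι → WickField C ι)
    (X : WickField C ι) : WickField C ι :=
  fun A x => deriv (fun t : ℝ => X (A + t • contractionConfig T₀ α A) x) 0

/-- The bilinear extension of `ω_U` to power series in `g`. -/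
def omega [Fintype ι] [DecidableEq ι] (T₀ : CDist) (α : Fin 4 → ι → (WickField C ι)⟦X⟧)
    (u : (WickField C ι)⟦X⟧) : (WickField C ι)⟦X⟧ :=
  PowerSeries.mk fun n => ∑ p ∈ Finset.HasAntidiagonal.antidiagonal n,
    obstruction T₀ (fun μ a => PowerSeries.coeff p.1 (α μ a)) (PowerSeries.coeff p.2 u)

/-- `e^{ω_U} = ∑_k ω_U^k / k!` for `α` without term of order `g⁰`; `ω_U^k` then raises the order
by at least `k`, so only `k ≤ n` contributes at order `gⁿ`. -/
def expOmega [Fintype ι] [DecidableEq ι] (T₀ : CDist) (α : Fin 4 → ι → (WickField C ι)⟦X⟧)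
    (u : (WickField C ι)⟦X⟧) : (WickField C ι)⟦X⟧ :=
  PowerSeries.mk fun n => ∑ k ∈ Finset.range (n + 1),
    ((k.factorial : ℂ)⁻¹) • PowerSeries.coeff n ((omega T₀ α)^[k] u)

/-- `F(ω_U) = (e^{ω_U} - 1) / ω_U = ∑_k ω_U^k / (k + 1)!`. -/
def FOmega [Fintype ι] [DecidableEq ι] (T₀ : CDist) (α : Fin 4 → ι → (WickField C ι)⟦X⟧)
    (u : (WickField C ι)⟦X⟧) : (WickField C ι)⟦X⟧ :=
  PowerSeries.mk fun n => ∑ k ∈ Finset.range (n + 1),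
    (((k + 1).factorial : ℂ)⁻¹) • PowerSeries.coeff n ((omega T₀ α)^[k] u)

/-! ### The dressing factor -/

/-- The matrix-valued field `∑_a X_a ξ_a`. -/
def toMatrix {R : Type*} [CommRing R] [Algebra ℂ R] [Fintype ι] (ξ : ι → Matrix d d ℂ)
    (X : ι → R) : Matrix d d R :=
  Matrix.of fun i j => ∑ a, (ξ a i j) • X a

/-- The exponential of a matrix-valued power series without term of order `g⁰`. -/
def matExp {R : Type*} [CommRing R] [Algebra ℂ R] [Fintype d] [DecidableEq d]
    (Y : Matrix d d R⟦X⟧) : Matrix d d R⟦X⟧ :=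
  Matrix.of fun i j => PowerSeries.mk fun n => ∑ k ∈ Finset.range (n + 1),
    ((k.factorial : ℂ)⁻¹) • PowerSeries.coeff n ((Y ^ k) i j)

/-- `W (g A_μ + i ∂_μ) W⁻¹` with `W = e^{iγ}`, `W⁻¹ = e^{-iγ}`. -/
def gaugeTransform [Fintype ι] [Fintype d] [DecidableEq d] (ξ : ι → Matrix d d ℂ)
    (γ : ι → (WickField C ι)⟦X⟧) (μ : Fin 4) : Matrix d d (WickField C ι)⟦X⟧ :=
  let W := matExp (Complex.I • toMatrix ξ γ)
  let Winv := matExp (-(Complex.I • toMatrix ξ γ))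
  (PowerSeries.X : (WickField C ι)⟦X⟧) •
      (W * toMatrix ξ (fun a => PowerSeries.C (potential μ a)) * Winv)
    + Complex.I • (W * Winv.map (mapCoeff (pd μ)))

/-- Equality of two power series of fields at the configuration `A`. -/
def EqAt (A : Config C ι) (u v : (WickField C ι)⟦X⟧) : Prop :=
  ∀ n x, PowerSeries.coeff n u A x = PowerSeries.coeff n v A x

/-- The dressing ansatz `e^{ω_U}(A_μ(c)) = W (A_μ + i g⁻¹ ∂_μ) W⁻¹` (multiplied by `g`), at the
configuration `A`, with `U^μ = ⟨F^{μν} | α_ν⟩` and `W = e^{iγ}`. -/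
def DressingAt [Fintype ι] [DecidableEq ι] [Fintype d] [DecidableEq d] (s : StringFunction)
    (T₀ : CDist) (ξ : ι → Matrix d d ℂ) (γ : ι → (WickField s.cone ι)⟦X⟧)
    (α : Fin 4 → ι → (WickField s.cone ι)⟦X⟧) (A : Config s.cone ι) : Prop :=
  ∀ μ i j, EqAt A
    (PowerSeries.X *
      toMatrix ξ (fun a => expOmega T₀ α (PowerSeries.C (stringPotential s μ a))) i j)
    (gaugeTransform ξ γ μ i j)

/-- The equation `I_c^μ (W (g A_μ + i ∂_μ) W⁻¹) = 0`, at the configuration `A`. -/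
def AxialAt [Fintype ι] [Fintype d] [DecidableEq d] (s : StringFunction)
    (ξ : ι → Matrix d d ℂ) (γ : ι → (WickField s.cone ι)⟦X⟧) (A : Config s.cone ι) : Prop :=
  ∀ i j, EqAt A (∑ μ, mapCoeff (stringInt s μ) (gaugeTransform ξ γ μ i j)) 0

/-- `Σ_μ(γ) = ∑_{n ≥ 1} (1/n!) ad_{iγ}^n (A_μ + g⁻¹/(n+1) ∂_μ γ)` for `γ` without term of order
`g⁰`; only `n ≤ m` contributes at order `g^m`. -/
def Sig [Fintype ι] (f : ι → ι → ι → ℝ) (γ : ι → (WickField C ι)⟦X⟧) (μ : Fin 4) (a : ι) :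
    (WickField C ι)⟦X⟧ :=
  PowerSeries.mk fun m => ∑ n ∈ Finset.Icc 1 m, ((n.factorial : ℂ)⁻¹) • PowerSeries.coeff m
    ((ad f γ)^[n] (fun b => PowerSeries.C (potential μ b) + (((n : ℂ) + 1)⁻¹) •
      PowerSeries.mk fun k => pd μ (PowerSeries.coeff (k + 1) (γ b))) a)

/-- The part of a power series of order less than `n`. -/
def below {R : Type*} [CommRing R] (n : ℕ) (u : R⟦X⟧) : R⟦X⟧ :=
  (PowerSeries.trunc n u : Polynomial R)

end StringYM

end

open scoped Distributions LineDeriv PowerSeries Pointwise ContDiff Topology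

noncomputable section

namespace StringYM

/-! ### Translates of test functions -/

/-! The obstruction map turns out to be elementary. In `O_μ(F^{μν}, A_κ)` the mixed second
derivatives of `T₀` cancel and only `δ^ν_κ □T₀ = -iδ^ν_κ δ` survives (`obstrFA_apply`), so
contracting with `α` replaces `A_κ` by `α_κ` (`contraction_eq`). Hence `ω = ω_U` is a derivation
with `ω(A_μ) = α_μ` that commutes with `∂_μ` and `I_c^μ`, and `e^ω(A_μ) = A_μ + F(ω)(α_μ)`. For this
the derivative along a line of configurations must be an algebraic operation: all fields in play are
polynomial along lines, with coefficients on which `∂` and `I_c` act (`Regular`, `TameOp`).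

The second ingredient is the operator `P = 1 + ∂ I_c` (`axialProj`). By `I_c^μ ∂_μ = -id` it
annihilates gradients, its image is annihilated by `I_c`, and `A(c) = P A`. Since `ω` commutes with
`P`, `e^ω(A(c)) = P(A + F(ω)α)` (`coeff_expOmega_stringPotential`). Applying `I_c` gives (i).

The third ingredient is the identity `W(gA_μ + i∂_μ)W⁻¹ = g(A_μ + Σ_μ(γ)) + ∂_μ γ`
(`gaugeTransform_eq`), from the series for `e^Y M e^{-Y}` and `e^Y ∂ e^{-Y}`. Applying `I_c` turns
(2) into the fixed-point equation `γ = I_c^μ(gA_μ + gΣ_μ(γ))` (`axialAt_iff`). Order `n` of the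
right side involves only orders below `n` of `γ`, and only values at the same configuration; this
gives existence, uniqueness and the recursion in (ii).

For (iii), `F(ω)(α)` equals `α` plus terms that at order `n` see only lower orders of `α`
(`coeff_FOmega_below`), so `F(ω)(α) = σ` is uniquely solvable for every `σ` in `g𝒱[[g]]`. With `σ =
Σ(γ)` one finds `P(A + Σ) = A + Σ + ∂ I_c(A + Σ) = A + Σ + g⁻¹∂γ`, which is (1). With `σ = Σ(γ) +
h`, where `h` is a nonzero gradient, `P` does not see `h`, so a different `α` satisfies (1) too. -/

/-- Real test functions on Minkowski space. -/
abbrev RTest : Type := 𝓓((⊤ : TopologicalSpace.Opens Spacetime), ℝ)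

theorem RTest.lineDeriv_apply (v : RTest) (h x : Spacetime) :
    (∂_{h} v : RTest) x = fderiv ℝ v x h := by
  rw [TestFunction.lineDerivOp_eq_lineDerivCLM ℝ, TestFunction.lineDerivCLM_eq_fderivCLM,
    TestFunction.fderivCLM_apply]
  simp

theorem RTest.smooth (v : RTest) : ContDiff ℝ ∞ v := v.contDiff

/-- A smooth compactly supported function as a test function. -/
def RTest.ofSmooth (u : Spacetime → ℝ) (h : ContDiff ℝ ∞ u) (hc : HasCompactSupport u) : RTest :=
  ⟨u, h, hc, by simp⟩

/-- The translate `y ↦ v (x + y)`. -/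
def RTest.shift (v : RTest) (x : Spacetime) : RTest :=
  RTest.ofSmooth (fun y => v (x + y)) (v.smooth.comp (contDiff_const.add contDiff_id))
    (v.hasCompactSupport.comp_homeomorph (Homeomorph.addLeft x))

@[simp]
theorem RTest.shift_apply (v : RTest) (x y : Spacetime) : v.shift x y = v (x + y) := rfl

/-- A distribution has finite order on each compact set, so a Taylor remainder has to be controlled
in only finitely many derivatives. -/
theorem exists_seminorm_bound (T : 𝓓'((⊤ : TopologicalSpace.Opens Spacetime), ℝ))
    (K : TopologicalSpace.Compacts Spacetime) :
    ∃ (N : ℕ) (M : ℝ), 0 ≤ M ∧ ∀ (ψ : RTest) (ε : ℝ), 0 ≤ ε → Function.support ψ ⊆ K →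
      (∀ i ≤ N, ∀ x, ‖iteratedFDeriv ℝ i ψ x‖ ≤ ε) → |T ψ| ≤ M * ε := by
  have hK : (K : Set Spacetime) ⊆ (⊤ : TopologicalSpace.Opens Spacetime) := by simp
  let L := (T : RTest →L[ℝ] ℝ).comp (TestFunction.ofSupportedInCLM (n := ⊤) (F := ℝ) ℝ hK)
  obtain ⟨s, c, -, hs⟩ := Seminorm.bound_of_continuous
    (ContDiffMapSupportedIn.withSeminorms ℝ Spacetime ℝ ⊤ K) ((normSeminorm ℝ ℝ).comp L.toLinearMap)
    (by
      have : Continuous fun f => ‖L f‖ := L.continuous.norm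
      exact this)
  refine ⟨s.sup id, c, c.2, fun ψ ε hε hψ hb => ?_⟩
  let f : 𝓓^{⊤}_{K}(Spacetime, ℝ) :=
    ContDiffMapSupportedIn.of_support_subset (f := ψ) ψ.contDiff hψ
  have h1 := hs f
  have h2 : ((normSeminorm ℝ ℝ).comp L.toLinearMap) f = |T ψ| := rfl
  rw [h2] at h1
  refine h1.trans ?_
  refine mul_le_mul_of_nonneg_left ?_ c.2
  refine Seminorm.finset_sup_apply_le hε fun i hi => ?_
  rw [ContDiffMapSupportedIn.seminorm_top_le_iff ℝ hε]
  exact fun x _ => hb i (Finset.le_sup (f := id) hi) x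

theorem minSmoothness_two_le : minSmoothness ℝ 2 ≤ ∞ := by
  rw [minSmoothness_of_isRCLikeNormedField]
  exact WithTop.coe_le_coe.2 (le_top : (2 : ℕ∞) ≤ ⊤)

/-- The induction step is the symmetry of the second derivative. With it, every derivative of a
Taylor remainder of `v` is a Taylor remainder of a derivative of `v`. -/
theorem iteratedFDeriv_fderiv_apply {v : Spacetime → ℝ} (hv : ContDiff ℝ ∞ v) (h : Spacetime)
    (i : ℕ) (x : Spacetime) :
    iteratedFDeriv ℝ i (fun y => fderiv ℝ v y h) x = fderiv ℝ (iteratedFDeriv ℝ i v) x h := by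
  induction i generalizing x with
  | zero =>
    ext m
    rw [iteratedFDeriv_zero_eq_comp]
    rw [iteratedFDeriv_zero_eq_comp, LinearIsometryEquiv.comp_fderiv']
    simp
  | succ i ih =>
    have hw : ContDiff ℝ ∞ (iteratedFDeriv ℝ i v) :=
      hv.iteratedFDeriv_right (m := ∞) (by exact_mod_cast le_top)
    have hd : ContDiff ℝ ∞ (fderiv ℝ (iteratedFDeriv ℝ i v)) :=
      hw.fderiv_right (m := ∞) (by simp)
    rw [iteratedFDeriv_succ_eq_comp_left, iteratedFDeriv_succ_eq_comp_left]
    have hcomp := LinearIsometryEquiv.comp_fderiv (𝕜 := ℝ)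
      (F := Spacetime [×(i + 1)]→L[ℝ] ℝ) (iso := (continuousMultilinearCurryLeftEquiv ℝ (fun _ : Fin (i + 1) => Spacetime) ℝ).symm)
      (f := fderiv ℝ (iteratedFDeriv ℝ i v)) (x := x)
    refine Eq.trans ?_ (congrArg (fun L => L h) hcomp).symm
    refine congrArg (continuousMultilinearCurryLeftEquiv ℝ (fun _ : Fin (i + 1) => Spacetime) ℝ).symm ?_
    have : iteratedFDeriv ℝ i (fun y => fderiv ℝ v y h)
        = fun y => fderiv ℝ (iteratedFDeriv ℝ i v) y h := funext ih
    rw [this]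
    ext1 k
    have hsymm : IsSymmSndFDerivAt ℝ (iteratedFDeriv ℝ i v) x :=
      hw.contDiffAt.isSymmSndFDerivAt minSmoothness_two_le
    have hda : DifferentiableAt ℝ (fderiv ℝ (iteratedFDeriv ℝ i v)) x :=
      (hd.differentiable (by simp)) x
    rw [fderiv_clm_apply hda (differentiableAt_const h)]
    simp [hsymm.eq k h]

/-- Compact support makes the derivative uniformly continuous, so the mean value inequality yields a
`δ` that does not depend on the base point `z`. -/
theorem exists_forall_norm_taylor_le {G : Type*} [NormedAddCommGroup G] [NormedSpace ℝ G]
    {w : Spacetime → G} (hw : ContDiff ℝ ∞ w) (hc : HasCompactSupport w) {ε : ℝ} (hε : 0 < ε) :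
    ∃ δ > 0, ∀ h, ‖h‖ < δ → ∀ z, ‖w (z + h) - w z - fderiv ℝ w z h‖ ≤ ε * ‖h‖ := by
  have hcont : Continuous (fderiv ℝ w) := hw.continuous_fderiv (by simp)
  have hu := (hc.fderiv ℝ).uniformContinuous_of_continuous hcont
  obtain ⟨δ, hδ, H⟩ := Metric.uniformContinuous_iff.1 hu ε hε
  refine ⟨δ, hδ, fun h hh z => ?_⟩
  have := (convex_ball z δ).norm_image_sub_le_of_norm_fderiv_le' (𝕜 := ℝ) (f := w)
    (φ := fderiv ℝ w z) (C := ε) (x := z) (y := z + h)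
    (fun x _ => hw.differentiable (by simp) x)
    (fun x hx => by
      have := H (a := x) (b := z) hx
      rw [dist_eq_norm] at this
      exact this.le)
    (Metric.mem_ball_self hδ) (by simpa using hh)
  simpa using this

theorem RTest.tsupport_subset_closedBall (v : RTest) :
    ∃ r : ℝ, ∀ x, v x ≠ 0 → ‖x‖ ≤ r := by
  obtain ⟨r, hr⟩ := v.hasCompactSupport.isCompact.isBounded.subset_closedBall (0 : Spacetime)
  exact ⟨r, fun x hx => by simpa using hr (subset_tsupport _ hx)⟩

/-- A distribution applied to the translates of a test function is differentiable. -/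
theorem hasFDerivAt_apply_shift (T : 𝓓'((⊤ : TopologicalSpace.Opens Spacetime), ℝ)) (v : RTest)
    (x : Spacetime) :
    HasFDerivAt (fun x => T (v.shift x))
      (∑ μ, T ((∂_{dir μ} v : RTest).shift x) • EuclideanSpace.proj (𝕜 := ℝ) μ) x := by
  obtain ⟨r, hr⟩ := v.tsupport_subset_closedBall
  -- For `‖h‖ ≤ 1` the remainder at `y` vanishes unless `‖x + y‖ ≤ r + 1`, so this ball contains its
  -- support for all such `h`.
  let K : TopologicalSpace.Compacts Spacetime :=
    ⟨Metric.closedBall 0 (r + ‖x‖ + 1), isCompact_closedBall _ _⟩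
  obtain ⟨N, M, hM, hb⟩ := exists_seminorm_bound T K
  have hlin : ∀ h : Spacetime, ∑ μ, h μ • (∂_{dir μ} v : RTest).shift x
      = (∂_{h} v : RTest).shift x := by
    intro h
    ext y
    have e : h = ∑ μ, h μ • dir μ := by
      ext i
      simp [dir, Finset.sum_apply, Pi.single_apply]
    rw [RTest.shift_apply, RTest.lineDeriv_apply]
    conv_rhs => rw [e]
    rw [map_sum]
    simp only [map_smul, ← RTest.lineDeriv_apply]
    simp
  let R : Spacetime → RTest := fun h => v.shift (x + h) - v.shift x - (∂_{h} v : RTest).shift x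
  have hR : ∀ h y, R h y = v (x + y + h) - v (x + y) - fderiv ℝ v (x + y) h := by
    intro h y
    change v (x + h + y) - v (x + y) - (∂_{h} v : RTest) (x + y) = _
    rw [RTest.lineDeriv_apply, add_right_comm]
  have hvz : ∀ y, r < ‖y‖ → fderiv ℝ v y = 0 := by
    intro y hy
    have : v =ᶠ[𝓝 y] fun _ => (0 : ℝ) := by
      filter_upwards [(isOpen_lt continuous_const continuous_norm).mem_nhds hy] with z hz
      by_contra hne
      exact absurd (hr z hne) (not_le.2 hz)
    rw [this.fderiv_eq]
    simp
  have hRsupp : ∀ h, ‖h‖ ≤ 1 → Function.support (R h) ⊆ K := by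
    intro h hh y hy
    by_contra hyK
    have hy' : r + ‖x‖ + 1 < ‖y‖ := by simpa [K] using hyK
    have h1 : ‖y‖ ≤ ‖x + y‖ + ‖x‖ := by
      have := norm_sub_le (x + y) x
      simpa using this
    have h2 : ‖x + y‖ ≤ ‖x + y + h‖ + ‖h‖ := by
      have := norm_sub_le (x + y + h) h
      simpa using this
    refine hy ?_
    rw [hR, hvz _ (by linarith)]
    have e1 : v (x + y) = 0 := by
      by_contra hne
      linarith [hr _ hne]
    have e2 : v (x + y + h) = 0 := by
      by_contra hne
      linarith [hr _ hne]
    simp [e1, e2]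
  have hRd : ∀ h i y, iteratedFDeriv ℝ i (R h) y
      = iteratedFDeriv ℝ i v (x + y + h) - iteratedFDeriv ℝ i v (x + y)
        - fderiv ℝ (iteratedFDeriv ℝ i v) (x + y) h := by
    intro h i y
    have e : (R h : Spacetime → ℝ)
        = ((fun y => v ((x + h) + y)) - (fun y => v (x + y))) - fun y => fderiv ℝ v (x + y) h := by
      funext y
      rw [hR]
      simp [add_right_comm]
    have hvi : ContDiff ℝ i v := v.smooth.of_le (by exact_mod_cast le_top)
    have c1 : ContDiff ℝ i (fun y => v ((x + h) + y)) := hvi.comp (contDiff_const.add contDiff_id)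
    have c2 : ContDiff ℝ i (fun y => v (x + y)) := hvi.comp (contDiff_const.add contDiff_id)
    have c3' : ContDiff ℝ ∞ (fun y => fderiv ℝ v y h) :=
      (v.smooth.fderiv_right (m := ∞) (by simp)).clm_apply contDiff_const
    have c3 : ContDiff ℝ i (fun y => fderiv ℝ v (x + y) h) :=
      (c3'.of_le (by exact_mod_cast le_top)).comp (contDiff_const.add contDiff_id)
    rw [e, iteratedFDeriv_sub (f := (fun y => v ((x + h) + y)) - (fun y => v (x + y))) (c1.sub c2) c3, iteratedFDeriv_sub c1 c2]
    simp only [Pi.sub_apply]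
    rw [iteratedFDeriv_comp_add_left, iteratedFDeriv_comp_add_left,
      iteratedFDeriv_comp_add_left (f := fun y => fderiv ℝ v y h),
      iteratedFDeriv_fderiv_apply v.smooth, add_right_comm]
  rw [hasFDerivAt_iff_isLittleO_nhds_zero, Asymptotics.isLittleO_iff]
  intro c hc
  -- The denominator is `M + 1` because `M` may be zero; then `M * (c / (M + 1)) ≤ c`.
  have hc' : 0 < c / (M + 1) := by positivity
  have hδ : ∀ i : ℕ, ∃ δ > 0, ∀ h, ‖h‖ < δ → ∀ z,
      ‖iteratedFDeriv ℝ i v (z + h) - iteratedFDeriv ℝ i v z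
        - fderiv ℝ (iteratedFDeriv ℝ i v) z h‖ ≤ c / (M + 1) * ‖h‖ := fun i =>
    exists_forall_norm_taylor_le
      (v.smooth.iteratedFDeriv_right (m := ∞) (by exact_mod_cast le_top))
      (v.hasCompactSupport.iteratedFDeriv i) hc'
  choose δ hδ0 hδ using hδ
  have hev : ∀ᶠ h : Spacetime in 𝓝 0, ‖h‖ < 1 ∧ ∀ i ∈ Finset.range (N + 1), ‖h‖ < δ i := by
    refine Filter.Eventually.and ?_ ((Finset.eventually_all _).2 fun i _ => ?_)
    · filter_upwards [Metric.ball_mem_nhds (0 : Spacetime) one_pos] with h hh using by simpa using hh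
    · filter_upwards [Metric.ball_mem_nhds (0 : Spacetime) (hδ0 i)] with h hh using by simpa using hh
  filter_upwards [hev] with h hh
  have hT : T (v.shift (x + h)) - T (v.shift x)
      - (∑ μ, T ((∂_{dir μ} v : RTest).shift x) • EuclideanSpace.proj (𝕜 := ℝ) μ) h = T (R h) := by
    simp only [R, map_sub]
    rw [← hlin h, map_sum]
    rw [sum_apply]
    congr 1
    refine Finset.sum_congr rfl fun μ _ => ?_
    rw [map_smul]
    exact mul_comm _ _
  rw [hT]
  refine (hb (R h) (c / (M + 1) * ‖h‖) (by positivity) (hRsupp h hh.1.le) fun i hi y => ?_).trans ?_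
  · rw [hRd]
    exact hδ i h (hh.2 i (by simpa using Nat.lt_succ_of_le hi)) _
  · rw [← mul_assoc]
    refine mul_le_mul_of_nonneg_right ?_ (norm_nonneg _)
    rw [mul_div_assoc', div_le_iff₀ (by positivity)]
    nlinarith

/-- The derivative is a combination of functions of the same kind, with `∂_μ v` in place of `v`, so
the order of differentiability can be raised one at a time. -/
theorem contDiff_apply_shift (T : 𝓓'((⊤ : TopologicalSpace.Opens Spacetime), ℝ)) (v : RTest) :
    ContDiff ℝ ∞ fun x => T (v.shift x) := by
  rw [contDiff_infty]
  intro n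
  induction n generalizing v with
  | zero =>
    exact contDiff_zero.2 (continuous_iff_continuousAt.2 fun x =>
      (hasFDerivAt_apply_shift T v x).continuousAt)
  | succ n ih =>
    have : ((n + 1 : ℕ) : WithTop ℕ∞) = n + 1 := by norm_cast
    rw [this, contDiff_succ_iff_hasFDerivAt]
    exact ⟨_, ContDiff.sum fun μ _ => (ih _).smul contDiff_const, hasFDerivAt_apply_shift T v⟩

end StringYM

end

open scoped Distributions LineDeriv PowerSeries Pointwise ContDiff Topology

noncomputable section

namespace StringYM

/-! ### Tame functions -/

variable {C : ProperCone ℝ Spacetime} {F G : Type*} [NormedAddCommGroup F] [NormedSpace ℝ F]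
  [NormedAddCommGroup G] [NormedSpace ℝ G]

/-- Smooth functions whose support meets every `K + C` (`K` compact) in a compact set. -/
def Tame (C : ProperCone ℝ Spacetime) (u : Spacetime → F) : Prop :=
  ContDiff ℝ ∞ u ∧
    ∀ K : Set Spacetime, IsCompact K → IsCompact (tsupport u ∩ (K + (C : Set Spacetime)))

theorem isClosed_compact_add_cone {K : Set Spacetime} (hK : IsCompact K) :
    IsClosed (K + (C : Set Spacetime)) :=
  C.isClosed.add_left_of_isCompact hK

theorem Tame.of_tsupport_subset {u : Spacetime → F} {v : Spacetime → G} (hv : Tame C v)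
    (hu : ContDiff ℝ ∞ u) (h : tsupport u ⊆ tsupport v) : Tame C u :=
  ⟨hu, fun K hK => (hv.2 K hK).of_isClosed_subset
    ((isClosed_tsupport u).inter (isClosed_compact_add_cone hK))
    (Set.inter_subset_inter_left _ h)⟩

theorem Tame.of_hasCompactSupport {u : Spacetime → F} (hu : ContDiff ℝ ∞ u)
    (hc : HasCompactSupport u) : Tame C u :=
  ⟨hu, fun _ hK => hc.isCompact.inter_right (isClosed_compact_add_cone hK)⟩

theorem Tame.zero : Tame C (0 : Spacetime → F) :=
  Tame.of_hasCompactSupport contDiff_const HasCompactSupport.zero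

theorem Tame.add {u v : Spacetime → F} (hu : Tame C u) (hv : Tame C v) : Tame C (u + v) := by
  refine ⟨hu.1.add hv.1, fun K hK => ?_⟩
  refine ((hu.2 K hK).union (hv.2 K hK)).of_isClosed_subset
    ((isClosed_tsupport _).inter (isClosed_compact_add_cone hK)) ?_
  rw [← Set.union_inter_distrib_right]
  exact Set.inter_subset_inter_left _ (tsupport_add u v)

theorem Tame.sum {κ : Type*} (s : Finset κ) {u : κ → Spacetime → F} (h : ∀ k ∈ s, Tame C (u k)) :
    Tame C (∑ k ∈ s, u k) :=
  Finset.sum_induction _ (Tame C) (fun _ _ => Tame.add) Tame.zero h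

theorem Tame.clm {u : Spacetime → F} (hu : Tame C u) (L : F →L[ℝ] G) : Tame C fun x => L (u x) :=
  hu.of_tsupport_subset (L.contDiff.comp hu.1) (tsupport_comp_subset (map_zero L) u)

theorem Tame.const_smul {u : Spacetime → ℂ} (hu : Tame C u) (z : ℂ) : Tame C (z • u) :=
  hu.clm (z • ContinuousLinearMap.id ℝ ℂ)

theorem Tame.mul {u v : Spacetime → ℂ} (hu : Tame C u) (hv : Tame C v) : Tame C (u * v) :=
  hu.of_tsupport_subset (hu.1.mul hv.1) (closure_mono (by
    intro x hx hu0
    exact hx (by simp [hu0])))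

theorem Tame.re {u : Spacetime → ℂ} (hu : Tame C u) : Tame C fun x => (u x).re :=
  hu.clm Complex.reCLM

theorem Tame.im {u : Spacetime → ℂ} (hu : Tame C u) : Tame C fun x => (u x).im :=
  hu.clm Complex.imCLM

theorem Tame.ofReal {u : Spacetime → ℝ} (hu : Tame C u) : Tame C fun x => (u x : ℂ) :=
  hu.clm Complex.ofRealCLM

/-- The partial derivative of a function on Minkowski space. -/
def partialDeriv (μ : Fin 4) (u : Spacetime → F) : Spacetime → F := fun x => fderiv ℝ u x (dir μ)

theorem contDiff_partialDeriv {u : Spacetime → F} (hu : ContDiff ℝ ∞ u) (μ : Fin 4) :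
    ContDiff ℝ ∞ (partialDeriv μ u) :=
  (hu.fderiv_right (m := ∞) (by simp)).clm_apply contDiff_const

theorem partialDeriv_add {u v : Spacetime → F} (hu : ContDiff ℝ ∞ u) (hv : ContDiff ℝ ∞ v)
    (μ : Fin 4) : partialDeriv μ (u + v) = partialDeriv μ u + partialDeriv μ v := by
  funext x
  simp only [partialDeriv, Pi.add_apply]
  rw [fderiv_add (hu.differentiable (by simp) x) (hv.differentiable (by simp) x)]
  rfl

theorem partialDeriv_zero (μ : Fin 4) : partialDeriv μ (0 : Spacetime → F) = 0 := by
  funext x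
  simp [partialDeriv]

theorem partialDeriv_clm {u : Spacetime → F} (hu : ContDiff ℝ ∞ u) (L : F →L[ℝ] G) (μ : Fin 4)
    (x : Spacetime) : partialDeriv μ (fun y => L (u y)) x = L (partialDeriv μ u x) := by
  have := (L.hasFDerivAt.comp x (hu.differentiable (by simp) x).hasFDerivAt).fderiv
  simp only [partialDeriv]
  change fderiv ℝ (L ∘ u) x (dir μ) = _
  rw [this]
  rfl

theorem partialDeriv_smul {u : Spacetime → ℂ} (hu : ContDiff ℝ ∞ u) (z : ℂ) (μ : Fin 4) :
    partialDeriv μ (z • u) = z • partialDeriv μ u :=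
  funext fun x => partialDeriv_clm hu (z • ContinuousLinearMap.id ℝ ℂ) μ x

theorem partialDeriv_mul {u v : Spacetime → ℂ} (hu : ContDiff ℝ ∞ u) (hv : ContDiff ℝ ∞ v)
    (μ : Fin 4) : partialDeriv μ (u * v) = partialDeriv μ u * v + u * partialDeriv μ v := by
  funext x
  simp only [partialDeriv, Pi.add_apply, Pi.mul_apply]
  rw [fderiv_mul (hu.differentiable (by simp) x) (hv.differentiable (by simp) x)]
  simp
  ring

theorem partialDeriv_sum {κ : Type*} (s : Finset κ) {u : κ → Spacetime → F}
    (h : ∀ k ∈ s, ContDiff ℝ ∞ (u k)) (μ : Fin 4) :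
    partialDeriv μ (∑ k ∈ s, u k) = ∑ k ∈ s, partialDeriv μ (u k) := by
  funext x
  rw [Finset.sum_apply]
  simp only [partialDeriv]
  have := fderiv_sum (𝕜 := ℝ) (x := x) (u := s) (A := u)
    fun k hk => (h k hk).differentiable (by simp) x
  rw [this]
  simp

theorem Tame.partialDeriv {u : Spacetime → F} (hu : Tame C u) (μ : Fin 4) :
    Tame C (partialDeriv μ u) :=
  hu.of_tsupport_subset (contDiff_partialDeriv hu.1 μ)
    (closure_minimal (fun x hx => by
      by_contra h
      exact hx (by simp [StringYM.partialDeriv, fderiv_of_notMem_tsupport (𝕜 := ℝ) h]))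
      (isClosed_tsupport u))

/-! ### Distributions with support in a closed set -/

/-- Independence of the choice made in `evalNear`: two admissible test functions differ by one whose
closed support avoids `S`. -/
theorem evalNear_eq {T : 𝓓'((⊤ : TopologicalSpace.Opens Spacetime), F)} {S : Set Spacetime}
    (hT : Distribution.IsVanishingOn T Sᶜ) {f : Spacetime → ℝ} (ψ : RTest)
    (h : ψ =ᶠ[𝓝ˢ S] f) : evalNear T S f = T ψ := by
  have hex : ∃ ψ : RTest, ψ =ᶠ[𝓝ˢ S] f := ⟨ψ, h⟩
  rw [evalNear, dif_pos hex, ← sub_eq_zero, ← map_sub]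
  refine hT _ fun x hx hxS => ?_
  have hz : ∀ᶠ y in 𝓝ˢ S, (hex.choose - ψ : RTest) y = 0 := by
    filter_upwards [hex.choose_spec, h] with y h1 h2
    change hex.choose y - ψ y = 0
    rw [h1, h2, sub_self]
  have : ∀ᶠ y in 𝓝 x, (hex.choose - ψ : RTest) y = 0 :=
    Filter.Eventually.filter_mono (nhds_le_nhdsSet hxS) hz
  exact notMem_tsupport_iff_eventuallyEq.2 this hx

/-- A tame function agrees with a test function on all `x + C` for `x` near a given point. -/
theorem Tame.exists_test {u : Spacetime → ℝ} (hu : Tame C u) (x₀ : Spacetime) :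
    ∃ v : RTest, ∀ᶠ x in 𝓝 x₀, v.shift x =ᶠ[𝓝ˢ (C : Set Spacetime)] fun y => u (x + y) := by
  -- The radius 2 leaves room 1 for moving `x` near `x₀` and room 1 for a neighbourhood of the cone.
  obtain ⟨R, hR⟩ := (hu.2 _ (isCompact_closedBall x₀ 2)).isBounded.subset_closedBall
    (0 : Spacetime)
  let χ : ContDiffBump (0 : Spacetime) := ⟨max R 1, max R 1 + 1, by positivity, by simp⟩
  let v : RTest := RTest.ofSmooth (fun x => χ x * u x) (χ.contDiff.mul hu.1)
    (χ.hasCompactSupport.mul_right)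
  refine ⟨v, ?_⟩
  filter_upwards [Metric.ball_mem_nhds x₀ one_pos] with x hx
  filter_upwards [Metric.thickening_mem_nhdsSet (C : Set Spacetime) one_pos] with y hy
  obtain ⟨c, hc, hyc⟩ := Metric.mem_thickening_iff.1 hy
  change χ (x + y) * u (x + y) = u (x + y)
  by_cases h0 : u (x + y) = 0
  · simp [h0]
  · have hmem : x + y ∈ Metric.closedBall (0 : Spacetime) R := by
      refine hR ⟨subset_tsupport _ h0, Set.mem_add.2 ⟨x + (y - c), ?_, c, hc, by abel⟩⟩
      rw [Metric.mem_closedBall, dist_eq_norm]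
      have h1 : ‖x - x₀‖ < 1 := by simpa [dist_eq_norm] using hx
      have h2 : ‖y - c‖ < 1 := by simpa [dist_eq_norm] using hyc
      calc ‖x + (y - c) - x₀‖ = ‖(x - x₀) + (y - c)‖ := by congr 1; abel
        _ ≤ ‖x - x₀‖ + ‖y - c‖ := norm_add_le _ _
        _ ≤ 2 := by linarith
    rw [χ.one_of_mem_closedBall (Metric.closedBall_subset_closedBall (le_max_left R 1) hmem),
      one_mul]

/-! ### String integration of functions -/

/-- The string integral of a real function. -/
def realInt (s : StringFunction) (μ : Fin 4) (u : Spacetime → ℝ) : Spacetime → ℝ :=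
  fun x => evalNear (s.c μ) (s.cone : Set Spacetime) fun y => u (x + y)

variable {s : StringFunction}

theorem realInt_eq (μ : Fin 4) {u : Spacetime → ℝ} {v : RTest} {x : Spacetime}
    (h : v.shift x =ᶠ[𝓝ˢ (s.cone : Set Spacetime)] fun y => u (x + y)) :
    realInt s μ u x = s.c μ (v.shift x) :=
  evalNear_eq (s.support μ) _ h

theorem realInt_add (μ : Fin 4) {u v : Spacetime → ℝ} (hu : Tame s.cone u) (hv : Tame s.cone v) :
    realInt s μ (u + v) = realInt s μ u + realInt s μ v := by
  funext x
  obtain ⟨u', hu'⟩ := hu.exists_test x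
  obtain ⟨v', hv'⟩ := hv.exists_test x
  have hu' := hu'.self_of_nhds
  have hv' := hv'.self_of_nhds
  rw [Pi.add_apply, realInt_eq μ hu', realInt_eq μ hv', ← map_add]
  refine evalNear_eq (s.support μ) (u'.shift x + v'.shift x) ?_
  filter_upwards [hu', hv'] with y h1 h2
  change u'.shift x y + v'.shift x y = u (x + y) + v (x + y)
  rw [h1, h2]

theorem realInt_smul (μ : Fin 4) (r : ℝ) {u : Spacetime → ℝ} (hu : Tame s.cone u) :
    realInt s μ (r • u) = r • realInt s μ u := by
  funext x
  obtain ⟨u', hu'⟩ := hu.exists_test x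
  have hu' := hu'.self_of_nhds
  rw [Pi.smul_apply, realInt_eq μ hu', ← map_smul]
  refine evalNear_eq (s.support μ) (r • u'.shift x) ?_
  filter_upwards [hu'] with y h1
  change r • u'.shift x y = r • u (x + y)
  rw [h1]

theorem realInt_zero (μ : Fin 4) : realInt s μ 0 = 0 := by
  have := realInt_smul (s := s) μ 0 (u := 0) Tame.zero
  simpa using this

theorem partialDeriv_eventuallyEq {u : Spacetime → ℝ} {v : RTest} {x : Spacetime} (ν : Fin 4)
    (h : v.shift x =ᶠ[𝓝ˢ (C : Set Spacetime)] fun y => u (x + y)) :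
    (∂_{dir ν} v : RTest).shift x =ᶠ[𝓝ˢ (C : Set Spacetime)] fun y => partialDeriv ν u (x + y) := by
  obtain ⟨U, hU, hCU, h'⟩ := eventually_nhdsSet_iff_exists.1 h
  filter_upwards [hU.mem_nhdsSet.2 hCU] with y hyU
  have hy : ∀ᶠ z in 𝓝 y, v.shift x z = u (x + z) :=
    Filter.mem_of_superset (hU.mem_nhds hyU) h'
  rw [RTest.shift_apply, RTest.lineDeriv_apply, partialDeriv]
  have e : v =ᶠ[𝓝 (x + y)] u := by
    have hcont : Filter.Tendsto (fun z => z - x) (𝓝 (x + y)) (𝓝 y) := by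
      have : Continuous fun z : Spacetime => z - x := by fun_prop
      simpa using this.tendsto (x + y)
    filter_upwards [hcont.eventually hy] with z hz
    simpa using hz
  rw [e.fderiv_eq]

/-- A single test function represents the string integral of `u` near `x` and those of all its
partial derivatives at `x`; smoothness and commutation with `∂_ν` are thereby reduced to test
functions. -/
theorem hasFDerivAt_realInt (μ : Fin 4) {u : Spacetime → ℝ} (hu : Tame s.cone u) (x : Spacetime) :
    ∃ v : RTest, realInt s μ u =ᶠ[𝓝 x] (fun x => s.c μ (v.shift x)) ∧
      ∀ ν, realInt s μ (partialDeriv ν u) x = s.c μ ((∂_{dir ν} v : RTest).shift x) := by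
  obtain ⟨v, hv⟩ := hu.exists_test x
  refine ⟨v, hv.mono fun y hy => realInt_eq μ hy, fun ν => ?_⟩
  exact realInt_eq μ (partialDeriv_eventuallyEq ν hv.self_of_nhds)

theorem contDiff_realInt (μ : Fin 4) {u : Spacetime → ℝ} (hu : Tame s.cone u) :
    ContDiff ℝ ∞ (realInt s μ u) := by
  rw [contDiff_iff_contDiffAt]
  intro x
  obtain ⟨v, hv, -⟩ := hasFDerivAt_realInt μ hu x
  exact (contDiff_apply_shift (s.c μ) v).contDiffAt.congr_of_eventuallyEq hv

theorem partialDeriv_realInt (μ ν : Fin 4) {u : Spacetime → ℝ} (hu : Tame s.cone u) :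
    partialDeriv ν (realInt s μ u) = realInt s μ (partialDeriv ν u) := by
  funext x
  obtain ⟨v, hv, hd⟩ := hasFDerivAt_realInt μ hu x
  rw [hd, partialDeriv, hv.fderiv_eq, (hasFDerivAt_apply_shift (s.c μ) v x).fderiv, sum_apply]
  simp [dir]

/-- Pair `∂_μ c^μ = δ` with the translate of a test function; the sign is that of integration by
parts. The apex `0` lies in the cone, so the test function has the value `u x` at `x`. -/
theorem sum_realInt_partialDeriv {u : Spacetime → ℝ} (hu : Tame s.cone u) (x : Spacetime) :
    ∑ μ, realInt s μ (partialDeriv μ u) x = -u x := by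
  obtain ⟨v, hv⟩ := hu.exists_test x
  have hv := hv.self_of_nhds
  have h0 : v x = u x := by
    have : (0 : Spacetime) ∈ (s.cone : Set Spacetime) := s.cone.zero_mem
    simpa using Filter.Eventually.self_of_nhds
      (Filter.Eventually.filter_mono (nhds_le_nhdsSet this) hv)
  have hd := congrArg (fun T : 𝓓'((⊤ : TopologicalSpace.Opens Spacetime), ℝ) => T (v.shift x))
    s.divergence
  simp only [sum_apply, Distribution.lineDerivOp_apply_apply,
    Distribution.delta_apply, RTest.shift_apply, add_zero, map_neg, Finset.sum_neg_distrib] at hd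
  rw [← h0, ← hd, neg_neg]
  refine Finset.sum_congr rfl fun μ _ => ?_
  rw [realInt_eq μ (partialDeriv_eventuallyEq μ hv)]
  congr 1
  ext y
  rw [RTest.shift_apply, RTest.lineDeriv_apply, RTest.lineDeriv_apply]
  have : (v.shift x : Spacetime → ℝ) = fun y => v (x + y) := rfl
  rw [this, fderiv_comp_add_left]

/-! ### Salient cones and the support of string integrals. -/

/-- In a closed cone without lines, summands are controlled by the sum. -/
theorem exists_norm_le_norm_add (hC : ∀ y ∈ C, -y ∈ C → y = 0) :
    ∃ κ > 0, ∀ a ∈ C, ∀ b ∈ C, κ * ‖a‖ ≤ ‖a + b‖ := by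
  -- The sums `a + b` with `‖a‖ = 1` form a closed set which misses `0` because the cone is salient.
  -- Hence it misses a ball around `0`, whose radius is `κ`; the general case follows by scaling.
  have hS : IsCompact (Metric.sphere (0 : Spacetime) 1 ∩ C) :=
    (isCompact_sphere _ _).inter_right C.isClosed
  have hcl := isClosed_compact_add_cone (C := C) hS
  have h0 : (0 : Spacetime) ∉ (Metric.sphere (0 : Spacetime) 1 ∩ C) + (C : Set Spacetime) := by
    rintro ⟨a, ⟨ha1, ha⟩, b, hb, hab⟩
    have : -a ∈ C := by
      have e : -a = b := neg_eq_of_add_eq_zero_right hab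
      rw [e]
      exact hb
    have := hC a ha this
    simp [this] at ha1
  obtain ⟨κ, hκ, hball⟩ := Metric.isOpen_iff.1 hcl.isOpen_compl 0 h0
  refine ⟨κ, hκ, fun a ha b hb => ?_⟩
  by_contra hlt
  push Not at hlt
  have ha0 : 0 < ‖a‖ := by
    rcases (norm_nonneg a).eq_or_lt with h | h
    · rw [← h, mul_zero] at hlt
      exact absurd hlt (not_lt.2 (norm_nonneg _))
    · exact h
  have hmem : ‖a‖⁻¹ • (a + b) ∈ Metric.ball (0 : Spacetime) κ := by
    rw [mem_ball_zero_iff, norm_smul, norm_inv, norm_norm, inv_mul_lt_iff₀ ha0, mul_comm]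
    exact hlt
  refine hball hmem ?_
  rw [smul_add]
  refine Set.add_mem_add ⟨?_, ?_⟩ ?_
  · simp [norm_smul, ha0.ne']
  · exact C.smul_mem ha (by positivity)
  · exact C.smul_mem hb (by positivity)

/-- If `z = a + b = a' - b'` with `b, b'` in the cone, then `b + b' = a' - a` is bounded, and
salience bounds `b` itself. -/
theorem isCompact_add_cone_inter_sub_cone (hC : ∀ y ∈ C, -y ∈ C → y = 0) {P Q : Set Spacetime}
    (hP : IsCompact P) (hQ : IsCompact Q) :
    IsCompact ((P + (C : Set Spacetime)) ∩ (Q - (C : Set Spacetime))) := by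
  obtain ⟨κ, hκ, h⟩ := exists_norm_le_norm_add hC
  obtain ⟨p, hp⟩ := hP.isBounded.exists_norm_le
  obtain ⟨q, hq⟩ := hQ.isBounded.exists_norm_le
  refine (isCompact_closedBall (0 : Spacetime) (p + (q + p) / κ)).of_isClosed_subset
    ((isClosed_compact_add_cone hP).inter ?_) ?_
  · rw [sub_eq_add_neg]
    exact IsClosed.add_left_of_isCompact C.isClosed.neg hQ
  · rintro z ⟨⟨a, ha, b, hb, hab⟩, ⟨a', ha', b', hb', hab'⟩⟩
    have hab : a + b = z := hab
    have hab' : a' - b' = z := hab'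
    have e : b + b' = a' - a := by
      have : b + b' = (a + b) - (a' - b') + (a' - a) := by abel
      rw [this, hab, hab', sub_self, zero_add]
    have h1 := h b hb b' hb'
    rw [e] at h1
    have h2 : ‖a' - a‖ ≤ q + p := (norm_sub_le _ _).trans (add_le_add (hq _ ha') (hp _ ha))
    have h3 : ‖b‖ ≤ (q + p) / κ := by
      rw [le_div_iff₀ hκ]
      linarith
    rw [mem_closedBall_zero_iff, ← hab]
    exact (norm_add_le _ _).trans (add_le_add (hp _ ha) h3)

/-- The integral can be nonzero at `x` only if `x + C` meets the support of `u`. Within `K + C` this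
confines `x` to a set of the form `(P + C) ∩ (Q - C)` with compact `P` and `Q`. This closure
property allows string integrations to be iterated. -/
theorem Tame.realInt (μ : Fin 4) {u : Spacetime → ℝ} (hu : Tame s.cone u) :
    Tame s.cone (realInt s μ u) := by
  have hsupp : ∀ x, StringYM.realInt s μ u x ≠ 0 → ∃ c ∈ s.cone, x + c ∈ tsupport u := by
    intro x hx
    by_contra hno
    push Not at hno
    refine hx ?_
    have : (0 : RTest) =ᶠ[𝓝ˢ (s.cone : Set Spacetime)] fun y => u (x + y) := by
      rw [Filter.EventuallyEq, Filter.Eventually, mem_nhdsSet_iff_forall]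
      intro c hc
      have h1 : ∀ᶠ z in 𝓝 (x + c), u z = 0 := notMem_tsupport_iff_eventuallyEq.1 (hno c hc)
      have h2 : Filter.Tendsto (fun y => x + y) (𝓝 c) (𝓝 (x + c)) :=
        (continuous_const.add continuous_id).tendsto c
      filter_upwards [h2.eventually h1] with y hy
      exact hy.symm
    rw [StringYM.realInt, evalNear_eq (s.support μ) 0 this, map_zero]
  refine ⟨contDiff_realInt μ hu, fun K hK => ?_⟩
  -- A point of the closed support is only a limit of points where the integral is nonzero; these
  -- may leave `K + C`, but stay within distance 1.
  have hK' : IsCompact (K + Metric.closedBall (0 : Spacetime) 1) :=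
    hK.add (isCompact_closedBall _ _)
  have hM := isCompact_add_cone_inter_sub_cone s.salient hK' (hu.2 _ hK')
  refine hM.of_isClosed_subset ((isClosed_tsupport _).inter (isClosed_compact_add_cone hK)) ?_
  rintro z ⟨hz, k, hk, c, hc, hkc⟩
  have hkc : k + c = z := hkc
  have hz' : z ∈ closure (Function.support (StringYM.realInt s μ u) ∩ Metric.ball z 1) :=
    mem_closure_iff_nhds.2 fun t ht => by
      obtain ⟨w, ⟨hw1, hw2⟩, hw3⟩ := mem_closure_iff_nhds.1 hz _
        (Filter.inter_mem ht (Metric.ball_mem_nhds z one_pos))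
      exact ⟨w, hw1, hw3, hw2⟩
  refine closure_minimal ?_ hM.isClosed hz'
  rintro w ⟨hw, hwz⟩
  have hwK : w ∈ K + Metric.closedBall (0 : Spacetime) 1 + (s.cone : Set Spacetime) := by
    refine Set.mem_add.2 ⟨k + (w - z), Set.add_mem_add hk ?_, c, hc, ?_⟩
    · rw [mem_closedBall_zero_iff, ← dist_eq_norm]
      exact (Metric.mem_ball.1 hwz).le
    · rw [← hkc]
      abel
  refine ⟨hwK, ?_⟩
  obtain ⟨c', hc', hwc⟩ := hsupp w hw
  refine Set.mem_sub.2 ⟨w + c', ⟨hwc, ?_⟩, c', hc', by abel⟩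
  obtain ⟨a, ha, b, hb, hab⟩ := hwK
  have hab : a + b = w := hab
  refine Set.mem_add.2 ⟨a, ha, b + c', s.cone.add_mem hb hc', ?_⟩
  rw [← hab]
  abel

/-! ### String integration of complex functions. -/

/-- The string integral of a complex function. -/
def funInt (s : StringFunction) (μ : Fin 4) (u : Spacetime → ℂ) : Spacetime → ℂ :=
  fun x => (realInt s μ (fun y => (u y).re) x : ℂ)
    + Complex.I * (realInt s μ (fun y => (u y).im) x : ℂ)

theorem funInt_add (μ : Fin 4) {u v : Spacetime → ℂ} (hu : Tame s.cone u) (hv : Tame s.cone v) :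
    funInt s μ (u + v) = funInt s μ u + funInt s μ v := by
  funext x
  have h1 := congrFun (realInt_add μ hu.re hv.re) x
  have h2 := congrFun (realInt_add μ hu.im hv.im) x
  have e1 : (fun y => ((u + v) y).re) = (fun y => (u y).re) + fun y => (v y).re := by
    funext y; simp
  have e2 : (fun y => ((u + v) y).im) = (fun y => (u y).im) + fun y => (v y).im := by
    funext y; simp
  rw [Pi.add_apply, funInt, e1, e2, h1, h2]
  simp only [funInt, Pi.add_apply]
  push_cast
  ring

theorem funInt_smul (μ : Fin 4) (z : ℂ) {u : Spacetime → ℂ} (hu : Tame s.cone u) :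
    funInt s μ (z • u) = z • funInt s μ u := by
  funext x
  have key : ∀ a b : ℝ, realInt s μ (a • (fun y => (u y).re) + b • fun y => (u y).im) x
      = a * realInt s μ (fun y => (u y).re) x + b * realInt s μ (fun y => (u y).im) x := by
    intro a b
    have ha : Tame s.cone (a • fun y => (u y).re) := hu.re.clm (a • ContinuousLinearMap.id ℝ ℝ)
    have hb : Tame s.cone (b • fun y => (u y).im) := hu.im.clm (b • ContinuousLinearMap.id ℝ ℝ)
    rw [realInt_add μ ha hb, realInt_smul μ a hu.re, realInt_smul μ b hu.im]
    rfl
  have e1 : (fun y => ((z • u) y).re)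
      = z.re • (fun y => (u y).re) + (-z.im) • fun y => (u y).im := by
    funext y; simp; ring
  have e2 : (fun y => ((z • u) y).im)
      = z.im • (fun y => (u y).re) + z.re • fun y => (u y).im := by
    funext y; simp; ring
  rw [Pi.smul_apply, funInt, e1, e2, key, key, smul_eq_mul, funInt]
  conv_rhs => rw [← Complex.re_add_im z]
  push_cast
  linear_combination (-(z.im * realInt s μ (fun y => (u y).im) x : ℂ)) * Complex.I_sq

theorem funInt_zero (μ : Fin 4) : funInt s μ 0 = 0 := by
  simpa using funInt_smul (s := s) μ 0 (u := 0) Tame.zero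

theorem Tame.funInt (μ : Fin 4) {u : Spacetime → ℂ} (hu : Tame s.cone u) :
    Tame s.cone (funInt s μ u) :=
  ((hu.re.realInt μ).ofReal).add (((hu.im.realInt μ).ofReal).const_smul Complex.I)

theorem funInt_sum (μ : Fin 4) {κ : Type*} (t : Finset κ) {u : κ → Spacetime → ℂ}
    (h : ∀ k ∈ t, Tame s.cone (u k)) :
    funInt s μ (∑ k ∈ t, u k) = ∑ k ∈ t, funInt s μ (u k) := by
  classical
  induction t using Finset.induction_on with
  | empty => simp [funInt_zero]
  | insert a t ha ih =>
    rw [Finset.sum_insert ha, Finset.sum_insert ha,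
      funInt_add μ (h a (by simp)) (Tame.sum t fun k hk => h k (by simp [hk])),
      ih fun k hk => h k (by simp [hk])]

theorem partialDeriv_re {u : Spacetime → ℂ} (hu : ContDiff ℝ ∞ u) (ν : Fin 4) :
    (fun y => (partialDeriv ν u y).re) = partialDeriv ν fun y => (u y).re :=
  funext fun x => (partialDeriv_clm hu Complex.reCLM ν x).symm

theorem partialDeriv_im {u : Spacetime → ℂ} (hu : ContDiff ℝ ∞ u) (ν : Fin 4) :
    (fun y => (partialDeriv ν u y).im) = partialDeriv ν fun y => (u y).im :=
  funext fun x => (partialDeriv_clm hu Complex.imCLM ν x).symm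

theorem partialDeriv_funInt (μ ν : Fin 4) {u : Spacetime → ℂ} (hu : Tame s.cone u) :
    partialDeriv ν (funInt s μ u) = funInt s μ (partialDeriv ν u) := by
  funext x
  have h1 : ContDiff ℝ ∞ fun x => (realInt s μ (fun y => (u y).re) x : ℂ) :=
    (hu.re.realInt μ).ofReal.1
  have h2 : ContDiff ℝ ∞ fun x => (realInt s μ (fun y => (u y).im) x : ℂ) :=
    (hu.im.realInt μ).ofReal.1
  have e : funInt s μ u = (fun x => (realInt s μ (fun y => (u y).re) x : ℂ))
      + Complex.I • fun x => (realInt s μ (fun y => (u y).im) x : ℂ) := rfl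
  have h3 : ContDiff ℝ ∞ (Complex.I • fun x => (realInt s μ (fun y => (u y).im) x : ℂ)) :=
    ((hu.im.realInt μ).ofReal.const_smul Complex.I).1
  rw [e, partialDeriv_add h1 h3, partialDeriv_smul h2, funInt,
    partialDeriv_re hu.1, partialDeriv_im hu.1, ← partialDeriv_realInt μ ν hu.re,
    ← partialDeriv_realInt μ ν hu.im]
  have f1 := partialDeriv_clm (hu.re.realInt μ).1 Complex.ofRealCLM ν x
  have f2 := partialDeriv_clm (hu.im.realInt μ).1 Complex.ofRealCLM ν x
  simp only [Complex.ofRealCLM_apply] at f1 f2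
  simp [f1, f2]

/-- `I_c^μ ∂_μ = -id`. -/
theorem sum_funInt_partialDeriv {u : Spacetime → ℂ} (hu : Tame s.cone u) :
    ∑ μ, funInt s μ (partialDeriv μ u) = -u := by
  funext x
  simp only [Finset.sum_apply, funInt, Finset.sum_add_distrib, ← Finset.mul_sum,
    ← Complex.ofReal_sum, partialDeriv_re hu.1, partialDeriv_im hu.1,
    sum_realInt_partialDeriv hu.re, sum_realInt_partialDeriv hu.im]
  conv_rhs => rw [Pi.neg_apply, ← Complex.re_add_im (u x)]
  push_cast
  ring

theorem funInt_im_eq_zero (μ : Fin 4) {u : Spacetime → ℂ} (hr : ∀ x, (u x).im = 0)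
    (x : Spacetime) : (funInt s μ u x).im = 0 := by
  have : (fun y => (u y).im) = 0 := funext hr
  simp [funInt, this, realInt_zero]

end StringYM

end

open scoped Distributions LineDeriv PowerSeries Pointwise ContDiff Topology

noncomputable section

namespace StringYM

/-! ### Fields depending polynomially on the configuration -/

variable {ι : Type*} {C : ProperCone ℝ Spacetime} {s : StringFunction}

/-- A linear operation on tame functions. -/
structure TameOp (C : ProperCone ℝ Spacetime) (L : (Spacetime → ℂ) → Spacetime → ℂ) : Prop where
  tame : ∀ {u}, Tame C u → Tame C (L u)
  add : ∀ {u v}, Tame C u → Tame C v → L (u + v) = L u + L v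
  smul : ∀ (z : ℂ) {u}, Tame C u → L (z • u) = z • L u

theorem TameOp.zero {L : (Spacetime → ℂ) → Spacetime → ℂ} (hL : TameOp C L) : L 0 = 0 := by
  simpa using hL.smul 0 (u := 0) Tame.zero

theorem TameOp.sum {L : (Spacetime → ℂ) → Spacetime → ℂ} (hL : TameOp C L) {κ : Type*}
    (t : Finset κ) {u : κ → Spacetime → ℂ} (h : ∀ k ∈ t, Tame C (u k)) :
    L (∑ k ∈ t, u k) = ∑ k ∈ t, L (u k) := by
  classical
  induction t using Finset.induction_on with
  | empty => simp [hL.zero]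
  | insert a t ha ih =>
    rw [Finset.sum_insert ha, Finset.sum_insert ha,
      hL.add (h a (by simp)) (Tame.sum t fun k hk => h k (by simp [hk])),
      ih fun k hk => h k (by simp [hk])]

theorem tameOp_partialDeriv (μ : Fin 4) : TameOp C (partialDeriv μ) where
  tame h := h.partialDeriv μ
  add hu hv := partialDeriv_add hu.1 hv.1 μ
  smul z _ hu := partialDeriv_smul hu.1 z μ

theorem tameOp_funInt (μ : Fin 4) : TameOp s.cone (funInt s μ) where
  tame h := h.funInt μ
  add hu hv := funInt_add μ hu hv
  smul z _ hu := funInt_smul μ z hu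

/-- The polynomial `p` with tame coefficients describes the field `X` on the line `A + t B`. -/
def IsLinePoly (X : WickField C ι) (A B : Config C ι) (p : Polynomial (Spacetime → ℂ)) : Prop :=
  (∀ k, Tame C (p.coeff k)) ∧ ∀ t : ℝ, X (A + t • B) = p.eval fun _ => (t : ℂ)

/-- Fields that are polynomial, with tame coefficients, on all lines in configuration space. -/
def Regular (X : WickField C ι) : Prop := ∀ A B, ∃ p, IsLinePoly X A B p

/-- The derivative of a field in the direction of a configuration. -/
def dirDeriv (X : WickField C ι) (A B : Config C ι) : Spacetime → ℂ :=
  fun x => deriv (fun t : ℝ => X (A + t • B) x) 0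

theorem IsLinePoly.apply_self {X : WickField C ι} {A B : Config C ι}
    {p : Polynomial (Spacetime → ℂ)} (h : IsLinePoly X A B p) : X A = p.coeff 0 := by
  have := h.2 0
  rw [zero_smul, add_zero] at this
  rw [this, Polynomial.coeff_zero_eq_eval_zero]
  congr 1

/-- This makes functional differentiation algebraic: the derivative along a line is the linear
coefficient, so the Leibniz rule is the formula for the linear coefficient of a product. -/
theorem IsLinePoly.dirDeriv_eq {X : WickField C ι} {A B : Config C ι}
    {p : Polynomial (Spacetime → ℂ)} (h : IsLinePoly X A B p) : dirDeriv X A B = p.coeff 1 := by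
  funext x
  have e : (fun t : ℝ => X (A + t • B) x)
      = fun t : ℝ => (p.map (Pi.evalRingHom (fun _ => ℂ) x)).eval (t : ℂ) := by
    funext t
    rw [h.2 t]
    exact (Polynomial.eval_map_apply (Pi.evalRingHom (fun _ => ℂ) x) (fun _ => (t : ℂ))).symm
  have hd := ((p.map (Pi.evalRingHom (fun _ => ℂ) x)).hasDerivAt ((0 : ℝ) : ℂ)).comp_ofReal
  rw [dirDeriv, e, hd.deriv]
  rw [Complex.ofReal_zero, ← Polynomial.coeff_zero_eq_eval_zero, Polynomial.coeff_derivative]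
  simp

theorem Regular.tame {X : WickField C ι} (h : Regular X) (A : Config C ι) : Tame C (X A) := by
  obtain ⟨p, hp⟩ := h A 0
  rw [hp.apply_self]
  exact hp.1 0

theorem IsLinePoly.add {X Y : WickField C ι} {A B : Config C ι} {p q : Polynomial (Spacetime → ℂ)}
    (hp : IsLinePoly X A B p) (hq : IsLinePoly Y A B q) : IsLinePoly (X + Y) A B (p + q) :=
  ⟨fun k => by rw [Polynomial.coeff_add]; exact (hp.1 k).add (hq.1 k),
    fun t => by rw [Polynomial.eval_add, ← hp.2, ← hq.2]; rfl⟩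

theorem IsLinePoly.mul {X Y : WickField C ι} {A B : Config C ι} {p q : Polynomial (Spacetime → ℂ)}
    (hp : IsLinePoly X A B p) (hq : IsLinePoly Y A B q) : IsLinePoly (X * Y) A B (p * q) :=
  ⟨fun k => by
    rw [Polynomial.coeff_mul]
    exact Tame.sum _ fun x _ => (hp.1 x.1).mul (hq.1 x.2),
    fun t => by rw [Polynomial.eval_mul, ← hp.2, ← hq.2]; rfl⟩

/-- The parameter `t` is a scalar and the sum over powers is finite, so a linear operation acts
coefficientwise, without any continuity. Consequently `∂_μ` and `I_c^μ` commute with the derivative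
in the configuration. -/
theorem IsLinePoly.op {X : WickField C ι} {A B : Config C ι} {p : Polynomial (Spacetime → ℂ)}
    (hp : IsLinePoly X A B p) {L : (Spacetime → ℂ) → Spacetime → ℂ} (hL : TameOp C L) :
    ∃ q, IsLinePoly (fun A => L (X A)) A B q ∧ ∀ k, q.coeff k = L (p.coeff k) := by
  let q : Polynomial (Spacetime → ℂ) :=
    ∑ k ∈ Finset.range (p.natDegree + 1), Polynomial.monomial k (L (p.coeff k))
  have hq : ∀ k, q.coeff k = L (p.coeff k) := by
    intro k
    simp only [q, Polynomial.finsetSum_coeff, Polynomial.coeff_monomial, Finset.sum_ite_eq',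
      Finset.mem_range]
    split_ifs with hk
    · rfl
    · rw [Polynomial.coeff_eq_zero_of_natDegree_lt (by omega), hL.zero]
  refine ⟨q, ⟨fun k => ?_, fun t => ?_⟩, hq⟩
  · rw [hq]
    exact hL.tame (hp.1 k)
  · have hsm : ∀ k, p.coeff k * (fun _ => (t : ℂ)) ^ k = ((t : ℂ) ^ k) • p.coeff k := by
      intro k
      funext x
      simp [mul_comm]
    change L (X (A + t • B)) = _
    rw [hp.2, Polynomial.eval_eq_sum_range]
    simp only [hsm]
    rw [hL.sum _ fun k _ => (hp.1 k).const_smul _]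
    simp only [q, Polynomial.eval_finsetSum, Polynomial.eval_monomial]
    refine Finset.sum_congr rfl fun k _ => ?_
    rw [hL.smul _ (hp.1 k)]
    funext x
    simp [mul_comm]

theorem Regular.add {X Y : WickField C ι} (hX : Regular X) (hY : Regular Y) : Regular (X + Y) :=
  fun A B => ⟨_, (hX A B).choose_spec.add (hY A B).choose_spec⟩

theorem Regular.mul {X Y : WickField C ι} (hX : Regular X) (hY : Regular Y) : Regular (X * Y) :=
  fun A B => ⟨_, (hX A B).choose_spec.mul (hY A B).choose_spec⟩

theorem Regular.op {X : WickField C ι} (hX : Regular X) {L : (Spacetime → ℂ) → Spacetime → ℂ}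
    (hL : TameOp C L) : Regular (fun A => L (X A)) := fun A B =>
  let ⟨q, hq, _⟩ := (hX A B).choose_spec.op hL
  ⟨q, hq⟩

theorem tameOp_smul (z : ℂ) : TameOp C fun u => z • u where
  tame h := h.const_smul z
  add _ _ := smul_add _ _ _
  smul _ _ _ := smul_comm _ _ _

theorem Regular.const_smul {X : WickField C ι} (hX : Regular X) (z : ℂ) : Regular (z • X) :=
  hX.op (tameOp_smul z)

theorem Regular.pd {X : WickField C ι} (hX : Regular X) (μ : Fin 4) : Regular (pd μ X) :=
  hX.op (tameOp_partialDeriv μ)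

theorem Regular.stringInt {X : WickField s.cone ι} (hX : Regular X) (μ : Fin 4) :
    Regular (stringInt s μ X) :=
  hX.op (tameOp_funInt μ)

theorem Regular.zero : Regular (0 : WickField C ι) := fun _ _ =>
  ⟨0, fun k => by simpa using Tame.zero, fun t => by simp⟩

theorem Config.tame (A : Config C ι) (μ : Fin 4) (a : ι) : Tame C (A.1 μ a) := A.2 μ a

theorem isLinePoly_potential (μ : Fin 4) (a : ι) (A B : Config C ι) :
    IsLinePoly (potential μ a) A B (Polynomial.C (potential μ a A)
      + Polynomial.C (potential μ a B) * Polynomial.X) := by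
  have h : ∀ A : Config C ι, Tame C (potential μ a A) := fun A => (Config.tame A μ a).ofReal
  refine ⟨fun k => ?_, fun t => ?_⟩
  · match k with
    | 0 => simpa using h A
    | 1 => simpa using h B
    | k + 2 =>
      have : (Polynomial.C (potential μ a A)
          + Polynomial.C (potential μ a B) * Polynomial.X).coeff (k + 2) = 0 := by
        simp
      rw [this]
      exact Tame.zero
  · rw [Polynomial.eval_add, Polynomial.eval_mul, Polynomial.eval_C, Polynomial.eval_C,
      Polynomial.eval_X]
    funext x
    change ((A.1 μ a x + t * B.1 μ a x : ℝ) : ℂ) = (A.1 μ a x : ℂ) + (B.1 μ a x : ℂ) * (t : ℂ)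
    push_cast
    ring

theorem Regular.potential (μ : Fin 4) (a : ι) : Regular (potential μ a : WickField C ι) :=
  fun A B => ⟨_, isLinePoly_potential μ a A B⟩

theorem Regular.sum {κ : Type*} (t : Finset κ) {X : κ → WickField C ι}
    (h : ∀ k ∈ t, Regular (X k)) : Regular (∑ k ∈ t, X k) :=
  Finset.sum_induction _ Regular (fun _ _ => Regular.add) Regular.zero h

theorem dirDeriv_add {X Y : WickField C ι} (hX : Regular X) (hY : Regular Y) (A B : Config C ι) :
    dirDeriv (X + Y) A B = dirDeriv X A B + dirDeriv Y A B := by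
  obtain ⟨p, hp⟩ := hX A B
  obtain ⟨q, hq⟩ := hY A B
  rw [hp.dirDeriv_eq, hq.dirDeriv_eq, (hp.add hq).dirDeriv_eq, Polynomial.coeff_add]

theorem dirDeriv_mul {X Y : WickField C ι} (hX : Regular X) (hY : Regular Y) (A B : Config C ι) :
    dirDeriv (X * Y) A B = dirDeriv X A B * Y A + X A * dirDeriv Y A B := by
  obtain ⟨p, hp⟩ := hX A B
  obtain ⟨q, hq⟩ := hY A B
  rw [hp.dirDeriv_eq, hq.dirDeriv_eq, (hp.mul hq).dirDeriv_eq, Polynomial.mul_coeff_one,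
    hp.apply_self, hq.apply_self, add_comm]

theorem dirDeriv_op {X : WickField C ι} (hX : Regular X)
    {L : (Spacetime → ℂ) → Spacetime → ℂ} (hL : TameOp C L) (A B : Config C ι) :
    dirDeriv (fun A => L (X A)) A B = L (dirDeriv X A B) := by
  obtain ⟨p, hp⟩ := hX A B
  obtain ⟨q, hq, hc⟩ := hp.op hL
  rw [hp.dirDeriv_eq, hq.dirDeriv_eq, hc]

theorem dirDeriv_potential (μ : Fin 4) (a : ι) (A B : Config C ι) :
    dirDeriv (potential μ a) A B = potential μ a B := by
  rw [(isLinePoly_potential μ a A B).dirDeriv_eq]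
  simp

theorem dirDeriv_zero (A B : Config C ι) : dirDeriv (0 : WickField C ι) A B = 0 := by
  funext x
  simp [dirDeriv]

theorem dirDeriv_zero_right (X : WickField C ι) (A : Config C ι) : dirDeriv X A 0 = 0 := by
  funext x
  simp [dirDeriv]

/-- Real-valued regular fields. -/
structure RealRegular (X : WickField C ι) : Prop where
  regular : Regular X
  im_eq_zero : ∀ A x, (X A x).im = 0

namespace RealRegular

theorem zero : RealRegular (0 : WickField C ι) := ⟨Regular.zero, fun _ _ => by simp⟩

theorem add {X Y : WickField C ι} (hX : RealRegular X) (hY : RealRegular Y) :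
    RealRegular (X + Y) :=
  ⟨hX.1.add hY.1, fun A x => by simp [hX.2 A x, hY.2 A x]⟩

theorem mul {X Y : WickField C ι} (hX : RealRegular X) (hY : RealRegular Y) :
    RealRegular (X * Y) :=
  ⟨hX.1.mul hY.1, fun A x => by simp [hX.2 A x, hY.2 A x]⟩

theorem const_smul {X : WickField C ι} (hX : RealRegular X) (r : ℝ) :
    RealRegular ((r : ℂ) • X) :=
  ⟨hX.1.const_smul _, fun A x => by simp [hX.2 A x]⟩

theorem sum {κ : Type*} (t : Finset κ) {X : κ → WickField C ι}
    (h : ∀ k ∈ t, RealRegular (X k)) : RealRegular (∑ k ∈ t, X k) :=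
  Finset.sum_induction _ RealRegular (fun _ _ => RealRegular.add) RealRegular.zero h

theorem potential (μ : Fin 4) (a : ι) : RealRegular (potential μ a : WickField C ι) :=
  ⟨Regular.potential μ a, fun A x => by simp [StringYM.potential]⟩

theorem pd {X : WickField C ι} (hX : RealRegular X) (μ : Fin 4) : RealRegular (pd μ X) := by
  refine ⟨hX.1.pd μ, fun A x => ?_⟩
  have h := congrFun (partialDeriv_im (hX.1.tame A).1 μ) x
  have h0 : (fun y => (X A y).im) = 0 := funext fun y => hX.2 A y
  rw [h0, partialDeriv_zero] at h
  exact h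

theorem stringInt {X : WickField s.cone ι} (hX : RealRegular X) (μ : Fin 4) :
    RealRegular (stringInt s μ X) :=
  ⟨hX.1.stringInt μ, fun A x => funInt_im_eq_zero μ (hX.2 A) x⟩

theorem ad [Fintype ι] (f : ι → ι → ι → ℝ) {X Y : ι → WickField C ι}
    (hX : ∀ a, RealRegular (X a)) (hY : ∀ a, RealRegular (Y a)) (e : ι) :
    RealRegular (ad f X Y e) :=
  sum _ fun a _ => sum _ fun b _ => ((hX a).mul (hY b)).const_smul _

end RealRegular

theorem real_smul_eq (r : ℝ) (X : WickField C ι) : r • X = (r : ℂ) • X := by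
  funext A x
  simp

/-! ### The contraction -/

theorem lineDeriv_comm (T : CDist) (u v : Spacetime) :
    (∂_{u} (∂_{v} T : CDist) : CDist) = ∂_{v} (∂_{u} T : CDist) := by
  ext (ψ : RTest)
  simp only [Distribution.lineDerivOp_apply_apply, LineDeriv.lineDerivOp_neg, neg_neg]
  congr 1
  ext x
  have hd : DifferentiableAt ℝ (fderiv ℝ ψ) x :=
    ((RTest.smooth ψ).fderiv_right (m := ∞) (by simp)).differentiable (by simp) x
  have hs : IsSymmSndFDerivAt ℝ ψ x := (RTest.smooth ψ).contDiffAt.isSymmSndFDerivAt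
    minSmoothness_two_le
  have key : ∀ a b : Spacetime, (∂_{a} (∂_{b} ψ : RTest) : RTest) x
      = fderiv ℝ (fderiv ℝ ψ) x a b := by
    intro a b
    have e : ((∂_{b} ψ : RTest) : Spacetime → ℝ) = fun y => fderiv ℝ ψ y b :=
      funext fun y => RTest.lineDeriv_apply ψ b y
    rw [RTest.lineDeriv_apply, e, fderiv_clm_apply hd (differentiableAt_const _)]
    simp
  rw [key, key, hs.eq]

theorem eta_mul_self (μ : Fin 4) : eta μ * eta μ = 1 := by
  unfold eta
  split_ifs <;> norm_num

/-- The null field contributes `η_ν ∂_ν ∂_κ T₀`, which cancels the mixed derivative coming from the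
field strength. What remains is `δ_{νκ} □T₀`, a point-supported distribution. -/
theorem obstrFA_apply [DecidableEq ι] {T₀ : CDist} (hT₀ : IsPropagator T₀) (ν : Fin 4) (a : ι)
    (κ : Fin 4) (b : ι) (ψ : RTest) :
    obstrFA T₀ ν a κ b ψ = if ν = κ ∧ a = b then -Complex.I * (ψ 0 : ℂ) else 0 := by
  by_cases hab : a = b
  · subst hab
    have hN : propNA T₀ a κ a = -(∂_{dir κ} T₀ : CDist) := by
      unfold propNA propAA
      rw [Finset.sum_eq_single κ]
      · simp [LineDeriv.lineDerivOp_smul, smul_smul, eta_mul_self]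
      · intro μ _ hμ
        rw [if_neg fun h => hμ h.1, LineDeriv.lineDerivOp_zero]
        exact smul_zero (A := CDist) (eta μ)
      · simp
    have hF : ∀ μ, (∂_{dir μ} (propFA T₀ μ ν a κ a) : CDist)
        = (if μ = κ then eta ν • (∂_{dir ν} (∂_{dir κ} T₀ : CDist) : CDist) else 0)
          - if ν = κ then eta μ • (∂_{dir μ} (∂_{dir μ} T₀ : CDist) : CDist) else 0 := by
      intro μ
      unfold propFA propAA
      have hsub : ∀ (x y : CDist) (v : Spacetime),
          (∂_{v} (x - y) : CDist) = ∂_{v} x - ∂_{v} y := by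
        intro x y v
        rw [sub_eq_add_neg, LineDeriv.lineDerivOp_add, LineDeriv.lineDerivOp_neg, ← sub_eq_add_neg]
      rw [LineDeriv.lineDerivOp_smul, hsub]
      by_cases h1 : μ = κ <;> by_cases h2 : ν = κ
      · subst h1; subst h2
        simp
      · subst h1
        simp only [h2, if_false, and_true, if_true, LineDeriv.lineDerivOp_zero,
          LineDeriv.lineDerivOp_neg, LineDeriv.lineDerivOp_smul, zero_sub, neg_neg, smul_smul,
          sub_zero]
        rw [mul_right_comm, eta_mul_self, one_mul, lineDeriv_comm]
      · subst h2
        simp only [h1, if_false, and_true, if_true, LineDeriv.lineDerivOp_zero,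
          LineDeriv.lineDerivOp_neg, LineDeriv.lineDerivOp_smul, zero_sub, smul_neg, smul_smul,
          sub_zero]
        rw [mul_assoc, eta_mul_self, mul_one]
      · simp [h1, h2]
    unfold obstrFA
    rw [hN, Finset.sum_congr rfl fun μ _ => hF μ, Finset.sum_sub_distrib]
    by_cases h2 : ν = κ
    · simp only [h2, if_true, and_true]
      rw [← hT₀ ψ]
      congr 1
      simp
    · simp [h2]
  · simp [obstrFA, propNA, propFA, propAA, hab]

theorem evalNear_obstrFA [DecidableEq ι] {T₀ : CDist} (hT₀ : IsPropagator T₀) (ν : Fin 4) (a : ι)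
    (κ : Fin 4) (b : ι) {f : Spacetime → ℝ} (hf : ContDiff ℝ ∞ f) :
    evalNear (obstrFA T₀ ν a κ b) {0} f
      = if ν = κ ∧ a = b then -Complex.I * (f 0 : ℂ) else 0 := by
  let χ : ContDiffBump (0 : Spacetime) := ⟨1, 2, by norm_num, by norm_num⟩
  let ψ : RTest := RTest.ofSmooth (fun x => χ x * f x) (χ.contDiff.mul hf)
    χ.hasCompactSupport.mul_right
  have hψ : ψ =ᶠ[𝓝ˢ {0}] f := by
    rw [nhdsSet_singleton]
    filter_upwards [Metric.closedBall_mem_nhds (0 : Spacetime) one_pos] with x hx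
    change χ x * f x = f x
    rw [χ.one_of_mem_closedBall hx, one_mul]
  have h0 : ψ 0 = f 0 := by
    rw [nhdsSet_singleton] at hψ
    exact hψ.self_of_nhds
  -- The obstruction is supported at the origin, so any cutoff equal to 1 near `0` computes the
  -- value on `f`.
  rw [evalNear_eq (fun u hu => ?_) ψ hψ, obstrFA_apply hT₀, h0]
  have : u 0 = 0 := by
    by_contra hne
    exact hu (subset_tsupport _ hne) rfl
  rw [obstrFA_apply hT₀, this]
  simp

/-- The prefactor `i` meets the `-i` of the obstruction: the whole propagator calculus reduces to
the substitution of `α_κ` for `A_κ`. -/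
theorem contraction_eq [Fintype ι] [DecidableEq ι] {T₀ : CDist} (hT₀ : IsPropagator T₀)
    {α : Fin 4 → ι → WickField C ι} {A : Config C ι} (hα : ∀ ν a, ContDiff ℝ ∞ (α ν a A))
    (κ : Fin 4) (b : ι) (x : Spacetime) : contraction T₀ α A κ b x = α κ b A x := by
  have hre : ∀ ν a, ContDiff ℝ ∞ fun z => (α ν a A (x + z)).re := fun ν a =>
    Complex.reCLM.contDiff.comp ((hα ν a).comp (contDiff_const.add contDiff_id))
  have him : ∀ ν a, ContDiff ℝ ∞ fun z => (α ν a A (x + z)).im := fun ν a =>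
    Complex.imCLM.contDiff.comp ((hα ν a).comp (contDiff_const.add contDiff_id))
  unfold contraction
  rw [Finset.sum_eq_single κ, Finset.sum_eq_single b]
  · rw [evalNear_obstrFA hT₀ _ _ _ _ (hre κ b), evalNear_obstrFA hT₀ _ _ _ _ (him κ b)]
    simp only [and_self, if_true, add_zero]
    conv_rhs => rw [← Complex.re_add_im (α κ b A x)]
    linear_combination (-(α κ b A x).re - (α κ b A x).im * Complex.I) * Complex.I_sq
  · intro a _ ha
    rw [evalNear_obstrFA hT₀ _ _ _ _ (hre κ a), evalNear_obstrFA hT₀ _ _ _ _ (him κ a)]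
    simp [ha]
  · simp
  · intro ν _ hν
    refine Finset.sum_eq_zero fun a _ => ?_
    rw [evalNear_obstrFA hT₀ _ _ _ _ (hre ν a), evalNear_obstrFA hT₀ _ _ _ _ (him ν a)]
    simp [hν]
  · simp

/-- Real values and tame support make `α[A]` itself a configuration, so the default value `0` does
not intervene. -/
theorem contractionConfig_eq [Fintype ι] [DecidableEq ι] {T₀ : CDist} (hT₀ : IsPropagator T₀)
    {α : Fin 4 → ι → WickField C ι} (hα : ∀ ν a, RealRegular (α ν a)) (A : Config C ι)
    (κ : Fin 4) (b : ι) : potential κ b (contractionConfig T₀ α A) = α κ b A := by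
  have hex : ∃ B : Config C ι, ∀ κ b x, ((B.1 κ b x : ℝ) : ℂ) = contraction T₀ α A κ b x := by
    refine ⟨⟨fun κ b x => (α κ b A x).re, fun κ b => ((hα κ b).1.tame A).re⟩, fun κ b x => ?_⟩
    rw [contraction_eq hT₀ fun ν a => ((hα ν a).1.tame A).1]
    exact Complex.ext rfl (by simp [(hα κ b).2 A x])
  funext x
  unfold contractionConfig
  rw [dif_pos hex, potential, hex.choose_spec κ b x,
    contraction_eq hT₀ fun ν a => ((hα ν a).1.tame A).1]

end StringYM

end

open scoped Distributions LineDeriv PowerSeries Pointwise ContDiff Topology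

noncomputable section

namespace StringYM

/-! ### The obstruction map on regular fields -/

section Obstruction

variable {ι : Type*} [Fintype ι] [DecidableEq ι] {C : ProperCone ℝ Spacetime} {s : StringFunction}
  {T₀ : CDist} {α : Fin 4 → ι → WickField C ι} {X Y : WickField C ι}

theorem obstruction_apply (A : Config C ι) :
    obstruction T₀ α X A = dirDeriv X A (contractionConfig T₀ α A) := rfl

theorem obstruction_add (hX : Regular X) (hY : Regular Y) :
    obstruction T₀ α (X + Y) = obstruction T₀ α X + obstruction T₀ α Y :=
  funext fun A => dirDeriv_add hX hY A _

theorem obstruction_mul (hX : Regular X) (hY : Regular Y) :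
    obstruction T₀ α (X * Y) = obstruction T₀ α X * Y + X * obstruction T₀ α Y :=
  funext fun A => dirDeriv_mul hX hY A _

theorem obstruction_smul (hX : Regular X) (z : ℂ) :
    obstruction T₀ α (z • X) = z • obstruction T₀ α X :=
  funext fun A => dirDeriv_op hX (tameOp_smul z) A _

theorem obstruction_pd (hX : Regular X) (μ : Fin 4) :
    obstruction T₀ α (pd μ X) = pd μ (obstruction T₀ α X) :=
  funext fun A => dirDeriv_op hX (tameOp_partialDeriv μ) A _

theorem obstruction_stringInt {α : Fin 4 → ι → WickField s.cone ι} {X : WickField s.cone ι}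
    (hX : Regular X) (μ : Fin 4) :
    obstruction T₀ α (stringInt s μ X) = stringInt s μ (obstruction T₀ α X) :=
  funext fun A => dirDeriv_op hX (tameOp_funInt μ) A _

theorem obstruction_zero : obstruction T₀ α 0 = 0 :=
  funext fun A => dirDeriv_zero A _

theorem obstruction_sum {κ : Type*} (t : Finset κ) {X : κ → WickField C ι}
    (h : ∀ k ∈ t, Regular (X k)) :
    obstruction T₀ α (∑ k ∈ t, X k) = ∑ k ∈ t, obstruction T₀ α (X k) := by
  classical
  induction t using Finset.induction_on with
  | empty => simp [obstruction_zero]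
  | insert a t ha ih =>
    rw [Finset.sum_insert ha, Finset.sum_insert ha,
      obstruction_add (h a (by simp)) (Regular.sum t fun k hk => h k (by simp [hk])),
      ih fun k hk => h k (by simp [hk])]

theorem obstruction_potential (hT₀ : IsPropagator T₀) (hα : ∀ ν a, RealRegular (α ν a))
    (μ : Fin 4) (a : ι) : obstruction T₀ α (potential μ a) = α μ a := by
  funext A
  rw [obstruction_apply, dirDeriv_potential, contractionConfig_eq hT₀ hα]

/-- Needed for the order `g⁰` of `α`, which vanishes; this is why `ω_U` raises the order in `g`. -/
theorem obstruction_zero_left (hT₀ : IsPropagator T₀) (X : WickField C ι) :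
    obstruction T₀ 0 X = 0 := by
  funext A
  have h0 : contractionConfig T₀ (0 : Fin 4 → ι → WickField C ι) A = 0 := by
    refine Subtype.ext (funext fun κ => funext fun b => funext fun x => ?_)
    have h := congrFun (contractionConfig_eq hT₀ (α := (0 : Fin 4 → ι → WickField C ι))
      (fun _ _ => RealRegular.zero) A κ b) x
    exact Complex.ofReal_eq_zero.1 h
  rw [obstruction_apply, h0, dirDeriv_zero_right]
  rfl

theorem obstruction_ad (f : ι → ι → ι → ℝ) {X Y : ι → WickField C ι} (hX : ∀ a, Regular (X a))
    (hY : ∀ a, Regular (Y a)) (e : ι) :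
    obstruction T₀ α (ad f X Y e) = ad f (fun a => obstruction T₀ α (X a)) Y e
      + ad f X (fun a => obstruction T₀ α (Y a)) e := by
  unfold ad
  rw [obstruction_sum _ fun a _ => Regular.sum _ fun b _ => ((hX a).mul (hY b)).const_smul _,
    ← Finset.sum_add_distrib]
  refine Finset.sum_congr rfl fun a _ => ?_
  rw [obstruction_sum _ fun b _ => ((hX a).mul (hY b)).const_smul _, ← Finset.sum_add_distrib]
  refine Finset.sum_congr rfl fun b _ => ?_
  rw [obstruction_smul ((hX a).mul (hY b)), obstruction_mul (hX a) (hY b), smul_add]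

end Obstruction

/-! ### The spaces `𝒮` and `𝒱` -/

section Spaces

variable {ι : Type*} {C : ProperCone ℝ Spacetime} {s : StringFunction} {f : ι → ι → ι → ℝ}

theorem pd_smul {X : WickField C ι} (hX : Regular X) (z : ℂ) (μ : Fin 4) :
    pd μ (z • X) = z • pd μ X :=
  funext fun A => partialDeriv_smul (hX.tame A).1 z μ

theorem pd_zero (μ : Fin 4) : pd μ (0 : WickField C ι) = 0 :=
  funext fun _ => partialDeriv_zero μ

theorem pd_sum {κ : Type*} (t : Finset κ) {X : κ → WickField C ι} (h : ∀ k ∈ t, Regular (X k))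
    (μ : Fin 4) : pd μ (∑ k ∈ t, X k) = ∑ k ∈ t, pd μ (X k) := by
  funext A
  have := partialDeriv_sum t (fun k hk => ((h k hk).tame A).1) μ
  rw [Finset.sum_apply, ← show _ = ∑ k ∈ t, pd μ (X k) A from this, ← Finset.sum_apply]
  rfl

theorem stringInt_add {X Y : WickField s.cone ι} (hX : Regular X) (hY : Regular Y) (μ : Fin 4) :
    stringInt s μ (X + Y) = stringInt s μ X + stringInt s μ Y :=
  funext fun A => funInt_add μ (hX.tame A) (hY.tame A)

theorem stringInt_smul {X : WickField s.cone ι} (hX : Regular X) (z : ℂ) (μ : Fin 4) :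
    stringInt s μ (z • X) = z • stringInt s μ X :=
  funext fun A => funInt_smul μ z (hX.tame A)

theorem stringInt_zero (μ : Fin 4) : stringInt s μ (0 : WickField s.cone ι) = 0 :=
  funext fun _ => funInt_zero μ

theorem stringInt_sum {κ : Type*} (t : Finset κ) {X : κ → WickField s.cone ι}
    (h : ∀ k ∈ t, Regular (X k)) (μ : Fin 4) :
    stringInt s μ (∑ k ∈ t, X k) = ∑ k ∈ t, stringInt s μ (X k) := by
  funext A
  have := funInt_sum μ t fun k hk => (h k hk).tame A
  rw [Finset.sum_apply, ← show _ = ∑ k ∈ t, stringInt s μ (X k) A from this, ← Finset.sum_apply]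
  rfl

theorem pd_stringInt {X : WickField s.cone ι} (hX : Regular X) (μ ν : Fin 4) :
    pd ν (stringInt s μ X) = stringInt s μ (pd ν X) :=
  funext fun A => partialDeriv_funInt μ ν (hX.tame A)

/-- `I_c^μ ∂_μ = -id`. -/
theorem sum_stringInt_pd {X : WickField s.cone ι} (hX : Regular X) :
    ∑ μ, stringInt s μ (pd μ X) = -X := by
  funext A
  rw [Finset.sum_apply]
  exact sum_funInt_partialDeriv (hX.tame A)

theorem stringIntVec_grad {X : ι → WickField s.cone ι} (hX : ∀ a, Regular (X a)) :
    stringIntVec s (grad X) = -X :=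
  funext fun a => sum_stringInt_pd (hX a)

theorem stringIntVec_add {v w : Fin 4 → ι → WickField s.cone ι} (hv : ∀ μ a, Regular (v μ a))
    (hw : ∀ μ a, Regular (w μ a)) :
    stringIntVec s (v + w) = stringIntVec s v + stringIntVec s w := by
  funext a
  simp only [stringIntVec, Pi.add_apply]
  rw [← Finset.sum_add_distrib]
  exact Finset.sum_congr rfl fun μ _ => stringInt_add (hv μ a) (hw μ a) μ

theorem stringIntVec_smul {v : Fin 4 → ι → WickField s.cone ι} (hv : ∀ μ a, Regular (v μ a))
    (r : ℝ) : stringIntVec s (r • v) = r • stringIntVec s v := by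
  funext a
  simp only [stringIntVec, Pi.smul_apply]
  rw [Finset.smul_sum]
  refine Finset.sum_congr rfl fun μ _ => ?_
  rw [real_smul_eq, real_smul_eq, stringInt_smul (hv μ a)]

theorem stringIntVec_realRegular {v : Fin 4 → ι → WickField s.cone ι}
    (hv : ∀ μ a, RealRegular (v μ a)) (a : ι) : RealRegular (stringIntVec s v a) :=
  RealRegular.sum _ fun μ _ => (hv μ a).stringInt μ

variable [Fintype ι]

theorem adList_realRegular {l : List (ι → WickField C ι)}
    (hl : ∀ X ∈ l, ∀ a, RealRegular (X a)) {v : Fin 4 → ι → WickField C ι}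
    (hv : ∀ μ a, RealRegular (v μ a)) : ∀ μ a, RealRegular (adList f l v μ a) := by
  induction l with
  | nil => exact hv
  | cons X l ih =>
    intro μ a
    exact RealRegular.ad f (hl X (by simp)) (ih (fun Y hY => hl Y (by simp [hY])) μ) a

theorem spaceS_realRegular {X : ι → WickField s.cone ι} (h : X ∈ spaceS s f) :
    ∀ a, RealRegular (X a) := by
  replace h : MemS s f X := h
  induction h with
  | zero => exact fun _ => RealRegular.zero
  | add _ _ ihX ihY => exact fun a => (ihX a).add (ihY a)
  | smul r _ ih =>
    intro a
    rw [Pi.smul_apply, real_smul_eq]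
    exact (ih a).const_smul r
  | ofPotential l _ ih =>
    exact stringIntVec_realRegular (adList_realRegular ih RealRegular.potential)
  | ofGrad l _ _ _ ih ih₀ =>
    exact stringIntVec_realRegular (adList_realRegular ih fun μ a => (ih₀ a).pd μ)

theorem spaceV_realRegular {v : Fin 4 → ι → WickField s.cone ι} (h : v ∈ spaceV s f) :
    ∀ μ a, RealRegular (v μ a) := by
  induction h using Submodule.span_induction with
  | mem v hv =>
    rcases hv with ⟨l, hl, rfl⟩ | ⟨l, hl, X, hX, rfl⟩
    · exact adList_realRegular (fun Y hY => spaceS_realRegular (hl Y hY)) RealRegular.potential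
    · exact adList_realRegular (fun Y hY => spaceS_realRegular (hl Y hY))
        fun μ a => (spaceS_realRegular hX a).pd μ
  | zero => exact fun _ _ => RealRegular.zero
  | add v w _ _ ihv ihw => exact fun μ a => (ihv μ a).add (ihw μ a)
  | smul r v _ ih =>
    intro μ a
    rw [Pi.smul_apply, Pi.smul_apply, real_smul_eq]
    exact (ih μ a).const_smul r

theorem potential_mem_spaceV :
    (potential : Fin 4 → ι → WickField s.cone ι) ∈ spaceV s f :=
  Submodule.subset_span (Or.inl ⟨[], by simp, rfl⟩)

theorem grad_mem_spaceV {X : ι → WickField s.cone ι} (h : X ∈ spaceS s f) :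
    grad X ∈ spaceV s f :=
  Submodule.subset_span (Or.inr ⟨[], by simp, X, h, rfl⟩)

theorem ad_add_right {R : Type*} [CommRing R] [Algebra ℂ R] (X Y Z : ι → R) :
    ad f X (Y + Z) = ad f X Y + ad f X Z := by
  funext e
  simp [ad, mul_add, Finset.sum_add_distrib]

theorem ad_smul_right {R : Type*} [CommRing R] [Algebra ℂ R] (z : ℂ) (X Y : ι → R) :
    ad f X (z • Y) = z • ad f X Y := by
  funext e
  simp only [ad, Pi.smul_apply, mul_smul_comm, Finset.smul_sum]
  exact Finset.sum_congr rfl fun a _ => Finset.sum_congr rfl fun b _ => smul_comm _ _ _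

theorem ad_zero_right {R : Type*} [CommRing R] [Algebra ℂ R] (X : ι → R) :
    ad f X 0 = 0 := by
  funext e
  simp [ad]

theorem ad_mem_spaceV {X : ι → WickField s.cone ι} (hX : X ∈ spaceS s f)
    {v : Fin 4 → ι → WickField s.cone ι} (hv : v ∈ spaceV s f) :
    (fun μ => ad f X (v μ)) ∈ spaceV s f := by
  induction hv using Submodule.span_induction with
  | mem v hv =>
    rcases hv with ⟨l, hl, rfl⟩ | ⟨l, hl, X₀, hX₀, rfl⟩
    · refine Submodule.subset_span (Or.inl ⟨X :: l, ?_, rfl⟩)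
      simpa using ⟨hX, hl⟩
    · refine Submodule.subset_span (Or.inr ⟨X :: l, ?_, X₀, hX₀, rfl⟩)
      simpa using ⟨hX, hl⟩
  | zero =>
    have : (fun μ : Fin 4 => ad f X ((0 : Fin 4 → ι → WickField s.cone ι) μ)) = 0 :=
      funext fun μ => ad_zero_right X
    rw [this]
    exact Submodule.zero_mem _
  | add v w _ _ ihv ihw =>
    have : (fun μ => ad f X ((v + w) μ)) = (fun μ => ad f X (v μ)) + fun μ => ad f X (w μ) :=
      funext fun μ => ad_add_right X (v μ) (w μ)
    rw [this]
    exact Submodule.add_mem _ ihv ihw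
  | smul r v _ ih =>
    have : (fun μ => ad f X ((r • v) μ)) = r • fun μ => ad f X (v μ) := by
      funext μ
      have e : (r • v) μ = (r : ℂ) • v μ := funext fun a => real_smul_eq r (v μ a)
      rw [e, ad_smul_right]
      exact funext fun a => (real_smul_eq r _).symm
    rw [this]
    exact Submodule.smul_mem _ r ih

/-- The only generators of `𝒱` whose string integrals are not generators of `𝒮` by definition are
the bare gradients `∂_ν s`, and these integrate to `-s`. -/
theorem stringIntVec_mem_spaceS {v : Fin 4 → ι → WickField s.cone ι} (hv : v ∈ spaceV s f) :
    stringIntVec s v ∈ spaceS s f := by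
  induction hv using Submodule.span_induction with
  | mem v hv =>
    rcases hv with ⟨l, hl, rfl⟩ | ⟨l, hl, X₀, hX₀, rfl⟩
    · exact MemS.ofPotential l hl
    · rcases eq_or_ne l [] with rfl | hne
      · have : stringIntVec s (adList f [] (grad X₀)) = -X₀ :=
          stringIntVec_grad fun a => (spaceS_realRegular hX₀ a).1
        rw [this]
        exact Submodule.neg_mem _ hX₀
      · exact MemS.ofGrad l hne hl hX₀
  | zero =>
    have : stringIntVec s (0 : Fin 4 → ι → WickField s.cone ι) = 0 :=
      funext fun a => Finset.sum_eq_zero fun μ _ => stringInt_zero μ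
    rw [this]
    exact Submodule.zero_mem _
  | add v w hv hw ihv ihw =>
    rw [stringIntVec_add (fun μ a => (spaceV_realRegular hv μ a).1)
      fun μ a => (spaceV_realRegular hw μ a).1]
    exact Submodule.add_mem _ ihv ihw
  | smul r v hv ih =>
    rw [stringIntVec_smul fun μ a => (spaceV_realRegular hv μ a).1]
    exact Submodule.smul_mem _ r ih

variable [DecidableEq ι] {T₀ : CDist} {α : Fin 4 → ι → WickField s.cone ι}

/-- Leibniz rule along the nested brackets. Both memberships are proved together, because the term
in which `ω` hits the outer factor contains the undifferentiated inner bracket. -/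
theorem obstruction_adList_mem {l : List (ι → WickField s.cone ι)}
    (hl : ∀ X ∈ l, X ∈ spaceS s f)
    (hl' : ∀ X ∈ l, (fun a => obstruction T₀ α (X a)) ∈ spaceS s f)
    {v : Fin 4 → ι → WickField s.cone ι} (hv : v ∈ spaceV s f)
    (hv' : (fun μ a => obstruction T₀ α (v μ a)) ∈ spaceV s f) :
    adList f l v ∈ spaceV s f ∧
      (fun μ a => obstruction T₀ α (adList f l v μ a)) ∈ spaceV s f := by
  induction l with
  | nil => exact ⟨hv, hv'⟩
  | cons X l ih =>
    have hX := hl X (by simp)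
    obtain ⟨h1, h2⟩ := ih (fun Y hY => hl Y (by simp [hY])) fun Y hY => hl' Y (by simp [hY])
    refine ⟨ad_mem_spaceV hX h1, ?_⟩
    have e : (fun μ a => obstruction T₀ α (adList f (X :: l) v μ a))
        = (fun μ => ad f (fun a => obstruction T₀ α (X a)) (adList f l v μ))
          + fun μ => ad f X (fun a => obstruction T₀ α (adList f l v μ a)) := by
      funext μ a
      exact obstruction_ad f (fun a => (spaceS_realRegular hX a).1)
        (fun a => (spaceV_realRegular h1 μ a).1) a
    rw [e]
    exact Submodule.add_mem _ (ad_mem_spaceV (hl' X (by simp)) h1) (ad_mem_spaceV hX h2)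

theorem obstruction_stringIntVec {v : Fin 4 → ι → WickField s.cone ι}
    (hv : ∀ μ a, Regular (v μ a)) :
    (fun a => obstruction T₀ α (stringIntVec s v a))
      = stringIntVec s fun μ a => obstruction T₀ α (v μ a) := by
  funext a
  unfold stringIntVec
  rw [obstruction_sum _ fun μ _ => (hv μ a).stringInt μ]
  exact Finset.sum_congr rfl fun μ _ => obstruction_stringInt (hv μ a) μ

theorem obstruction_potential_mem (hT₀ : IsPropagator T₀) (hα : α ∈ spaceV s f) :
    (fun μ a => obstruction T₀ α (potential μ a)) ∈ spaceV s f := by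
  have : (fun μ a => obstruction T₀ α (potential μ a)) = α :=
    funext fun μ => funext fun a => obstruction_potential hT₀ (spaceV_realRegular hα) μ a
  rw [this]
  exact hα

theorem obstruction_grad_mem {X : ι → WickField s.cone ι} (hX : X ∈ spaceS s f)
    (h : (fun a => obstruction T₀ α (X a)) ∈ spaceS s f) :
    (fun μ a => obstruction T₀ α (grad X μ a)) ∈ spaceV s f := by
  have : (fun μ a => obstruction T₀ α (grad X μ a)) = grad fun a => obstruction T₀ α (X a) :=
    funext fun μ => funext fun a => obstruction_pd (spaceS_realRegular hX a).1 μ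
  rw [this]
  exact grad_mem_spaceV h

/-- Induction over the generation of `𝒮`: `ω` passes through `I_c` and hits either some `s_k`,
staying in `𝒮` by induction, or `A_ν`, giving `α_ν` in `𝒱`, or `∂_ν s_0`, giving the gradient of a
field in `𝒮`. -/
theorem obstruction_mem_spaceS (hT₀ : IsPropagator T₀) (hα : α ∈ spaceV s f)
    {X : ι → WickField s.cone ι} (hX : X ∈ spaceS s f) :
    (fun a => obstruction T₀ α (X a)) ∈ spaceS s f := by
  replace hX : MemS s f X := hX
  induction hX with
  | zero =>
    have : (fun a => obstruction T₀ α ((0 : ι → WickField s.cone ι) a)) = 0 :=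
      funext fun a => obstruction_zero
    rw [this]
    exact Submodule.zero_mem _
  | @add X Y hX hY ihX ihY =>
    have : (fun a => obstruction T₀ α ((X + Y) a))
        = (fun a => obstruction T₀ α (X a)) + fun a => obstruction T₀ α (Y a) :=
      funext fun a => obstruction_add (spaceS_realRegular hX a).1 (spaceS_realRegular hY a).1
    rw [this]
    exact Submodule.add_mem _ ihX ihY
  | @smul r X hX ih =>
    have : (fun a => obstruction T₀ α ((r • X) a)) = r • fun a => obstruction T₀ α (X a) := by
      funext a
      rw [Pi.smul_apply, Pi.smul_apply, real_smul_eq, real_smul_eq,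
        obstruction_smul (spaceS_realRegular hX a).1]
    rw [this]
    exact Submodule.smul_mem _ r ih
  | ofPotential l hl ih =>
    obtain ⟨h1, h2⟩ := obstruction_adList_mem hl ih potential_mem_spaceV
      (obstruction_potential_mem hT₀ hα)
    rw [obstruction_stringIntVec fun μ a => (spaceV_realRegular h1 μ a).1]
    exact stringIntVec_mem_spaceS h2
  | ofGrad l _ hl h₀ ih ih₀ =>
    obtain ⟨h1, h2⟩ := obstruction_adList_mem hl ih (grad_mem_spaceV h₀)
      (obstruction_grad_mem h₀ ih₀)
    rw [obstruction_stringIntVec fun μ a => (spaceV_realRegular h1 μ a).1]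
    exact stringIntVec_mem_spaceS h2

theorem obstruction_mem_spaceV (hT₀ : IsPropagator T₀) (hα : α ∈ spaceV s f)
    {v : Fin 4 → ι → WickField s.cone ι} (hv : v ∈ spaceV s f) :
    (fun μ a => obstruction T₀ α (v μ a)) ∈ spaceV s f := by
  induction hv using Submodule.span_induction with
  | mem v hv =>
    rcases hv with ⟨l, hl, rfl⟩ | ⟨l, hl, X₀, hX₀, rfl⟩
    · exact (obstruction_adList_mem hl (fun X hX => obstruction_mem_spaceS hT₀ hα (hl X hX))
        potential_mem_spaceV (obstruction_potential_mem hT₀ hα)).2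
    · exact (obstruction_adList_mem hl (fun X hX => obstruction_mem_spaceS hT₀ hα (hl X hX))
        (grad_mem_spaceV hX₀)
        (obstruction_grad_mem hX₀ (obstruction_mem_spaceS hT₀ hα hX₀))).2
  | zero =>
    have : (fun μ a => obstruction T₀ α ((0 : Fin 4 → ι → WickField s.cone ι) μ a)) = 0 :=
      funext fun μ => funext fun a => obstruction_zero
    rw [this]
    exact Submodule.zero_mem _
  | add v w hv hw ihv ihw =>
    have : (fun μ a => obstruction T₀ α ((v + w) μ a))
        = (fun μ a => obstruction T₀ α (v μ a)) + fun μ a => obstruction T₀ α (w μ a) :=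
      funext fun μ => funext fun a =>
        obstruction_add (spaceV_realRegular hv μ a).1 (spaceV_realRegular hw μ a).1
    rw [this]
    exact Submodule.add_mem _ ihv ihw
  | smul r v hv ih =>
    have : (fun μ a => obstruction T₀ α ((r • v) μ a))
        = r • fun μ a => obstruction T₀ α (v μ a) := by
      funext μ a
      simp only [Pi.smul_apply]
      rw [real_smul_eq, real_smul_eq, obstruction_smul (spaceV_realRegular hv μ a).1]
    rw [this]
    exact Submodule.smul_mem _ r ih

end Spaces

end StringYM

end

open scoped Distributions LineDeriv PowerSeries Pointwise ContDiff Topology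

noncomputable section

namespace StringYM

/-! ### Formal sums of matrix-valued power series -/

set_option linter.unusedSectionVars false

section FormalSums

open PowerSeries Finset

variable {R : Type*} [CommRing R] [Algebra ℂ R] {d : Type*} [Fintype d] [DecidableEq d]

theorem coeff_complex_smul (n : ℕ) (z : ℂ) (u : R⟦X⟧) : coeff n (z • u) = z • coeff n u := rfl

/-- The formal sum `∑_k Z_k` of a family with `Z_k` of order at least `k`. -/
def matSum (Z : ℕ → Matrix d d R⟦X⟧) : Matrix d d R⟦X⟧ :=
  Matrix.of fun i j => PowerSeries.mk fun n => ∑ k ∈ range (n + 1), coeff n (Z k i j)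

/-- The family `Z_k` has order at least `k`. -/
def OrderGE (Z : ℕ → Matrix d d R⟦X⟧) : Prop := ∀ k n i j, n < k → coeff n (Z k i j) = 0

theorem coeff_matSum (Z : ℕ → Matrix d d R⟦X⟧) (n : ℕ) (i j : d) :
    coeff n (matSum Z i j) = ∑ k ∈ range (n + 1), coeff n (Z k i j) := by
  simp [matSum]

/-- Formal sums may be replaced by one common finite partial sum, so matrix products of them become
finite computations. -/
theorem coeff_matSum_of_le {Z : ℕ → Matrix d d R⟦X⟧} (hZ : OrderGE Z) {n N : ℕ} (h : n ≤ N)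
    (i j : d) : coeff n (matSum Z i j) = coeff n ((∑ k ∈ range (N + 1), Z k) i j) := by
  rw [coeff_matSum, Matrix.sum_apply, map_sum]
  refine sum_subset (range_mono (by omega)) fun k _ hk => hZ k n i j ?_
  simpa [Nat.lt_succ_iff] using hk

theorem coeff_matrix_mul_congr {M M' N N' : Matrix d d R⟦X⟧} {n : ℕ}
    (hM : ∀ m ≤ n, ∀ i j, coeff m (M i j) = coeff m (M' i j))
    (hN : ∀ m ≤ n, ∀ i j, coeff m (N i j) = coeff m (N' i j)) (i j : d) :
    coeff n ((M * N) i j) = coeff n ((M' * N') i j) := by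
  simp only [Matrix.mul_apply, map_sum, coeff_mul]
  refine sum_congr rfl fun l _ => sum_congr rfl fun p hp => ?_
  rw [HasAntidiagonal.mem_antidiagonal] at hp
  rw [hM p.1 (by omega), hN p.2 (by omega)]

theorem coeff_mul_eq_zero {u v : R⟦X⟧} {p q n : ℕ} (hu : ∀ m < p, coeff m u = 0)
    (hv : ∀ m < q, coeff m v = 0) (hn : n < p + q) : coeff n (u * v) = 0 := by
  rw [coeff_mul]
  refine sum_eq_zero fun x hx => ?_
  rw [HasAntidiagonal.mem_antidiagonal] at hx
  by_cases h : x.1 < p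
  · rw [hu _ h, zero_mul]
  · rw [hv x.2 (by omega), mul_zero]

/-- The square and the triangle differ only by terms with `p + q > n`, which vanish; the triangle is
then sliced by the value of `p + q`. -/
theorem sum_range_range_eq_sum_antidiagonal {M : Type*} [AddCommMonoid M] (n : ℕ)
    (g : ℕ → ℕ → M) (hg : ∀ p q, n < p + q → g p q = 0) :
    ∑ p ∈ range (n + 1), ∑ q ∈ range (n + 1), g p q
      = ∑ k ∈ range (n + 1), ∑ x ∈ antidiagonal k, g x.1 x.2 := by
  rw [← sum_product']
  have h1 : ∑ x ∈ range (n + 1) ×ˢ range (n + 1), g x.1 x.2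
      = ∑ x ∈ (range (n + 1) ×ˢ range (n + 1)).filter (fun x => x.1 + x.2 ≤ n), g x.1 x.2 := by
    rw [sum_filter]
    refine sum_congr rfl fun x _ => ?_
    split_ifs with h
    · rfl
    · exact hg _ _ (by omega)
  rw [h1, ← sum_fiberwise_of_maps_to (g := fun x : ℕ × ℕ => x.1 + x.2) (t := range (n + 1))]
  · refine sum_congr rfl fun k hk => sum_congr ?_ fun _ _ => rfl
    ext ⟨p, q⟩
    simp only [mem_filter, mem_product, mem_range, HasAntidiagonal.mem_antidiagonal] at hk ⊢
    omega
  · intro x hx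
    simp only [mem_filter, mem_range] at hx ⊢
    omega

theorem matSum_mul {Z Z' : ℕ → Matrix d d R⟦X⟧} (hZ : OrderGE Z) (hZ' : OrderGE Z') :
    matSum Z * matSum Z' = matSum fun n => ∑ x ∈ antidiagonal n, Z x.1 * Z' x.2 := by
  ext i j n
  rw [coeff_matrix_mul_congr (fun m hm i j => coeff_matSum_of_le hZ hm i j)
    (fun m hm i j => coeff_matSum_of_le hZ' hm i j), sum_mul_sum, coeff_matSum]
  simp only [Matrix.sum_apply, map_sum]
  refine sum_range_range_eq_sum_antidiagonal n (fun p q => coeff n ((Z p * Z' q) i j)) ?_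
  intro p q h
  rw [Matrix.mul_apply, map_sum]
  exact sum_eq_zero fun l _ => coeff_mul_eq_zero (fun m hm => hZ p m i l hm)
    (fun m hm => hZ' q m l j hm) h

theorem mul_matSum {Z : ℕ → Matrix d d R⟦X⟧} (hZ : OrderGE Z) (M : Matrix d d R⟦X⟧) :
    M * matSum Z = matSum fun n => M * Z n := by
  ext i j n
  rw [coeff_matrix_mul_congr (fun m _ i j => rfl)
    (fun m hm i j => coeff_matSum_of_le hZ hm i j), mul_sum, coeff_matSum]
  simp only [Matrix.sum_apply, map_sum]

theorem OrderGE.pow {Y : Matrix d d R⟦X⟧} (hY : ∀ i j, coeff 0 (Y i j) = 0) :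
    OrderGE fun k => Y ^ k := by
  intro k
  induction k with
  | zero => intro n i j h; omega
  | succ k ih =>
    intro n i j h
    change coeff n ((Y ^ (k + 1)) i j) = 0
    rw [pow_succ, Matrix.mul_apply, map_sum]
    refine sum_eq_zero fun l _ => coeff_mul_eq_zero (p := k) (q := 1) (fun m hm => ih m i l hm)
      (fun m hm => ?_) h
    rw [Nat.lt_one_iff.1 hm, hY]

theorem OrderGE.smul {Z : ℕ → Matrix d d R⟦X⟧} (hZ : OrderGE Z) (c : ℕ → ℂ) :
    OrderGE fun k => c k • Z k := by
  intro k n i j h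
  change coeff n (c k • Z k i j) = 0
  rw [coeff_complex_smul, hZ k n i j h, smul_zero]

theorem OrderGE.mul_left {Z : ℕ → Matrix d d R⟦X⟧} (hZ : OrderGE Z) (M : Matrix d d R⟦X⟧) :
    OrderGE fun k => M * Z k := by
  intro k n i j h
  change coeff n ((M * Z k) i j) = 0
  rw [Matrix.mul_apply, map_sum]
  exact sum_eq_zero fun l _ => coeff_mul_eq_zero (p := 0) (fun m hm => absurd hm (by omega))
    (fun m hm => hZ k m l j hm) (by omega)

theorem matExp_eq_matSum (Y : Matrix d d R⟦X⟧) :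
    matExp Y = matSum fun k => ((k.factorial : ℂ)⁻¹) • Y ^ k := rfl

/-- The commutator with `Y`. -/
def matAd (Y M : Matrix d d R⟦X⟧) : Matrix d d R⟦X⟧ := Y * M - M * Y

theorem matAd_smul (Y M : Matrix d d R⟦X⟧) (z : ℂ) : matAd Y (z • M) = z • matAd Y M := by
  simp [matAd, smul_sub]

theorem matAd_iterate_smul (Y M : Matrix d d R⟦X⟧) (z : ℂ) (n : ℕ) :
    (matAd Y)^[n] (z • M) = z • (matAd Y)^[n] M := by
  induction n with
  | zero => rfl
  | succ n ih => rw [Function.iterate_succ_apply', ih, matAd_smul, Function.iterate_succ_apply']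

theorem sum_antidiagonal_factorial_smul {M : Type*} [AddCommGroup M] [Module ℂ M] (n : ℕ)
    (g : ℕ → ℕ → M) :
    ∑ x ∈ antidiagonal n, ((x.1.factorial : ℂ)⁻¹ * (x.2.factorial : ℂ)⁻¹) • g x.1 x.2
      = ((n.factorial : ℂ)⁻¹) • ∑ x ∈ antidiagonal n, n.choose x.1 • g x.1 x.2 := by
  rw [smul_sum]
  refine sum_congr rfl fun x hx => ?_
  rw [HasAntidiagonal.mem_antidiagonal] at hx
  rw [← Nat.cast_smul_eq_nsmul ℂ, smul_smul, ← hx, Nat.choose_symm_add,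
    Nat.add_choose,
    Nat.cast_div (Nat.factorial_mul_factorial_dvd_factorial_add x.1 x.2)
      (by exact_mod_cast (Nat.mul_pos (Nat.factorial_pos _) (Nat.factorial_pos _)).ne')]
  congr 1
  have h1 : (x.1.factorial : ℂ) ≠ 0 := by exact_mod_cast Nat.factorial_ne_zero _
  have h2 : (x.2.factorial : ℂ) ≠ 0 := by exact_mod_cast Nat.factorial_ne_zero _
  have h3 : ((x.1 + x.2).factorial : ℂ) ≠ 0 := by exact_mod_cast Nat.factorial_ne_zero _
  push_cast
  field_simp

/-- The binomial theorem for the commuting operators of left multiplication by `Y` and right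
multiplication by `-Y`, whose sum is the commutator with `Y`. -/
theorem sum_choose_conj (Y M : Matrix d d R⟦X⟧) (n : ℕ) :
    ∑ x ∈ antidiagonal n, n.choose x.1 • (Y ^ x.1 * (M * (-Y) ^ x.2)) = (matAd Y)^[n] M := by
  induction n with
  | zero => simp
  | succ n ih =>
    rw [sum_antidiagonal_choose_succ_nsmul (fun p q => Y ^ p * (M * (-Y) ^ q)),
      Function.iterate_succ_apply', ← ih, matAd, mul_sum, sum_mul, add_comm, sub_eq_add_neg,
      ← sum_neg_distrib]
    congr 1
    · refine sum_congr rfl fun x hx => ?_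
      rw [HasAntidiagonal.mem_antidiagonal] at hx
      rw [← hx, Nat.choose_symm_add, pow_succ', mul_smul_comm, mul_assoc]
    · refine sum_congr rfl fun x _ => ?_
      rw [pow_succ, smul_mul_assoc, ← smul_neg, mul_assoc, mul_assoc, mul_neg, mul_neg, mul_neg]

/-- Here `D q` stands for `δ((-Y)^q)` and `E` for `δY`. Pascal's rule makes the binomial sums
satisfy `S_{n+1} = ad_Y(S_n) - 0^n E`, whence the single power of `ad_Y`. -/
theorem sum_choose_deriv (Y : Matrix d d R⟦X⟧) (D : ℕ → Matrix d d R⟦X⟧) (E : Matrix d d R⟦X⟧)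
    (h0 : D 0 = 0) (hD : ∀ q, D (q + 1) = D q * (-Y) + (-Y) ^ q * (-E)) (n : ℕ) :
    ∑ x ∈ antidiagonal (n + 1), (n + 1).choose x.1 • (Y ^ x.1 * D x.2)
      = -(matAd Y)^[n] E := by
  have step : ∀ n, ∑ x ∈ antidiagonal (n + 1), (n + 1).choose x.1 • (Y ^ x.1 * D x.2)
      = matAd Y (∑ x ∈ antidiagonal n, n.choose x.1 • (Y ^ x.1 * D x.2)) + 0 ^ n * (-E) := by
    intro n
    -- The inhomogeneous terms add up to `(Y + (-Y))^n`, which is nonzero only for `n = 0`.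
    have hb : ∑ x ∈ antidiagonal n, n.choose x.1 • (Y ^ x.1 * (-Y) ^ x.2)
        = (0 : Matrix d d R⟦X⟧) ^ n := by
      rw [← add_neg_cancel Y, (Commute.refl Y).neg_right.add_pow']
    have h1 : ∑ x ∈ antidiagonal n, n.choose x.2 • (Y ^ (x.1 + 1) * D x.2)
        = Y * ∑ x ∈ antidiagonal n, n.choose x.1 • (Y ^ x.1 * D x.2) := by
      rw [mul_sum]
      refine sum_congr rfl fun x hx => ?_
      rw [HasAntidiagonal.mem_antidiagonal] at hx
      rw [← hx, Nat.choose_symm_add, pow_succ', mul_smul_comm, mul_assoc]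
    have h2 : ∑ x ∈ antidiagonal n, n.choose x.1 • (Y ^ x.1 * D (x.2 + 1))
        = -((∑ x ∈ antidiagonal n, n.choose x.1 • (Y ^ x.1 * D x.2)) * Y) + 0 ^ n * (-E) := by
      rw [← hb, sum_mul, sum_mul, ← sum_neg_distrib, ← sum_add_distrib]
      refine sum_congr rfl fun x _ => ?_
      rw [hD, mul_add, smul_add, smul_mul_assoc, smul_mul_assoc, ← smul_neg, mul_neg (D x.2),
        mul_neg (Y ^ x.1), mul_assoc, mul_assoc]
    rw [sum_antidiagonal_choose_succ_nsmul (fun p q => Y ^ p * D q), h1, h2, matAd]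
    abel
  induction n with
  | zero => rw [step 0]; simp [h0, matAd]
  | succ n ih =>
    rw [step (n + 1), ih, Function.iterate_succ_apply', pow_succ, mul_zero, zero_mul, add_zero]
    simp only [matAd, mul_neg, neg_mul]
    abel

/-- `e^Y M e^{-Y} = ∑_n ad_Y^n(M) / n!`. -/
theorem matExp_conj {Y : Matrix d d R⟦X⟧} (hY : ∀ i j, coeff 0 (Y i j) = 0)
    (M : Matrix d d R⟦X⟧) :
    matExp Y * M * matExp (-Y) = matSum fun n => ((n.factorial : ℂ)⁻¹) • (matAd Y)^[n] M := by
  have hY' : ∀ i j, coeff 0 ((-Y) i j) = 0 := fun i j => by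
    rw [Matrix.neg_apply, map_neg, hY, neg_zero]
  have h2 : OrderGE fun k => ((k.factorial : ℂ)⁻¹) • (-Y) ^ k := (OrderGE.pow hY').smul _
  rw [mul_assoc, matExp_eq_matSum, matExp_eq_matSum, mul_matSum h2,
    matSum_mul ((OrderGE.pow hY).smul _) (h2.mul_left M)]
  congr 1
  funext n
  rw [← sum_choose_conj, ← sum_antidiagonal_factorial_smul n (fun p q => Y ^ p * (M * (-Y) ^ q))]
  refine sum_congr rfl fun x _ => ?_
  rw [mul_smul_comm, smul_mul_smul_comm]

/-! ### Derivations acting coefficientwise, and the derivative of the exponential. -/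

/-- The map `δ` is a derivation on the subalgebra `S`. -/
structure IsDerivOn (S : Subalgebra ℂ R) (δ : R → R) : Prop where
  add : ∀ {x y}, x ∈ S → y ∈ S → δ (x + y) = δ x + δ y
  mul : ∀ {x y}, x ∈ S → y ∈ S → δ (x * y) = δ x * y + x * δ y
  smul : ∀ (z : ℂ) {x}, x ∈ S → δ (z • x) = z • δ x

variable {S : Subalgebra ℂ R} {δ : R → R}

theorem IsDerivOn.zero (h : IsDerivOn S δ) : δ 0 = 0 := by
  simpa using h.smul 0 S.zero_mem

theorem IsDerivOn.one (h : IsDerivOn S δ) : δ 1 = 0 := by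
  simpa using h.mul S.one_mem S.one_mem

theorem IsDerivOn.neg (h : IsDerivOn S δ) {x : R} (hx : x ∈ S) : δ (-x) = -δ x := by
  have := h.smul (-1) hx
  simpa using this

theorem IsDerivOn.sum (h : IsDerivOn S δ) {κ : Type*} (t : Finset κ) {u : κ → R}
    (hu : ∀ k ∈ t, u k ∈ S) : δ (∑ k ∈ t, u k) = ∑ k ∈ t, δ (u k) := by
  classical
  induction t using Finset.induction_on with
  | empty => simp [h.zero]
  | insert a t ha ih =>
    rw [sum_insert ha, sum_insert ha, h.add (hu a (by simp))
      (S.sum_mem fun k hk => hu k (by simp [hk])), ih fun k hk => hu k (by simp [hk])]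

/-- All coefficients of the entries lie in `S`. -/
def CoeffIn (S : Subalgebra ℂ R) (M : Matrix d d R⟦X⟧) : Prop :=
  ∀ i j n, coeff n (M i j) ∈ S

theorem CoeffIn.mul {M N : Matrix d d R⟦X⟧} (hM : CoeffIn S M) (hN : CoeffIn S N) :
    CoeffIn S (M * N) := by
  intro i j n
  simp only [Matrix.mul_apply, map_sum, coeff_mul]
  exact S.sum_mem fun l _ => S.sum_mem fun x _ => S.mul_mem (hM i l _) (hN l j _)

theorem CoeffIn.pow {M : Matrix d d R⟦X⟧} (hM : CoeffIn S M) (k : ℕ) : CoeffIn S (M ^ k) := by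
  induction k with
  | zero =>
    intro i j n
    rw [pow_zero, Matrix.one_apply]
    split_ifs
    · rw [coeff_one]
      split_ifs
      · exact S.one_mem
      · exact S.zero_mem
    · simp
  | succ k ih => rw [pow_succ]; exact ih.mul hM

theorem CoeffIn.smul {M : Matrix d d R⟦X⟧} (hM : CoeffIn S M) (z : ℂ) : CoeffIn S (z • M) :=
  fun i j n => S.smul_mem (hM i j n) z

theorem CoeffIn.neg {M : Matrix d d R⟦X⟧} (hM : CoeffIn S M) : CoeffIn S (-M) := by
  intro i j n
  rw [Matrix.neg_apply, map_neg]
  exact S.neg_mem (hM i j n)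

theorem coeff_mapCoeff (n : ℕ) (u : R⟦X⟧) : coeff n (mapCoeff δ u) = δ (coeff n u) := by
  simp [mapCoeff]

theorem map_mapCoeff_mul (h : IsDerivOn S δ) {M N : Matrix d d R⟦X⟧} (hM : CoeffIn S M)
    (hN : CoeffIn S N) :
    (M * N).map (mapCoeff δ) = M.map (mapCoeff δ) * N + M * N.map (mapCoeff δ) := by
  ext i j n
  simp only [Matrix.map_apply, Matrix.add_apply, coeff_mapCoeff, Matrix.mul_apply, map_sum,
    coeff_mul, map_add]
  rw [h.sum _ fun l _ => S.sum_mem fun x _ => S.mul_mem (hM i l _) (hN l j _), ← sum_add_distrib]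
  refine sum_congr rfl fun l _ => ?_
  rw [h.sum _ fun x _ => S.mul_mem (hM i l _) (hN l j _), ← sum_add_distrib]
  exact sum_congr rfl fun x _ => h.mul (hM i l _) (hN l j _)

theorem map_mapCoeff_smul (h : IsDerivOn S δ) {M : Matrix d d R⟦X⟧} (hM : CoeffIn S M) (z : ℂ) :
    (z • M).map (mapCoeff δ) = z • M.map (mapCoeff δ) := by
  ext i j n
  change coeff n (mapCoeff δ (z • M i j)) = coeff n (z • mapCoeff δ (M i j))
  rw [coeff_mapCoeff, coeff_complex_smul, coeff_complex_smul, coeff_mapCoeff, h.smul z (hM i j n)]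

theorem map_mapCoeff_neg (h : IsDerivOn S δ) {M : Matrix d d R⟦X⟧} (hM : CoeffIn S M) :
    (-M).map (mapCoeff δ) = -M.map (mapCoeff δ) := by
  ext i j n
  simp only [Matrix.map_apply, Matrix.neg_apply, coeff_mapCoeff, map_neg]
  rw [h.neg (hM i j n)]

theorem map_mapCoeff_one (h : IsDerivOn S δ) :
    (1 : Matrix d d R⟦X⟧).map (mapCoeff δ) = 0 := by
  ext i j n
  simp only [Matrix.map_apply, coeff_mapCoeff, Matrix.one_apply, Matrix.zero_apply]
  split_ifs
  · rw [coeff_one]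
    split_ifs
    · simpa using h.one
    · simpa using h.zero
  · simpa using h.zero

theorem map_mapCoeff_matSum (h : IsDerivOn S δ) {Z : ℕ → Matrix d d R⟦X⟧}
    (hZ : ∀ k, CoeffIn S (Z k)) :
    (matSum Z).map (mapCoeff δ) = matSum fun k => (Z k).map (mapCoeff δ) := by
  ext i j n
  rw [Matrix.map_apply, coeff_mapCoeff, coeff_matSum, coeff_matSum, h.sum _ fun k _ => hZ k i j n]
  simp only [Matrix.map_apply, coeff_mapCoeff]

theorem OrderGE.map_mapCoeff (h : IsDerivOn S δ) {Z : ℕ → Matrix d d R⟦X⟧} (hZ : OrderGE Z) :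
    OrderGE fun k => (Z k).map (mapCoeff δ) := by
  intro k n i j hn
  change coeff n ((Z k).map (mapCoeff δ) i j) = 0
  rw [Matrix.map_apply, coeff_mapCoeff, hZ k n i j hn, h.zero]

/-- `e^Y δ(e^{-Y}) = -∑_n ad_Y^n(δY) / (n+1)!`. -/
theorem matExp_mul_deriv (h : IsDerivOn S δ) {Y : Matrix d d R⟦X⟧}
    (hY : ∀ i j, coeff 0 (Y i j) = 0) (hS : CoeffIn S Y) :
    matExp Y * (matExp (-Y)).map (mapCoeff δ)
      = matSum fun n => Nat.casesOn n 0 fun n =>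
        -((((n + 1).factorial : ℂ)⁻¹) • (matAd Y)^[n] (Y.map (mapCoeff δ))) := by
  have hY' : ∀ i j, coeff 0 ((-Y) i j) = 0 := fun i j => by
    rw [Matrix.neg_apply, map_neg, hY, neg_zero]
  have e : (fun k : ℕ => (((k.factorial : ℂ)⁻¹) • (-Y) ^ k).map (mapCoeff δ))
      = fun k : ℕ => ((k.factorial : ℂ)⁻¹) • ((-Y) ^ k).map (mapCoeff δ) :=
    funext fun k => map_mapCoeff_smul h (hS.neg.pow k) _
  rw [matExp_eq_matSum, matExp_eq_matSum,
    map_mapCoeff_matSum h (fun k => (hS.neg.pow k).smul _), e,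
    matSum_mul ((OrderGE.pow hY).smul _) (((OrderGE.pow hY').map_mapCoeff h).smul _)]
  congr 1
  funext n
  have e2 : ∀ x : ℕ × ℕ, (((x.1.factorial : ℂ)⁻¹) • Y ^ x.1)
      * (((x.2.factorial : ℂ)⁻¹) • ((-Y) ^ x.2).map (mapCoeff δ))
      = ((x.1.factorial : ℂ)⁻¹ * (x.2.factorial : ℂ)⁻¹)
        • (Y ^ x.1 * ((-Y) ^ x.2).map (mapCoeff δ)) := fun x => smul_mul_smul_comm _ _ _ _
  rw [sum_congr rfl fun x _ => e2 x,
    sum_antidiagonal_factorial_smul n (fun p q => Y ^ p * ((-Y) ^ q).map (mapCoeff δ))]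
  -- The zeroth term is `δ(1) = 0`; the term of index `n + 1` carries `1/(n+1)!` but only the `n`-th
  -- power of `ad_Y`.
  cases n with
  | zero => simp [map_mapCoeff_one h]
  | succ n =>
    rw [sum_choose_deriv Y (fun q => ((-Y) ^ q).map (mapCoeff δ)) (Y.map (mapCoeff δ))
      (by simpa using map_mapCoeff_one h), smul_neg]
    intro q
    rw [pow_succ, map_mapCoeff_mul h (hS.neg.pow q) hS.neg, map_mapCoeff_neg h hS]

end FormalSums

end StringYM

end

open scoped Distributions LineDeriv PowerSeries Pointwise ContDiff Topology

noncomputable section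

namespace StringYM

set_option linter.unusedSectionVars false

/-! ### The gauge transform in components -/

section GaugeTransform

open PowerSeries Finset

section Algebraic

variable {R : Type*} [CommRing R] [Algebra ℂ R] {ι d : Type*} [Fintype ι] [Fintype d]
  [DecidableEq d]

theorem toMatrix_apply (ξ : ι → Matrix d d ℂ) (X : ι → R) (i j : d) :
    toMatrix ξ X i j = ∑ a, ξ a i j • X a := rfl

theorem coeff_toMatrix (ξ : ι → Matrix d d ℂ) (u : ι → R⟦X⟧) (n : ℕ) (i j : d) :
    coeff n (toMatrix ξ u i j) = ∑ a, ξ a i j • coeff n (u a) := by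
  rw [toMatrix_apply, map_sum]
  rfl

theorem toMatrix_eq_sum (ξ : ι → Matrix d d ℂ) (X : ι → R) :
    toMatrix ξ X = ∑ a, X a • (ξ a).map (algebraMap ℂ R) := by
  ext i j
  rw [toMatrix_apply, Matrix.sum_apply]
  refine sum_congr rfl fun a _ => ?_
  rw [Matrix.smul_apply, Matrix.map_apply, smul_eq_mul, mul_comm, Algebra.smul_def]

/-- The bracket `ad_{iX}` is the commutator with `iX`. -/
theorem toMatrix_ad (𝔤 : GaugeAlgebra ι d) (X Y : ι → R) :
    toMatrix 𝔤.ξ (ad 𝔤.f X Y)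
      = (Complex.I • toMatrix 𝔤.ξ X) * toMatrix 𝔤.ξ Y
        - toMatrix 𝔤.ξ Y * (Complex.I • toMatrix 𝔤.ξ X) := by
  let P : ι → Matrix d d R := fun a => (𝔤.ξ a).map (algebraMap ℂ R)
  have hP : ∀ a b, Complex.I • (P a * P b - P b * P a) = ∑ e, (𝔤.f a b e : ℂ) • P e := by
    intro a b
    have h := congrArg (fun M : Matrix d d ℂ => M.map (algebraMap ℂ R)) (𝔤.commutator a b)
    ext i j
    have hij := congrFun (congrFun h i) j
    simp only [Matrix.map_apply, Matrix.smul_apply, Matrix.sub_apply, Matrix.mul_apply,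
      Matrix.sum_apply, smul_eq_mul, map_mul, map_sub, map_sum] at hij
    simp only [P, Matrix.smul_apply, Matrix.sub_apply, Matrix.mul_apply, Matrix.map_apply,
      Matrix.sum_apply]
    simp only [Algebra.smul_def]
    exact hij
  have e1 : toMatrix 𝔤.ξ (ad 𝔤.f X Y) = ∑ a, ∑ b, (X a * Y b) • ∑ e, (𝔤.f a b e : ℂ) • P e := by
    rw [toMatrix_eq_sum]
    simp only [ad, sum_smul, smul_sum]
    rw [sum_comm]
    refine sum_congr rfl fun a _ => ?_
    rw [sum_comm]
    refine sum_congr rfl fun b _ => sum_congr rfl fun e _ => ?_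
    rw [smul_assoc, smul_comm]
  have e2 : toMatrix 𝔤.ξ X * toMatrix 𝔤.ξ Y = ∑ a, ∑ b, (X a * Y b) • (P a * P b) := by
    rw [toMatrix_eq_sum, toMatrix_eq_sum, sum_mul_sum]
    exact sum_congr rfl fun a _ => sum_congr rfl fun b _ => smul_mul_smul_comm _ _ _ _
  have e3 : toMatrix 𝔤.ξ Y * toMatrix 𝔤.ξ X = ∑ a, ∑ b, (X a * Y b) • (P b * P a) := by
    rw [toMatrix_eq_sum, toMatrix_eq_sum, sum_mul_sum, sum_comm]
    refine sum_congr rfl fun a _ => sum_congr rfl fun b _ => ?_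
    rw [smul_mul_smul_comm, mul_comm (Y b)]
  rw [smul_mul_assoc, mul_smul_comm, ← smul_sub, e2, e3, ← sum_sub_distrib, e1, smul_sum]
  refine sum_congr rfl fun a _ => ?_
  rw [← sum_sub_distrib, smul_sum]
  refine sum_congr rfl fun b _ => ?_
  rw [← smul_sub, ← hP, smul_comm]

theorem toMatrix_ad_iterate (𝔤 : GaugeAlgebra ι d) (u v : ι → R⟦X⟧) (n : ℕ) :
    toMatrix 𝔤.ξ ((ad 𝔤.f u)^[n] v)
      = (matAd (Complex.I • toMatrix 𝔤.ξ u))^[n] (toMatrix 𝔤.ξ v) := by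
  induction n with
  | zero => rfl
  | succ n ih =>
    rw [Function.iterate_succ_apply', Function.iterate_succ_apply', toMatrix_ad, ih, matAd]

theorem ad_iterate_add (f : ι → ι → ι → ℝ) (u v w : ι → R) (n : ℕ) :
    (ad f u)^[n] (v + w) = (ad f u)^[n] v + (ad f u)^[n] w := by
  induction n with
  | zero => rfl
  | succ n ih => simp only [Function.iterate_succ_apply', ih, ad_add_right]

theorem ad_iterate_smul (f : ι → ι → ι → ℝ) (u v : ι → R) (z : ℂ) (n : ℕ) :
    (ad f u)^[n] (z • v) = z • (ad f u)^[n] v := by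
  induction n with
  | zero => rfl
  | succ n ih => simp only [Function.iterate_succ_apply', ih, ad_smul_right]

theorem ad_mul_right (f : ι → ι → ι → ℝ) (r : R) (u v : ι → R) :
    (ad f u fun a => r * v a) = fun a => r * ad f u v a := by
  funext e
  simp only [ad, mul_sum]
  refine sum_congr rfl fun a _ => sum_congr rfl fun b _ => ?_
  rw [mul_smul_comm]
  congr 1
  ring

theorem ad_iterate_mul (f : ι → ι → ι → ℝ) (r : R) (u v : ι → R) (n : ℕ) :
    (ad f u)^[n] (fun a => r * v a) = fun a => r * (ad f u)^[n] v a := by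
  induction n with
  | zero => rfl
  | succ n ih => simp only [Function.iterate_succ_apply', ih, ad_mul_right]

/-- For hermitean matrices the adjoint of a complex linear relation is the relation with conjugated
coefficients. Real and imaginary parts are then separate real relations. -/
theorem linearIndependent_complex (𝔤 : GaugeAlgebra ι d) {z : ι → ℂ}
    (h : ∀ i j, ∑ a, 𝔤.ξ a i j * z a = 0) (a : ι) : z a = 0 := by
  have hstar : ∀ i j, ∑ a, 𝔤.ξ a i j * star (z a) = 0 := by
    intro i j
    have := congrArg star (h j i)
    rw [star_sum, star_zero] at this
    rw [← this]
    refine sum_congr rfl fun b _ => ?_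
    rw [star_mul', ← Matrix.conjTranspose_apply, (𝔤.hermitian b).eq]
  have hli := Fintype.linearIndependent_iff.1 𝔤.linearIndependent
  have hre : ∑ a, (z a).re • 𝔤.ξ a = 0 := by
    ext i j
    have e : ∀ b, (z b).re • 𝔤.ξ b i j
        = (1 / 2 : ℂ) * (𝔤.ξ b i j * z b + 𝔤.ξ b i j * star (z b)) := by
      intro b
      rw [← mul_add, Complex.star_def, Complex.add_conj, Complex.real_smul]
      push_cast
      ring
    simp only [Matrix.sum_apply, Matrix.smul_apply, Matrix.zero_apply, e]
    rw [← mul_sum, sum_add_distrib, h, hstar]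
    simp
  have him : ∑ a, (z a).im • 𝔤.ξ a = 0 := by
    ext i j
    have e : ∀ b, (z b).im • 𝔤.ξ b i j
        = (-Complex.I / 2 : ℂ) * (𝔤.ξ b i j * z b - 𝔤.ξ b i j * star (z b)) := by
      intro b
      rw [← mul_sub, Complex.star_def, Complex.sub_conj, Complex.real_smul]
      push_cast
      linear_combination ((z b).im * 𝔤.ξ b i j) * Complex.I_sq
    simp only [Matrix.sum_apply, Matrix.smul_apply, Matrix.zero_apply, e]
    rw [← mul_sum, sum_sub_distrib, h, hstar]
    simp
  exact Complex.ext (hli _ hre a) (hli _ him a)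

end Algebraic

variable {ι d : Type*} {C : ProperCone ℝ Spacetime}

/-- The algebra of smooth fields. -/
def smoothFields (C : ProperCone ℝ Spacetime) (ι : Type*) : Subalgebra ℂ (WickField C ι) where
  carrier := {X | ∀ A, ContDiff ℝ ∞ (X A)}
  mul_mem' hX hY A := (hX A).mul (hY A)
  add_mem' hX hY A := (hX A).add (hY A)
  algebraMap_mem' _ _ := contDiff_const

theorem isDerivOn_pd (μ : Fin 4) : IsDerivOn (smoothFields C ι) (pd μ) where
  add hX hY := funext fun A => partialDeriv_add (hX A) (hY A) μ
  mul hX hY := funext fun A => partialDeriv_mul (hX A) (hY A) μ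
  smul z _ hX := funext fun A => partialDeriv_smul (hX A) z μ

variable [Fintype ι] [Fintype d] [DecidableEq d]

/-- `g⁻¹ ∂_μ γ` for `γ` without term of order `g⁰`. -/
def gradShift (μ : Fin 4) (γ : ι → (WickField C ι)⟦X⟧) : ι → (WickField C ι)⟦X⟧ :=
  fun a => PowerSeries.mk fun k => pd μ (coeff (k + 1) (γ a))

theorem X_mul_gradShift (μ : Fin 4) {γ : ι → (WickField C ι)⟦X⟧} (h0 : ∀ a, coeff 0 (γ a) = 0)
    (a : ι) : X * gradShift μ γ a = mapCoeff (pd μ) (γ a) := by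
  ext1 n
  cases n with
  | zero => rw [coeff_mapCoeff, h0, pd_zero, coeff_zero_X_mul]
  | succ n => rw [coeff_mapCoeff, coeff_succ_X_mul, gradShift, coeff_mk]

theorem coeff_Sig (f : ι → ι → ι → ℝ) (γ : ι → (WickField C ι)⟦X⟧) (μ : Fin 4) (a : ι) (m : ℕ) :
    coeff m (Sig f γ μ a) = ∑ n ∈ Icc 1 m, ((n.factorial : ℂ)⁻¹) • coeff m
      ((ad f γ)^[n] ((fun b => PowerSeries.C (potential μ b))
        + (((n : ℂ) + 1)⁻¹) • gradShift μ γ) a) := by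
  simp only [Sig, coeff_mk]
  rfl

/-- With `Y = iγ`, the conjugation series yields `ad_{iγ}^n(A_μ)/n!` and the derivative series
yields `ad_{iγ}^n(∂_μ γ)/(n+1)!`. The terms `n = 0` are `gA_μ + ∂_μ γ`, and the others make up
`gΣ_μ(γ)`. -/
theorem gaugeTransform_eq (𝔤 : GaugeAlgebra ι d) {γ : ι → (WickField C ι)⟦X⟧}
    (h0 : ∀ a, coeff 0 (γ a) = 0) (hγ : ∀ n a, coeff n (γ a) ∈ smoothFields C ι) (μ : Fin 4) :
    gaugeTransform 𝔤.ξ γ μ = toMatrix 𝔤.ξ fun a =>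
      X * (PowerSeries.C (potential μ a) + Sig 𝔤.f γ μ a) + mapCoeff (pd μ) (γ a) := by
  set Y : Matrix d d (WickField C ι)⟦X⟧ := Complex.I • toMatrix 𝔤.ξ γ with hYdef
  set Φ : ι → (WickField C ι)⟦X⟧ := fun b => PowerSeries.C (potential μ b) with hΦ
  set Ψ := gradShift μ γ with hΨ
  have hY0 : ∀ i j, coeff 0 (Y i j) = 0 := by
    intro i j
    rw [hYdef, Matrix.smul_apply, coeff_complex_smul, coeff_toMatrix]
    simp only [h0, smul_zero, sum_const_zero]
  have hmem : CoeffIn (smoothFields C ι) (toMatrix 𝔤.ξ γ) := by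
    intro i j n
    rw [coeff_toMatrix]
    exact Subalgebra.sum_mem _ fun a _ => Subalgebra.smul_mem _ (hγ n a) _
  have hDγ : (toMatrix 𝔤.ξ γ).map (mapCoeff (pd μ))
      = toMatrix 𝔤.ξ fun a => X * Ψ a := by
    ext1 i j
    ext1 n
    rw [Matrix.map_apply, coeff_mapCoeff, coeff_toMatrix, coeff_toMatrix,
      (isDerivOn_pd μ).sum _ fun a _ => Subalgebra.smul_mem _ (hγ n a) _]
    refine sum_congr rfl fun a _ => ?_
    rw [(isDerivOn_pd μ).smul _ (hγ n a), hΨ, X_mul_gradShift μ h0, coeff_mapCoeff]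
  have h1 := matExp_conj hY0 (toMatrix 𝔤.ξ Φ)
  have h2 := matExp_mul_deriv (isDerivOn_pd μ) hY0 (hmem.smul Complex.I)
  have e : gaugeTransform 𝔤.ξ γ μ
      = (X : (WickField C ι)⟦X⟧) • (matExp Y * toMatrix 𝔤.ξ Φ * matExp (-Y))
        + Complex.I • (matExp Y * (matExp (-Y)).map (mapCoeff (pd μ))) := rfl
  -- The family defined by cases is made opaque; only its zeroth term and its successor terms are
  -- needed.
  obtain ⟨Z, hZ, hZ0, hZs⟩ : ∃ Z : ℕ → Matrix d d (WickField C ι)⟦X⟧,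
      matExp Y * (matExp (-Y)).map (mapCoeff (pd μ)) = matSum Z ∧ Z 0 = 0 ∧
      ∀ n, Z (n + 1)
        = -((((n + 1).factorial : ℂ)⁻¹) • (matAd Y)^[n] (Y.map (mapCoeff (pd μ)))) :=
    ⟨_, h2, rfl, fun _ => rfl⟩
  rw [e, h1, hZ]
  ext1 i j
  ext1 m
  have hI : ∀ n, (matAd Y)^[n] (Y.map (mapCoeff (pd μ)))
      = Complex.I • toMatrix 𝔤.ξ (fun a => X * (ad 𝔤.f γ)^[n] Ψ a) := by
    intro n
    rw [hYdef, map_mapCoeff_smul (isDerivOn_pd μ) hmem, hDγ, matAd_iterate_smul,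
      ← toMatrix_ad_iterate, ad_iterate_mul]
  rw [coeff_toMatrix, Matrix.add_apply, map_add, Matrix.smul_apply, Matrix.smul_apply,
    coeff_complex_smul, smul_eq_mul]
  cases m with
  | zero =>
    rw [coeff_zero_X_mul, coeff_matSum, zero_add, zero_add, range_one, sum_singleton, hZ0,
      Matrix.zero_apply, map_zero, smul_zero]
    refine (sum_eq_zero fun a _ => ?_).symm
    rw [map_add, coeff_zero_X_mul, coeff_mapCoeff, h0, pd_zero, add_zero, smul_zero]
  | succ m =>
    have hA : coeff m (matSum (fun n => ((n.factorial : ℂ)⁻¹) • (matAd Y)^[n] (toMatrix 𝔤.ξ Φ)) i j)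
        = ∑ n ∈ range (m + 1), ∑ a, 𝔤.ξ a i j •
          ((n.factorial : ℂ)⁻¹) • coeff m ((ad 𝔤.f γ)^[n] Φ a) := by
      rw [coeff_matSum]
      refine sum_congr rfl fun n _ => ?_
      rw [← toMatrix_ad_iterate, Matrix.smul_apply, coeff_complex_smul, coeff_toMatrix, smul_sum]
      exact sum_congr rfl fun a _ => smul_comm _ _ _
    have hB : Complex.I • coeff (m + 1) (matSum Z i j)
        = ∑ n ∈ range (m + 1), ∑ a, 𝔤.ξ a i j •
          (((n + 1).factorial : ℂ)⁻¹) • coeff m ((ad 𝔤.f γ)^[n] Ψ a) := by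
      rw [coeff_matSum, sum_range_succ', hZ0, Matrix.zero_apply, map_zero, add_zero, smul_sum]
      refine sum_congr rfl fun n _ => ?_
      rw [hZs, hI, Matrix.neg_apply, map_neg, Matrix.smul_apply, Matrix.smul_apply,
        coeff_complex_smul, coeff_complex_smul, coeff_toMatrix, smul_neg,
        smul_comm (((n + 1).factorial : ℂ)⁻¹),
        smul_smul, Complex.I_mul_I, neg_smul, one_smul, neg_neg, smul_sum]
      refine sum_congr rfl fun a _ => ?_
      rw [coeff_succ_X_mul, smul_comm]
    rw [coeff_succ_X_mul, hA, hB, sum_comm, sum_comm (s := range (m + 1)), ← sum_add_distrib]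
    refine sum_congr rfl fun a _ => ?_
    -- The terms `n = 0` are split off. For `n ≥ 1` the identity `1/(n+1)! = (1/n!) (1/(n+1))`
    -- reproduces the weight in `Sig`.
    rw [map_add, coeff_succ_X_mul, map_add, coeff_mapCoeff, coeff_Sig, ← smul_sum, ← smul_sum,
      ← smul_add, ← sum_add_distrib, range_eq_Ico, sum_eq_sum_Ico_succ_bot (Nat.succ_pos m),
      add_right_comm]
    refine congrArg (𝔤.ξ a i j • ·) (congrArg₂ _ (congrArg₂ _ ?_ ?_) ?_)
    · simp [hΦ]
    · rw [zero_add, Nat.succ_eq_add_one, Ico_add_one_right_eq_Icc]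
      refine sum_congr rfl fun n _ => ?_
      rw [ad_iterate_add, ad_iterate_smul, Pi.add_apply, map_add, Pi.smul_apply,
        coeff_complex_smul, smul_add, smul_smul, Nat.factorial_succ, Nat.cast_mul, mul_inv,
        mul_comm ((n + 1 : ℕ) : ℂ)⁻¹, Nat.cast_succ]
    · simp [hΨ, gradShift]

end GaugeTransform

end StringYM

end

open scoped Distributions LineDeriv PowerSeries Pointwise ContDiff Topology

noncomputable section

namespace StringYM

set_option linter.unusedSectionVars false

/-! ### Power series of fields and the recursion for `γ` -/

section Axial

open PowerSeries Finset

theorem coeff_below {R : Type*} [CommRing R] (n k : ℕ) (u : R⟦X⟧) :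
    coeff k (below n u) = if k < n then coeff k u else 0 := by
  rw [below, Polynomial.coeff_coe, coeff_trunc]

/-- Definition of a sequence by recursion on its truncations. -/
theorem exists_eq_truncation {M : Type*} [Zero M] (Φ : ℕ → (ℕ → M) → M) :
    ∃ u : ℕ → M, ∀ n, u n = Φ n fun k => if k < n then u k else 0 := by
  let u : ℕ → M := fun n =>
    Nat.strongRec (fun n ih => Φ n fun k => if h : k < n then ih k h else 0) n
  refine ⟨u, fun n => ?_⟩
  have : u n = Φ n fun k => if _ : k < n then u k else 0 := Nat.strongRec_eq _ _
  simpa using this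

theorem coeff_ad {R ι : Type*} [CommRing R] [Algebra ℂ R] [Fintype ι] (f : ι → ι → ι → ℝ)
    (u v : ι → R⟦X⟧) (n : ℕ) (e : ι) :
    coeff n (ad f u v e) = ∑ p ∈ antidiagonal n,
      ad f (fun a => coeff p.1 (u a)) (fun a => coeff p.2 (v a)) e := by
  simp only [ad, map_sum, coeff_complex_smul, coeff_mul, smul_sum]
  rw [sum_comm (s := antidiagonal n)]
  refine sum_congr rfl fun a _ => ?_
  rw [sum_comm]

variable {ι d : Type*} [Fintype ι] {s : StringFunction} {f : ι → ι → ι → ℝ}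

/-- `γ ∈ 𝒮[[g]]`. -/
def SeriesS (s : StringFunction) (f : ι → ι → ι → ℝ) (γ : ι → (WickField s.cone ι)⟦X⟧) : Prop :=
  ∀ n, (fun a => coeff n (γ a)) ∈ spaceS s f

/-- `v ∈ 𝒱[[g]]`. -/
def SeriesV (s : StringFunction) (f : ι → ι → ι → ℝ)
    (v : Fin 4 → ι → (WickField s.cone ι)⟦X⟧) : Prop :=
  ∀ n, (fun μ a => coeff n (v μ a)) ∈ spaceV s f

theorem sum_smul_mem_spaceV {κ : Type*} (t : Finset κ) (r : κ → ℝ)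
    {v : κ → Fin 4 → ι → WickField s.cone ι} (h : ∀ k ∈ t, v k ∈ spaceV s f) :
    (fun μ a => ∑ k ∈ t, (r k : ℂ) • v k μ a) ∈ spaceV s f := by
  have e : (fun μ a => ∑ k ∈ t, (r k : ℂ) • v k μ a) = ∑ k ∈ t, r k • v k := by
    funext μ a
    simp only [Finset.sum_apply, Pi.smul_apply]
    exact sum_congr rfl fun k _ => (real_smul_eq (r k) (v k μ a)).symm
  rw [e]
  exact Submodule.sum_mem _ fun k hk => Submodule.smul_mem _ _ (h k hk)

theorem sum_mem_spaceV {κ : Type*} (t : Finset κ)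
    {v : κ → Fin 4 → ι → WickField s.cone ι} (h : ∀ k ∈ t, v k ∈ spaceV s f) :
    (fun μ a => ∑ k ∈ t, v k μ a) ∈ spaceV s f := by
  have e : (fun μ a => ∑ k ∈ t, v k μ a) = ∑ k ∈ t, v k := by
    funext μ a
    simp only [Finset.sum_apply]
  rw [e]
  exact Submodule.sum_mem _ h

namespace SeriesV

variable {γ : ι → (WickField s.cone ι)⟦X⟧} {v w : Fin 4 → ι → (WickField s.cone ι)⟦X⟧}

theorem regular (hv : SeriesV s f v) (n : ℕ) (μ : Fin 4) (a : ι) : Regular (coeff n (v μ a)) :=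
  (spaceV_realRegular (hv n) μ a).1

theorem add (hv : SeriesV s f v) (hw : SeriesV s f w) : SeriesV s f fun μ a => v μ a + w μ a :=
  fun n => Submodule.add_mem _ (hv n) (hw n)

theorem const_smul (hv : SeriesV s f v) (r : ℝ) : SeriesV s f fun μ a => (r : ℂ) • v μ a := by
  intro n
  have := sum_smul_mem_spaceV (univ : Finset Unit) (fun _ => r) fun _ _ => hv n
  simp only [univ_unique, sum_singleton] at this
  exact this

theorem const {v : Fin 4 → ι → WickField s.cone ι} (hv : v ∈ spaceV s f) :
    SeriesV s f fun μ a => PowerSeries.C (v μ a) := by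
  intro n
  by_cases h : n = 0
  · subst h
    simpa using hv
  · have : (fun μ a => coeff n (PowerSeries.C (v μ a))) = 0 := by
      funext μ a
      simp [coeff_C, h]
    rw [this]
    exact Submodule.zero_mem _

theorem X_mul (hv : SeriesV s f v) : SeriesV s f fun μ a => X * v μ a := by
  intro n
  cases n with
  | zero =>
    simp only [coeff_zero_X_mul]
    exact Submodule.zero_mem _
  | succ n =>
    simp only [coeff_succ_X_mul]
    exact hv n

theorem gradShift (hγ : SeriesS s f γ) : SeriesV s f fun μ => gradShift μ γ := by
  intro n
  simp only [StringYM.gradShift, coeff_mk]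
  exact grad_mem_spaceV (hγ (n + 1))

theorem ad (hγ : SeriesS s f γ) (hv : SeriesV s f v) : SeriesV s f fun μ => ad f γ (v μ) := by
  intro n
  simp only [coeff_ad]
  exact sum_mem_spaceV _ fun p _ => ad_mem_spaceV (hγ p.1) (hv p.2)

theorem ad_iterate (hγ : SeriesS s f γ) (hv : SeriesV s f v) (n : ℕ) :
    SeriesV s f fun μ => (StringYM.ad f γ)^[n] (v μ) := by
  induction n with
  | zero => exact hv
  | succ n ih =>
    simp only [Function.iterate_succ_apply']
    exact ih.ad hγ

theorem sig (hγ : SeriesS s f γ) : SeriesV s f (Sig f γ) := by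
  intro m
  have hbase : ∀ n : ℕ, SeriesV s f fun μ => (fun b => PowerSeries.C (potential μ b))
      + (((n : ℂ) + 1)⁻¹) • StringYM.gradShift μ γ := by
    intro n
    have h := (SeriesV.const (potential_mem_spaceV (s := s) (f := f))).add
      ((SeriesV.gradShift hγ).const_smul ((n : ℝ) + 1)⁻¹)
    push_cast at h
    exact h
  have h := sum_smul_mem_spaceV (Icc 1 m) (fun n => ((n.factorial : ℝ))⁻¹)
    fun n _ => ((hbase n).ad_iterate hγ n) m
  push_cast at h
  simp only [coeff_Sig]
  exact h

end SeriesV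

/-- Agreement of the terms of order less than `n` at the configuration `A`. -/
def AgreeAt {C : ProperCone ℝ Spacetime} (A : Config C ι) (n : ℕ)
    (u v : ι → (WickField C ι)⟦X⟧) : Prop :=
  ∀ k < n, ∀ a, coeff k (u a) A = coeff k (v a) A

section Agree

variable {C : ProperCone ℝ Spacetime} {A : Config C ι} {n : ℕ}
  {γ γ' v v' : ι → (WickField C ι)⟦X⟧}

theorem ad_apply (f : ι → ι → ι → ℝ) (X Y : ι → WickField C ι) (e : ι) (A : Config C ι) :
    ad f X Y e A = ∑ a, ∑ b, (f a b e : ℂ) • (X a A * Y b A) := by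
  simp only [ad, Finset.sum_apply]
  rfl

/-- A bracket with a series that starts at order `g` gains one order for the second argument. -/
theorem AgreeAt.ad (h0 : ∀ a, coeff 0 (γ a) = 0) (h0' : ∀ a, coeff 0 (γ' a) = 0)
    (hγ : AgreeAt A (n + 1) γ γ') (hv : AgreeAt A n v v') :
    AgreeAt A (n + 1) (ad f γ v) (ad f γ' v') := by
  intro k hk e
  simp only [coeff_ad, Finset.sum_apply]
  refine sum_congr rfl fun p hp => ?_
  rw [HasAntidiagonal.mem_antidiagonal] at hp
  simp only [ad_apply]
  refine sum_congr rfl fun a _ => sum_congr rfl fun b _ => ?_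
  by_cases hp1 : p.1 = 0
  · rw [hp1, h0, h0']
    simp
  · rw [hγ p.1 (by omega), hv p.2 (by omega)]

theorem AgreeAt.ad_iterate (h0 : ∀ a, coeff 0 (γ a) = 0) (h0' : ∀ a, coeff 0 (γ' a) = 0)
    (hγ : AgreeAt A (n + 1) γ γ') (hv : AgreeAt A n v v') (j : ℕ) :
    AgreeAt A (n + 1) ((StringYM.ad f γ)^[j + 1] v) ((StringYM.ad f γ')^[j + 1] v') := by
  induction j with
  | zero => exact AgreeAt.ad h0 h0' hγ hv
  | succ j ih =>
    rw [Function.iterate_succ_apply', Function.iterate_succ_apply' (StringYM.ad f γ')]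
    exact AgreeAt.ad h0 h0' hγ fun k hk => ih k (by omega)

/-- The order lost in `g⁻¹ ∂_μ γ` is regained by the at least one bracket with `γ` in every term of
`Σ`. -/
theorem AgreeAt.sig (h0 : ∀ a, coeff 0 (γ a) = 0) (h0' : ∀ a, coeff 0 (γ' a) = 0)
    (hγ : AgreeAt A (n + 1) γ γ') (μ : Fin 4) : AgreeAt A (n + 1) (Sig f γ μ) (Sig f γ' μ) := by
  intro m hm a
  simp only [coeff_Sig, Finset.sum_apply]
  refine sum_congr rfl fun j hj => ?_
  obtain ⟨j, rfl⟩ : ∃ i, j = i + 1 := ⟨j - 1, by simp only [mem_Icc] at hj; omega⟩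
  have hbase : AgreeAt A n
      ((fun b => PowerSeries.C (potential μ b)) + ((((j + 1 : ℕ) : ℂ) + 1)⁻¹) • gradShift μ γ)
      ((fun b => PowerSeries.C (potential μ b)) + ((((j + 1 : ℕ) : ℂ) + 1)⁻¹) • gradShift μ γ') := by
    intro k hk b
    have hg : pd μ (coeff (k + 1) (γ b)) A = pd μ (coeff (k + 1) (γ' b)) A :=
      congrArg (partialDeriv μ) (hγ (k + 1) (by omega) b)
    simp only [Pi.add_apply, Pi.smul_apply, map_add, coeff_complex_smul, gradShift, coeff_mk, hg]
  have h := AgreeAt.ad_iterate (f := f) h0 h0' hγ hbase j m hm a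
  simp only [Pi.smul_apply, h]

theorem agreeAt_below (γ : ι → (WickField C ι)⟦X⟧) (A : Config C ι) (n : ℕ) :
    AgreeAt A n γ fun a => below n (γ a) := by
  intro k hk a
  rw [coeff_below, if_pos hk]

end Agree

/-! ### The fixed-point equation for `γ`. -/

/-- The term of order `n` of `I_c^μ (g A_μ + g Σ_μ(γ))`. -/
def axialStep (s : StringFunction) (f : ι → ι → ι → ℝ) (γ : ι → (WickField s.cone ι)⟦X⟧) (n : ℕ)
    (a : ι) : WickField s.cone ι :=
  ∑ μ, stringInt s μ (coeff n (X * (PowerSeries.C (potential μ a) + Sig f γ μ a)))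

/-- The factor `g` in front of `Σ` makes the dependence strictly triangular in the order. As `I_c`,
`∂` and products act at a fixed configuration, agreement at that configuration alone suffices. -/
theorem axialStep_apply_congr {γ γ' : ι → (WickField s.cone ι)⟦X⟧}
    (h0 : ∀ a, coeff 0 (γ a) = 0) (h0' : ∀ a, coeff 0 (γ' a) = 0) {A : Config s.cone ι} {n : ℕ}
    (h : AgreeAt A n γ γ') (a : ι) : axialStep s f γ n a A = axialStep s f γ' n a A := by
  simp only [axialStep, Finset.sum_apply]
  refine sum_congr rfl fun μ _ => congrArg (funInt s μ) ?_
  cases n with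
  | zero => simp only [coeff_zero_X_mul]
  | succ n =>
    have := AgreeAt.sig (f := f) h0 h0' h μ n (Nat.lt_succ_self n) a
    simp only [coeff_succ_X_mul, map_add, Pi.add_apply, this]

theorem coeff_zero_below {R : Type*} [CommRing R] {u : R⟦X⟧} (h : coeff 0 u = 0) (n : ℕ) :
    coeff 0 (below n u) = 0 := by
  rw [coeff_below, h, ite_self]

theorem axialStep_below {γ : ι → (WickField s.cone ι)⟦X⟧} (h0 : ∀ a, coeff 0 (γ a) = 0) (n : ℕ)
    (a : ι) : axialStep s f (fun b => below n (γ b)) n a = axialStep s f γ n a :=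
  funext fun A => (axialStep_apply_congr h0 (fun b => coeff_zero_below (h0 b) n)
    (agreeAt_below γ A n) a).symm

theorem seriesV_axial {γ : ι → (WickField s.cone ι)⟦X⟧} (hγ : SeriesS s f γ) :
    SeriesV s f fun μ a => X * (PowerSeries.C (potential μ a) + Sig f γ μ a) :=
  ((SeriesV.const potential_mem_spaceV).add (SeriesV.sig hγ)).X_mul

theorem axialStep_mem {γ : ι → (WickField s.cone ι)⟦X⟧} (hγ : SeriesS s f γ) (n : ℕ) :
    axialStep s f γ n ∈ spaceS s f :=
  stringIntVec_mem_spaceS (seriesV_axial hγ n)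

theorem InGS.mem_smoothFields {γ : ι → (WickField s.cone ι)⟦X⟧} (hγ : InGS s f γ) (n : ℕ)
    (a : ι) : coeff n (γ a) ∈ smoothFields s.cone ι :=
  fun A => ((spaceS_realRegular (hγ.2 n) a).1.tame A).1

variable [Fintype d] [DecidableEq d]

theorem coeff_gaugeTransform (𝔤 : GaugeAlgebra ι d) {γ : ι → (WickField s.cone ι)⟦X⟧}
    (hγ : InGS s 𝔤.f γ) (n : ℕ) (μ : Fin 4) (i j : d) :
    coeff n (gaugeTransform 𝔤.ξ γ μ i j) = ∑ a, 𝔤.ξ a i j •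
      (coeff n (X * (PowerSeries.C (potential μ a) + Sig 𝔤.f γ μ a)) + pd μ (coeff n (γ a))) := by
  rw [gaugeTransform_eq 𝔤 hγ.1 hγ.mem_smoothFields, coeff_toMatrix]
  refine sum_congr rfl fun a _ => ?_
  rw [map_add, coeff_mapCoeff]

theorem sum_stringInt_toMatrix {ξ : ι → Matrix d d ℂ} {v : Fin 4 → ι → WickField s.cone ι}
    (hv : ∀ μ a, Regular (v μ a)) (i j : d) :
    ∑ μ, stringInt s μ (∑ a, ξ a i j • v μ a) = ∑ a, ξ a i j • stringIntVec s v a := by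
  have : ∀ μ, stringInt s μ (∑ a, ξ a i j • v μ a) = ∑ a, ξ a i j • stringInt s μ (v μ a) := by
    intro μ
    rw [stringInt_sum _ fun a _ => (hv μ a).const_smul _]
    exact sum_congr rfl fun a _ => stringInt_smul (hv μ a) _ μ
  simp only [this]
  rw [sum_comm]
  simp only [stringIntVec, smul_sum]

/-- Applying `I_c^μ` to `gA_μ + gΣ_μ + ∂_μ γ` turns the last term into `-γ`, and complex linear
independence of the `ξ_a` separates the components. -/
theorem axialAt_iff (𝔤 : GaugeAlgebra ι d) {γ : ι → (WickField s.cone ι)⟦X⟧}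
    (hγ : InGS s 𝔤.f γ) (A : Config s.cone ι) :
    AxialAt s 𝔤.ξ γ A ↔ ∀ n a, coeff n (γ a) A = axialStep s 𝔤.f γ n a A := by
  have key : ∀ i j n, coeff n (∑ μ, mapCoeff (stringInt s μ) (gaugeTransform 𝔤.ξ γ μ i j))
      = ∑ a, 𝔤.ξ a i j • (axialStep s 𝔤.f γ n a - coeff n (γ a)) := by
    intro i j n
    simp only [map_sum, coeff_mapCoeff, coeff_gaugeTransform 𝔤 hγ]
    have h1 := (seriesV_axial hγ.2).regular n
    have h2 := fun a => (spaceS_realRegular (hγ.2 n) a).1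
    rw [sum_stringInt_toMatrix fun μ a => (h1 μ a).add ((h2 a).pd μ)]
    refine sum_congr rfl fun a _ => congrArg _ ?_
    have h3 := congrFun (stringIntVec_add (s := s) h1 fun μ a => (h2 a).pd μ) a
    have h4 := congrFun (stringIntVec_grad (s := s) h2) a
    rw [sub_eq_add_neg]
    exact h3.trans (congrArg (axialStep s 𝔤.f γ n a + ·) h4)
  constructor
  · intro h n a
    funext x
    refine (sub_eq_zero.1 (linearIndependent_complex 𝔤
      (z := fun a => axialStep s 𝔤.f γ n a A x - coeff n (γ a) A x) (fun i j => ?_) a)).symm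
    have := h i j n x
    rw [key, map_zero] at this
    simpa only [Finset.sum_apply, Pi.smul_apply, Pi.sub_apply, smul_eq_mul, Pi.zero_apply] using this
  · intro h i j n x
    rw [key, map_zero]
    simp only [Finset.sum_apply, Pi.smul_apply, Pi.sub_apply, ← h, sub_self, smul_zero, sum_const_zero,
      Pi.zero_apply]

theorem eqAt_of_axialAt (𝔤 : GaugeAlgebra ι d) {γ γ' : ι → (WickField s.cone ι)⟦X⟧}
    (hγ : InGS s 𝔤.f γ) (hγ' : InGS s 𝔤.f γ') {A : Config s.cone ι} (h : AxialAt s 𝔤.ξ γ A)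
    (h' : AxialAt s 𝔤.ξ γ' A) (n : ℕ) (a : ι) : coeff n (γ a) A = coeff n (γ' a) A := by
  induction n using Nat.strong_induction_on generalizing a with
  | _ n ih =>
    rw [(axialAt_iff 𝔤 hγ A).1 h, (axialAt_iff 𝔤 hγ' A).1 h']
    exact axialStep_apply_congr hγ.1 hγ'.1 (fun k hk b => ih k hk b) a

theorem exists_axial (𝔤 : GaugeAlgebra ι d) (s : StringFunction) :
    ∃ γ : ι → (WickField s.cone ι)⟦X⟧, InGS s 𝔤.f γ ∧ ∀ A, AxialAt s 𝔤.ξ γ A := by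
  obtain ⟨u, hu⟩ := exists_eq_truncation (M := ι → WickField s.cone ι)
    fun n w => axialStep s 𝔤.f (fun a => PowerSeries.mk fun k => w k a) n
  have hmem : ∀ n, u n ∈ spaceS s 𝔤.f := by
    intro n
    induction n using Nat.strong_induction_on with
    | _ n ih =>
      rw [hu]
      refine axialStep_mem (fun k => ?_) n
      simp only [coeff_mk]
      split_ifs with hk
      · exact ih k hk
      · exact Submodule.zero_mem _
  let γ : ι → (WickField s.cone ι)⟦X⟧ := fun a => PowerSeries.mk fun n => u n a
  have hc : ∀ n a, coeff n (γ a) = u n a := fun n a => coeff_mk n _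
  have hγ : InGS s 𝔤.f γ := by
    refine ⟨fun a => ?_, fun n => ?_⟩
    · rw [hc, hu]
      simp only [axialStep, coeff_zero_X_mul, stringInt_zero, sum_const_zero]
    · simp only [hc]
      exact hmem n
  refine ⟨γ, hγ, fun A => (axialAt_iff 𝔤 hγ A).2 fun n a => ?_⟩
  rw [hc, hu, ← axialStep_below hγ.1]
  congr
  funext b
  ext1 k
  rw [coeff_mk, coeff_below, hc]
  change (if k < n then u k else 0) b = _
  split_ifs <;> rfl

end Axial

end StringYM

end

open scoped Distributions LineDeriv PowerSeries Pointwise ContDiff Topology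

noncomputable section

namespace StringYM

set_option linter.unusedSectionVars false

/-! ### The obstruction map on power series and the recursion for `α` -/

section Dressing

open PowerSeries Finset

variable {ι d : Type*} [Fintype ι] [DecidableEq ι] {s : StringFunction} {f : ι → ι → ι → ℝ}
  {T₀ : CDist}

section Omega

variable {C : ProperCone ℝ Spacetime} {α α' : Fin 4 → ι → (WickField C ι)⟦X⟧}

theorem coeff_omega (T₀ : CDist) (α : Fin 4 → ι → (WickField C ι)⟦X⟧) (u : (WickField C ι)⟦X⟧)
    (n : ℕ) : coeff n (omega T₀ α u) = ∑ p ∈ antidiagonal n,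
      obstruction T₀ (fun μ a => coeff p.1 (α μ a)) (coeff p.2 u) :=
  coeff_mk n _

theorem coeff_expOmega (T₀ : CDist) (α : Fin 4 → ι → (WickField C ι)⟦X⟧) (u : (WickField C ι)⟦X⟧)
    (n : ℕ) : coeff n (expOmega T₀ α u) = ∑ k ∈ range (n + 1),
      ((k.factorial : ℂ)⁻¹) • coeff n ((omega T₀ α)^[k] u) :=
  coeff_mk n _

theorem coeff_FOmega (T₀ : CDist) (α : Fin 4 → ι → (WickField C ι)⟦X⟧) (u : (WickField C ι)⟦X⟧)
    (n : ℕ) : coeff n (FOmega T₀ α u) = ∑ k ∈ range (n + 1),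
      (((k + 1).factorial : ℂ)⁻¹) • coeff n ((omega T₀ α)^[k] u) :=
  coeff_mk n _

theorem coeff_FOmega_eq_add (T₀ : CDist) (α : Fin 4 → ι → (WickField C ι)⟦X⟧)
    (u : (WickField C ι)⟦X⟧) (n : ℕ) : coeff n (FOmega T₀ α u) = coeff n u + ∑ k ∈ range n,
      (((k + 2).factorial : ℂ)⁻¹) • coeff n ((omega T₀ α)^[k + 1] u) := by
  rw [coeff_FOmega, sum_range_succ', add_comm]
  simp

theorem obstruction_coeff_zero (hT₀ : IsPropagator T₀) (h0 : ∀ μ a, coeff 0 (α μ a) = 0)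
    (Y : WickField C ι) : obstruction T₀ (fun μ a => coeff 0 (α μ a)) Y = 0 := by
  have : (fun μ a => coeff 0 (α μ a)) = 0 := funext fun μ => funext fun a => h0 μ a
  rw [this, obstruction_zero_left hT₀]

/-- The obstruction map raises the order in `g`. -/
theorem coeff_omega_eq_zero (hT₀ : IsPropagator T₀) (h0 : ∀ μ a, coeff 0 (α μ a) = 0)
    {u : (WickField C ι)⟦X⟧} {m : ℕ} (hu : ∀ k < m, coeff k u = 0) (k : ℕ) (hk : k < m + 1) :
    coeff k (omega T₀ α u) = 0 := by
  rw [coeff_omega]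
  refine sum_eq_zero fun p hp => ?_
  rw [HasAntidiagonal.mem_antidiagonal] at hp
  by_cases hp1 : p.1 = 0
  · rw [hp1, obstruction_coeff_zero hT₀ h0]
  · rw [hu p.2 (by omega), obstruction_zero]

theorem coeff_omega_iterate_eq_zero (hT₀ : IsPropagator T₀) (h0 : ∀ μ a, coeff 0 (α μ a) = 0)
    {u : (WickField C ι)⟦X⟧} {m : ℕ} (hu : ∀ k < m, coeff k u = 0) (j k : ℕ) (hk : k < m + j) :
    coeff k ((omega T₀ α)^[j] u) = 0 := by
  induction j generalizing k with
  | zero => exact hu k hk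
  | succ j ih =>
    rw [Function.iterate_succ_apply']
    exact coeff_omega_eq_zero hT₀ h0 ih k hk

/-- Neither `α` nor the argument has a term of order `g⁰`, so order `k` of `ω` pairs only orders
strictly below `k` of each. -/
theorem coeff_omega_congr (hT₀ : IsPropagator T₀) (h0 : ∀ μ a, coeff 0 (α μ a) = 0)
    (h0' : ∀ μ a, coeff 0 (α' μ a) = 0) {n : ℕ}
    (hα : ∀ k < n, ∀ μ a, coeff k (α μ a) = coeff k (α' μ a)) {u u' : (WickField C ι)⟦X⟧}
    (hu0 : coeff 0 u = 0) (hu0' : coeff 0 u' = 0) (hu : ∀ k < n, coeff k u = coeff k u') (k : ℕ)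
    (hk : k < n + 1) : coeff k (omega T₀ α u) = coeff k (omega T₀ α' u') := by
  rw [coeff_omega, coeff_omega]
  refine sum_congr rfl fun p hp => ?_
  rw [HasAntidiagonal.mem_antidiagonal] at hp
  by_cases hp1 : p.1 = 0
  · rw [hp1, obstruction_coeff_zero hT₀ h0, obstruction_coeff_zero hT₀ h0']
  by_cases hp2 : p.2 = 0
  · rw [hp2, hu0, hu0', obstruction_zero, obstruction_zero]
  · rw [hu p.2 (by omega)]
    congr
    funext μ a
    exact hα p.1 (by omega) μ a

theorem coeff_omega_iterate_congr (hT₀ : IsPropagator T₀) (h0 : ∀ μ a, coeff 0 (α μ a) = 0)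
    (h0' : ∀ μ a, coeff 0 (α' μ a) = 0) {n : ℕ}
    (hα : ∀ k < n, ∀ μ a, coeff k (α μ a) = coeff k (α' μ a)) {u u' : (WickField C ι)⟦X⟧}
    (hu0 : coeff 0 u = 0) (hu0' : coeff 0 u' = 0) (hu : ∀ k < n, coeff k u = coeff k u')
    (j k : ℕ) (hk : k < n + 1) :
    coeff k ((omega T₀ α)^[j + 1] u) = coeff k ((omega T₀ α')^[j + 1] u') := by
  induction j generalizing k with
  | zero => exact coeff_omega_congr hT₀ h0 h0' hα hu0 hu0' hu k hk
  | succ j ih =>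
    have hz : ∀ {β : Fin 4 → ι → (WickField C ι)⟦X⟧} {v : (WickField C ι)⟦X⟧},
        (∀ μ a, coeff 0 (β μ a) = 0) → coeff 0 ((omega T₀ β)^[j + 1] v) = 0 := fun hβ =>
      coeff_omega_iterate_eq_zero hT₀ hβ (m := 0) (by simp) (j + 1) 0 (by omega)
    rw [Function.iterate_succ_apply', Function.iterate_succ_apply' (omega T₀ α')]
    exact coeff_omega_congr hT₀ h0 h0' hα (hz h0) (hz h0') (fun k hk => ih k (by omega)) k hk

/-- At order `n` every term `ω^k(α)` with `k ≥ 1` is unchanged if `α` is truncated below `n`, and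
the term `k = 0` is `α` itself. Solvability, uniqueness and the recursion for `α` all rest on this
identity. -/
theorem coeff_FOmega_below (hT₀ : IsPropagator T₀) (h0 : ∀ μ a, coeff 0 (α μ a) = 0) (n : ℕ)
    (μ : Fin 4) (a : ι) : coeff n (FOmega T₀ α (α μ a)) = coeff n (α μ a)
      - coeff n (below n (α μ a) - FOmega T₀ (fun ν b => below n (α ν b)) (below n (α μ a))) := by
  have hb : ∀ ν b, ∀ k < n, coeff k (α ν b) = coeff k (below n (α ν b)) := fun ν b k hk => by
    rw [coeff_below, if_pos hk]
  rw [coeff_FOmega_eq_add, map_sub, coeff_FOmega_eq_add, sub_add_cancel_left, sub_neg_eq_add]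
  refine congrArg _ (sum_congr rfl fun k _ => congrArg _ ?_)
  exact coeff_omega_iterate_congr hT₀ h0 (fun ν b => coeff_zero_below (h0 ν b) n)
    (fun k hk ν b => hb ν b k hk) (h0 μ a) (coeff_zero_below (h0 μ a) n) (hb μ a) k n
    (Nat.lt_succ_self n)

theorem omega_C_potential (hT₀ : IsPropagator T₀)
    (hα : ∀ n μ a, RealRegular (coeff n (α μ a))) (μ : Fin 4) (a : ι) :
    omega T₀ α (PowerSeries.C (potential μ a)) = α μ a := by
  ext1 n
  rw [coeff_omega, sum_eq_single_of_mem (n, 0) (by simp), coeff_zero_C,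
    obstruction_potential hT₀ (hα n)]
  intro p hp hne
  rw [HasAntidiagonal.mem_antidiagonal] at hp
  have : p.2 ≠ 0 := fun h => hne (Prod.ext (by simpa [h] using hp) h)
  rw [coeff_C, if_neg this, obstruction_zero]

/-- `e^ω(A_μ) = A_μ + F(ω)(α_μ)`. -/
theorem expOmega_C_potential (hT₀ : IsPropagator T₀) (h0 : ∀ μ a, coeff 0 (α μ a) = 0)
    (hα : ∀ n μ a, RealRegular (coeff n (α μ a))) (μ : Fin 4) (a : ι) :
    expOmega T₀ α (PowerSeries.C (potential μ a))
      = PowerSeries.C (potential μ a) + FOmega T₀ α (α μ a) := by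
  ext1 n
  -- After the index shift the exponential supplies one term fewer than `F(ω)`; the surplus term
  -- `ω^n(α)` starts at order `n + 1` and does not contribute.
  rw [coeff_expOmega, map_add, coeff_FOmega, sum_range_succ', sum_range_succ,
    coeff_omega_iterate_eq_zero hT₀ h0 (m := 1) (u := α μ a) _ n n (by omega), smul_zero, add_zero,
    add_comm]
  · simp [Function.iterate_succ_apply, omega_C_potential hT₀ hα]
  · intro k hk
    rw [Nat.lt_one_iff.1 hk, h0]

end Omega

variable {α v : Fin 4 → ι → (WickField s.cone ι)⟦X⟧}

theorem InGV.realRegular (hα : InGV s f α) (n : ℕ) (μ : Fin 4) (a : ι) :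
    RealRegular (coeff n (α μ a)) :=
  spaceV_realRegular (hα.2 n) μ a

theorem SeriesV.omega (hT₀ : IsPropagator T₀) (hα : SeriesV s f α) (hv : SeriesV s f v) :
    SeriesV s f fun μ a => omega T₀ α (v μ a) := by
  intro n
  simp only [coeff_omega]
  exact sum_mem_spaceV _ fun p _ => obstruction_mem_spaceV hT₀ (hα p.1) (hv p.2)

theorem SeriesV.omega_iterate (hT₀ : IsPropagator T₀) (hα : SeriesV s f α) (hv : SeriesV s f v)
    (k : ℕ) : SeriesV s f fun μ a => (StringYM.omega T₀ α)^[k] (v μ a) := by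
  induction k with
  | zero => exact hv
  | succ k ih =>
    simp only [Function.iterate_succ_apply']
    exact SeriesV.omega hT₀ hα ih

theorem SeriesV.fOmega (hT₀ : IsPropagator T₀) (hα : SeriesV s f α) (hv : SeriesV s f v) :
    SeriesV s f fun μ a => FOmega T₀ α (v μ a) := by
  intro n
  have h := sum_smul_mem_spaceV (range (n + 1)) (fun k => (((k + 1).factorial : ℝ))⁻¹)
    fun k _ => SeriesV.omega_iterate hT₀ hα hv k n
  push_cast at h
  simp only [coeff_FOmega]
  exact h

theorem eq_of_FOmega_eq (hT₀ : IsPropagator T₀) {α α' : Fin 4 → ι → (WickField s.cone ι)⟦X⟧}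
    (h0 : ∀ μ a, coeff 0 (α μ a) = 0) (h0' : ∀ μ a, coeff 0 (α' μ a) = 0)
    (h : ∀ μ a, FOmega T₀ α (α μ a) = FOmega T₀ α' (α' μ a)) : α = α' := by
  have key : ∀ n, ∀ μ a, coeff n (α μ a) = coeff n (α' μ a) := by
    intro n
    induction n using Nat.strong_induction_on with
    | _ n ih =>
      intro μ a
      have hb : ∀ ν b, StringYM.below n (α ν b) = StringYM.below n (α' ν b) := by
        intro ν b
        ext1 k
        rw [coeff_below, coeff_below]
        split_ifs with hk
        · exact ih k hk ν b
        · rfl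
      have e := congrArg (coeff n) (h μ a)
      rw [coeff_FOmega_below hT₀ h0, coeff_FOmega_below hT₀ h0'] at e
      simp only [hb] at e
      exact sub_left_injective e
  exact funext fun μ => funext fun a => PowerSeries.ext fun n => key n μ a

/-- The triangular form defines `α` order by order, and stability of `𝒱` under `ω` keeps it in `𝒱`.
An arbitrary right side is admitted so that non-uniqueness can be derived from a modified one. -/
theorem exists_FOmega_eq (hT₀ : IsPropagator T₀) {σ : Fin 4 → ι → (WickField s.cone ι)⟦X⟧}
    (hσ : InGV s f σ) : ∃ α, InGV s f α ∧ ∀ μ a, FOmega T₀ α (α μ a) = σ μ a := by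
  obtain ⟨u, hu⟩ := exists_eq_truncation (M := Fin 4 → ι → WickField s.cone ι)
    fun n w μ a => coeff n (σ μ a + (PowerSeries.mk (fun k => w k μ a)
      - FOmega T₀ (fun ν b => PowerSeries.mk fun k => w k ν b) (PowerSeries.mk fun k => w k μ a)))
  have hmem : ∀ n, u n ∈ spaceV s f := by
    intro n
    induction n using Nat.strong_induction_on with
    | _ n ih =>
      have hb : SeriesV s f fun μ a =>
          PowerSeries.mk fun k => (if k < n then u k else 0) μ a := by
        intro k
        simp only [coeff_mk]
        split_ifs with hk
        · exact ih k hk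
        · exact Submodule.zero_mem _
      rw [hu]
      simp only [map_add, map_sub]
      exact Submodule.add_mem _ (hσ.2 n) (Submodule.sub_mem _ (hb n) (hb.fOmega hT₀ hb n))
  let α : Fin 4 → ι → (WickField s.cone ι)⟦X⟧ := fun μ a => PowerSeries.mk fun n => u n μ a
  have hc : ∀ n μ a, coeff n (α μ a) = u n μ a := fun n μ a => coeff_mk n _
  have hα : InGV s f α := by
    refine ⟨fun μ a => ?_, fun n => ?_⟩
    · rw [hc, hu]
      simp only [map_add, map_sub, hσ.1, coeff_FOmega_eq_add]
      simp
    · simp only [hc]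
      exact hmem n
  refine ⟨α, hα, fun μ a => PowerSeries.ext fun n => ?_⟩
  have hb : ∀ ν b, StringYM.below n (α ν b)
      = PowerSeries.mk fun k => (if k < n then u k else 0) ν b := by
    intro ν b
    ext1 k
    rw [coeff_mk, coeff_below, hc]
    split_ifs <;> rfl
  have e := congrFun (congrFun (hu n) μ) a
  rw [coeff_FOmega_below hT₀ hα.1, hc, e, map_add]
  simp only [hb, add_sub_cancel_right]

/-! ### The dressed potential -/

/-- The projection `v_μ ↦ v_μ + ∂_μ I_c^ν v_ν` onto the vector fields with `I_c^μ v_μ = 0`. -/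
def axialProj (s : StringFunction) (v : Fin 4 → ι → WickField s.cone ι) :
    Fin 4 → ι → WickField s.cone ι :=
  fun μ a => v μ a + pd μ (stringIntVec s v a)

/-- In `I_c^ν(∂_μ A_ν - ∂_ν A_μ)` the first derivative is pulled out of the integral and the second
term equals `A_μ` by `I_c^ν ∂_ν = -id`. -/
theorem stringPotential_eq (s : StringFunction) :
    (stringPotential s : Fin 4 → ι → WickField s.cone ι) = axialProj s potential := by
  funext μ a
  have h1 : ∀ ν, Regular (pd ν (potential μ a) : WickField s.cone ι) :=
    fun ν => (Regular.potential μ a).pd ν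
  have h2 : ∀ ν, Regular (pd μ (potential ν a) : WickField s.cone ι) :=
    fun ν => (Regular.potential ν a).pd μ
  have e : ∀ ν, stringInt s ν (fieldStrength μ ν a)
      = pd μ (stringInt s ν (potential ν a)) + (-1 : ℂ) • stringInt s ν (pd ν (potential μ a)) := by
    intro ν
    rw [pd_stringInt (Regular.potential ν a), ← stringInt_smul (h1 ν),
      ← stringInt_add (h2 ν) ((h1 ν).const_smul _), fieldStrength, neg_one_smul, sub_eq_add_neg]
  rw [stringPotential, sum_congr rfl fun ν _ => e ν, sum_add_distrib, ← smul_sum,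
    sum_stringInt_pd (Regular.potential μ a), neg_one_smul, neg_neg, axialProj, add_comm,
    stringIntVec, pd_sum _ fun ν _ => (Regular.potential ν a).stringInt ν]

theorem axialProj_mem {v : Fin 4 → ι → WickField s.cone ι} (hv : v ∈ spaceV s f) :
    axialProj s v ∈ spaceV s f :=
  Submodule.add_mem _ hv (grad_mem_spaceV (stringIntVec_mem_spaceS hv))

theorem stringIntVec_axialProj {v : Fin 4 → ι → WickField s.cone ι} (hv : v ∈ spaceV s f) :
    stringIntVec s (axialProj s v) = 0 := by
  have hI := stringIntVec_mem_spaceS hv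
  have h := stringIntVec_add (s := s) (fun μ a => (spaceV_realRegular hv μ a).1)
    fun μ a => (spaceV_realRegular (grad_mem_spaceV hI) μ a).1
  rw [stringIntVec_grad fun a => (spaceS_realRegular hI a).1, add_neg_cancel] at h
  exact h

theorem axialProj_sum_smul {κ : Type*} (t : Finset κ) (z : κ → ℂ)
    {v : κ → Fin 4 → ι → WickField s.cone ι} (h : ∀ k ∈ t, v k ∈ spaceV s f) (μ : Fin 4) (a : ι) :
    axialProj s (fun ν b => ∑ k ∈ t, z k • v k ν b) μ a
      = ∑ k ∈ t, z k • axialProj s (v k) μ a := by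
  have hr : ∀ k ∈ t, ∀ ν b, Regular (v k ν b) := fun k hk ν b => (spaceV_realRegular (h k hk) ν b).1
  have hI : ∀ k ∈ t, Regular (stringIntVec s (v k) a) := fun k hk =>
    (spaceS_realRegular (stringIntVec_mem_spaceS (h k hk)) a).1
  have e : stringIntVec s (fun ν b => ∑ k ∈ t, z k • v k ν b) a
      = ∑ k ∈ t, z k • stringIntVec s (v k) a := by
    simp only [stringIntVec, smul_sum]
    rw [sum_comm]
    refine sum_congr rfl fun ν _ => ?_
    rw [stringInt_sum _ fun k hk => (hr k hk ν a).const_smul _]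
    exact sum_congr rfl fun k hk => stringInt_smul (hr k hk ν a) _ ν
  simp only [axialProj, e, smul_add, sum_add_distrib]
  rw [pd_sum _ fun k hk => (hI k hk).const_smul _]
  exact congrArg _ (sum_congr rfl fun k hk => pd_smul (hI k hk) _ μ)

theorem obstruction_axialProj {α v : Fin 4 → ι → WickField s.cone ι} (hv : v ∈ spaceV s f)
    (μ : Fin 4) (a : ι) : obstruction T₀ α (axialProj s v μ a)
      = axialProj s (fun ν b => obstruction T₀ α (v ν b)) μ a := by
  have hr := fun ν b => (spaceV_realRegular hv ν b).1
  have hI := fun b => (spaceS_realRegular (stringIntVec_mem_spaceS hv) b).1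
  rw [axialProj, obstruction_add (hr μ a) ((hI a).pd μ), obstruction_pd (hI a),
    congrFun (obstruction_stringIntVec (α := α) (T₀ := T₀) hr) a, axialProj]

theorem coeff_omega_axialProj (hT₀ : IsPropagator T₀) (hα : SeriesV s f α) (hv : SeriesV s f v)
    {w : Fin 4 → ι → (WickField s.cone ι)⟦X⟧}
    (hw : ∀ n μ a, coeff n (w μ a) = axialProj s (fun ν b => coeff n (v ν b)) μ a)
    (n : ℕ) (μ : Fin 4) (a : ι) : coeff n (omega T₀ α (w μ a))
      = axialProj s (fun ν b => coeff n (omega T₀ α (v ν b))) μ a := by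
  have h := axialProj_sum_smul (antidiagonal n) (fun _ => (1 : ℂ))
    (fun p _ => obstruction_mem_spaceV hT₀ (hα p.1) (hv p.2)) μ a
  simp only [one_smul] at h
  simp only [coeff_omega, h]
  refine sum_congr rfl fun p _ => ?_
  rw [hw, obstruction_axialProj (hv p.2)]

/-- With `A(c) = P A`, the operator `P` is pulled through every power of `ω`, and `e^ω(A) = A +
F(ω)(α)` is inserted under it. -/
theorem coeff_expOmega_stringPotential (hT₀ : IsPropagator T₀) (hα : InGV s f α) (n : ℕ)
    (μ : Fin 4) (a : ι) : coeff n (expOmega T₀ α (PowerSeries.C (stringPotential s μ a)))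
      = axialProj s (fun ν b => coeff n (PowerSeries.C (potential ν b) + FOmega T₀ α (α ν b)))
        μ a := by
  have hA : SeriesV s f fun μ a => PowerSeries.C (potential μ a) :=
    SeriesV.const potential_mem_spaceV
  have hit : ∀ k n μ a, coeff n ((omega T₀ α)^[k] (PowerSeries.C (stringPotential s μ a)))
      = axialProj s (fun ν b => coeff n ((omega T₀ α)^[k] (PowerSeries.C (potential ν b)))) μ a := by
    intro k
    induction k with
    | zero =>
      intro n μ a
      simp only [Function.iterate_zero, id_eq, stringPotential_eq, coeff_C]
      split_ifs with h
      · rfl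
      -- Linearity for the empty sum says that `P` maps zero to zero.
      · have := axialProj_sum_smul (f := f) (s := s) (∅ : Finset ℕ) (fun _ => 0)
          (v := fun _ => 0) (by simp) μ a
        simpa using this.symm
    | succ k ih =>
      simp only [Function.iterate_succ_apply']
      exact coeff_omega_axialProj hT₀ hα.2 (SeriesV.omega_iterate hT₀ hα.2 hA k) ih
  simp only [← expOmega_C_potential hT₀ hα.1 hα.realRegular, coeff_expOmega, hit]
  exact (axialProj_sum_smul _ _ (fun k _ => SeriesV.omega_iterate hT₀ hα.2 hA k n) μ a).symm

variable [Fintype d] [DecidableEq d]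

theorem axialAt_of_dressingAt (𝔤 : GaugeAlgebra ι d) (hT₀ : IsPropagator T₀)
    {γ : ι → (WickField s.cone ι)⟦X⟧} (hα : InGV s 𝔤.f α)
    {A : Config s.cone ι} (h : DressingAt s T₀ 𝔤.ξ γ α A) : AxialAt s 𝔤.ξ γ A := by
  intro i j n x
  have e : coeff n (∑ μ, mapCoeff (stringInt s μ) (gaugeTransform 𝔤.ξ γ μ i j)) A
      = (∑ μ, stringInt s μ (coeff n ((X : (WickField s.cone ι)⟦X⟧) * toMatrix 𝔤.ξ
        (fun a => expOmega T₀ α (PowerSeries.C (stringPotential s μ a))) i j))) A := by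
    simp only [map_sum, coeff_mapCoeff, Finset.sum_apply]
    -- String integration at `A` sees only the function `X[A]`, so the ansatz at this one
    -- configuration is enough.
    exact sum_congr rfl fun μ _ =>
      congrArg (funInt s μ) (funext fun x => (h μ i j n x).symm)
  rw [e, map_zero]
  refine congrFun (congrFun ?_ A) x
  cases n with
  | zero => simp only [coeff_zero_X_mul, stringInt_zero, sum_const_zero]
  | succ n =>
    have hV : SeriesV s 𝔤.f fun ν b => PowerSeries.C (potential ν b) + FOmega T₀ α (α ν b) :=
      (SeriesV.const potential_mem_spaceV).add (SeriesV.fOmega hT₀ hα.2 hα.2)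
    have hP := axialProj_mem (hV n)
    simp only [coeff_succ_X_mul, coeff_toMatrix, coeff_expOmega_stringPotential hT₀ hα]
    rw [sum_stringInt_toMatrix fun μ a => (spaceV_realRegular hP μ a).1]
    refine sum_eq_zero fun a _ => ?_
    have := congrFun (stringIntVec_axialProj (hV n)) a
    rw [show stringIntVec s (fun μ a => axialProj s (fun ν b => coeff n
      (PowerSeries.C (potential ν b) + FOmega T₀ α (α ν b))) μ a) a = 0 from this, smul_zero]

/-- The left side of the ansatz is `P(A + Σ + h) = A + Σ + ∂ I_c(A + Σ)`, and the axial equation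
identifies `I_c(A + Σ)` with `g⁻¹γ`. The slack `h` in the kernel of `P` serves the non-uniqueness.
-/
theorem dressingAt_of_FOmega_eq (𝔤 : GaugeAlgebra ι d) (hT₀ : IsPropagator T₀)
    {γ : ι → (WickField s.cone ι)⟦X⟧} (hγ : InGS s 𝔤.f γ) (hα : InGV s 𝔤.f α)
    (hax : ∀ A, AxialAt s 𝔤.ξ γ A)
    {h : Fin 4 → ι → (WickField s.cone ι)⟦X⟧} (hh : SeriesV s 𝔤.f h)
    (hproj : ∀ n, axialProj s (fun μ a => coeff n (h μ a)) = 0)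
    (hF : ∀ μ a, FOmega T₀ α (α μ a) = Sig 𝔤.f γ μ a + h μ a) (A : Config s.cone ι) :
    DressingAt s T₀ 𝔤.ξ γ α A := by
  have hstep : ∀ n a, coeff n (γ a) = axialStep s 𝔤.f γ n a := fun n a =>
    funext fun A => (axialAt_iff 𝔤 hγ A).1 (hax A) n a
  intro μ i j n x
  refine congrFun (congrFun ?_ A) x
  rw [coeff_gaugeTransform 𝔤 hγ]
  cases n with
  | zero => simp only [coeff_zero_X_mul, hγ.1, pd_zero, add_zero, smul_zero, sum_const_zero]
  | succ n =>
    simp only [coeff_succ_X_mul, coeff_toMatrix, coeff_expOmega_stringPotential hT₀ hα, hF]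
    refine sum_congr rfl fun a _ => congrArg _ ?_
    have hV : SeriesV s 𝔤.f fun ν b => PowerSeries.C (potential ν b) + Sig 𝔤.f γ ν b :=
      (SeriesV.const potential_mem_spaceV).add (SeriesV.sig hγ.2)
    -- Additivity of `P` for the two summands `A + Σ` and `h`, indexed by `Bool`.
    have e := axialProj_sum_smul (s := s) (univ : Finset Bool) (fun _ => (1 : ℂ))
      (v := fun c => if c then fun ν b => coeff n (PowerSeries.C (potential ν b) + Sig 𝔤.f γ ν b)
        else fun ν b => coeff n (h ν b)) (f := 𝔤.f)
      (fun c _ => by cases c; exacts [hh n, hV n]) μ a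
    simp only [Fintype.sum_bool, one_smul, if_true, Bool.false_eq_true, if_false, hproj,
      Pi.zero_apply, add_zero, ← map_add, add_assoc] at e
    rw [e, axialProj, hstep]
    simp only [axialStep, coeff_succ_X_mul]
    rfl

end Dressing

end StringYM

end

open scoped Distributions LineDeriv PowerSeries Pointwise ContDiff Topology

noncomputable section

namespace StringYM

/-! ### Non-uniqueness of the dressing density -/

section Nonuniqueness

open PowerSeries Finset

variable {ι : Type*} {s : StringFunction}

theorem axialProj_grad {Y : ι → WickField s.cone ι} (hY : ∀ a, Regular (Y a)) :
    axialProj s (grad Y) = 0 := by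
  funext μ a
  have h : stringIntVec s (grad Y) a = (-1 : ℂ) • Y a := by
    rw [stringIntVec_grad hY, neg_one_smul, Pi.neg_apply]
  rw [axialProj, h, pd_smul (hY a), neg_one_smul, grad, add_neg_cancel, Pi.zero_apply,
    Pi.zero_apply]

/-- On the pure gauge configuration `A_ν = ∂_ν φ` the field `I_c^ν A_ν` equals `-φ`. -/
theorem stringIntVec_potential_ne_zero (s : StringFunction) (a : ι) :
    stringIntVec s (potential : Fin 4 → ι → WickField s.cone ι) a ≠ 0 := by
  let χ : ContDiffBump (0 : Spacetime) := ⟨1, 2, one_pos, one_lt_two⟩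
  have hχ : Tame s.cone (χ : Spacetime → ℝ) :=
    Tame.of_hasCompactSupport χ.contDiff χ.hasCompactSupport
  let A : Config s.cone ι := ⟨fun ν _ => partialDeriv ν χ, fun ν _ => hχ.partialDeriv ν⟩
  intro h
  have hA : ∀ ν, (potential ν a : WickField s.cone ι) A
      = partialDeriv ν fun x => ((χ x : ℝ) : ℂ) :=
    fun ν => funext fun x => (partialDeriv_clm hχ.1 Complex.ofRealCLM ν x).symm
  have e := congrFun (congrFun h A) 0
  have e' : stringIntVec s (potential : Fin 4 → ι → WickField s.cone ι) a A
      = ∑ ν, funInt s ν (partialDeriv ν fun x => ((χ x : ℝ) : ℂ)) := by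
    rw [stringIntVec, Finset.sum_apply]
    exact sum_congr rfl fun ν _ => congrArg (funInt s ν) (hA ν)
  rw [e', sum_funInt_partialDeriv hχ.ofReal] at e
  have h1 : χ 0 = 1 := χ.one_of_mem_closedBall (by simp [χ])
  simp [h1] at e

/-- String integration recovers `-Y` from its gradient, so nonzero tame fields have nonzero
gradient. -/
theorem grad_ne_zero {Y : ι → WickField s.cone ι} (hY : ∀ a, Regular (Y a)) {a : ι}
    (h : Y a ≠ 0) : grad Y ≠ 0 := by
  intro h0
  have h1 := congrFun (stringIntVec_grad (s := s) hY) a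
  rw [h0, Pi.neg_apply] at h1
  refine h (neg_eq_zero.1 (h1.symm.trans ?_))
  simp [stringIntVec, stringInt_zero]

theorem inGV_sig [Fintype ι] {f : ι → ι → ι → ℝ} {γ : ι → (WickField s.cone ι)⟦X⟧} (hγ : InGS s f γ) :
    InGV s f (Sig f γ) :=
  ⟨fun μ a => by rw [coeff_Sig]; simp, SeriesV.sig hγ.2⟩

end Nonuniqueness

end StringYM

end

/-! ### The proposition. -/

open StringYM PowerSeries in
theorem propositionp {ι d : Type*} [Fintype ι] [DecidableEq ι] [Fintype d] [DecidableEq d]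
    (𝔤 : GaugeAlgebra ι d) (s : StringFunction) (T₀ : CDist) (hT₀ : IsPropagator T₀) :
    (∀ γ α, InGS s 𝔤.f γ → InGV s 𝔤.f α →
      ∀ A, DressingAt s T₀ 𝔤.ξ γ α A → AxialAt s 𝔤.ξ γ A) ∧
    (∃! γ, InGS s 𝔤.f γ ∧ ∀ A, AxialAt s 𝔤.ξ γ A) ∧
    (∀ γ, InGS s 𝔤.f γ → (∀ A, AxialAt s 𝔤.ξ γ A) →
      (∀ γ', InGS s 𝔤.f γ' → ∀ A, AxialAt s 𝔤.ξ γ' A → ∀ a, EqAt A (γ' a) (γ a)) ∧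
      (∀ n a, coeff n (γ a) = ∑ μ, stringInt s μ (coeff n
        (X * (C (potential μ a) + Sig 𝔤.f (fun b => below n (γ b)) μ a)))) ∧
      (∃! α, InGV s 𝔤.f α ∧ ∀ μ a, FOmega T₀ α (α μ a) = Sig 𝔤.f γ μ a) ∧
      (∀ α, InGV s 𝔤.f α → (∀ μ a, FOmega T₀ α (α μ a) = Sig 𝔤.f γ μ a) →
        (∀ A, DressingAt s T₀ 𝔤.ξ γ α A) ∧
        ∀ n μ a, coeff n (α μ a) = coeff n (Sig 𝔤.f γ μ a + (below n (α μ a)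
          - FOmega T₀ (fun ν b => below n (α ν b)) (below n (α μ a))))) ∧
      (Nonempty ι → ∃ α₁ α₂, α₁ ≠ α₂ ∧
        (InGV s 𝔤.f α₁ ∧ ∀ A, DressingAt s T₀ 𝔤.ξ γ α₁ A) ∧
        (InGV s 𝔤.f α₂ ∧ ∀ A, DressingAt s T₀ 𝔤.ξ γ α₂ A))) := by
  refine ⟨fun γ α _ hα A h => axialAt_of_dressingAt 𝔤 hT₀ hα h, ?_, ?_⟩
  · obtain ⟨γ, hγ, hax⟩ := exists_axial 𝔤 s
    refine ⟨γ, ⟨hγ, hax⟩, fun γ' h' => funext fun a => PowerSeries.ext fun n => funext fun A => ?_⟩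
    exact eqAt_of_axialAt 𝔤 h'.1 hγ (h'.2 A) (hax A) n a
  intro γ hγ hax
  have hSig := inGV_sig hγ
  have hdress : ∀ α, InGV s 𝔤.f α → (∀ μ a, FOmega T₀ α (α μ a) = Sig 𝔤.f γ μ a) →
      ∀ A, DressingAt s T₀ 𝔤.ξ γ α A := by
    intro α hα hF
    refine dressingAt_of_FOmega_eq 𝔤 hT₀ hγ hα hax (h := fun _ _ => 0)
      (fun n => ?_) (fun n => ?_) (fun μ a => (hF μ a).trans (add_zero _).symm)
    · simp only [map_zero]
      exact Submodule.zero_mem _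
    · funext μ a
      simp only [map_zero, axialProj, stringIntVec, stringInt_zero, Finset.sum_const_zero, pd_zero,
        add_zero, Pi.zero_apply]
  refine ⟨fun γ' hγ' A h' a n x => congrFun (eqAt_of_axialAt 𝔤 hγ' hγ h' (hax A) n a) x, ?_, ?_,
    fun α hα hF => ⟨hdress α hα hF, ?_⟩, ?_⟩
  · intro n a
    exact (funext fun A => (axialAt_iff 𝔤 hγ A).1 (hax A) n a).trans
      (axialStep_below hγ.1 n a).symm
  · obtain ⟨α, hα, hF⟩ := exists_FOmega_eq hT₀ hSig
    exact ⟨α, ⟨hα, hF⟩, fun α' h' =>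
      eq_of_FOmega_eq hT₀ h'.1.1 hα.1 fun μ a => (h'.2 μ a).trans (hF μ a).symm⟩
  · intro n μ a
    rw [map_add, ← hF μ a, coeff_FOmega_below hT₀ hα.1, sub_add_cancel]
  · rintro ⟨a₀⟩
    -- The simplest nonzero element of `𝒮`. The density is changed by shifting the right side by `g
    -- ∂_μ Y`; the factor `g` keeps it in `g𝒱[[g]]`, and `P` annihilates it.
    let Y := stringIntVec s (potential : Fin 4 → ι → WickField s.cone ι)
    have hY : Y ∈ spaceS s 𝔤.f := stringIntVec_mem_spaceS potential_mem_spaceV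
    have hYr : ∀ a, Regular (Y a) := fun a => (spaceS_realRegular hY a).1
    let h : Fin 4 → ι → (WickField s.cone ι)⟦X⟧ := fun μ a => X * C (grad Y μ a)
    have hh : SeriesV s 𝔤.f h := (SeriesV.const (grad_mem_spaceV hY)).X_mul
    have hc : ∀ n, (fun μ a => coeff n (h μ a)) = if n = 1 then grad Y else 0 := by
      intro n
      funext μ a
      rcases n with _ | _ | n
      · simp [h]
      · simp [h]
      · change coeff (n + 1 + 1) (X * C (grad Y μ a)) = _
        rw [coeff_succ_X_mul, coeff_C, if_neg (by omega), if_neg (by omega)]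
        rfl
    have hproj : ∀ n, axialProj s (fun μ a => coeff n (h μ a)) = 0 := by
      intro n
      rw [hc]
      split_ifs
      · exact axialProj_grad hYr
      · funext μ a
        simp only [axialProj, stringIntVec, Pi.zero_apply, stringInt_zero, Finset.sum_const_zero,
          pd_zero, add_zero]
    obtain ⟨α₁, hα₁, hF₁⟩ := exists_FOmega_eq hT₀ hSig
    obtain ⟨α₂, hα₂, hF₂⟩ := exists_FOmega_eq hT₀ (σ := fun μ a => Sig 𝔤.f γ μ a + h μ a)
      (f := 𝔤.f) ⟨fun μ a => by rw [map_add, hSig.1, coeff_zero_X_mul, add_zero],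
        SeriesV.add hSig.2 hh⟩
    refine ⟨α₁, α₂, ?_, ⟨hα₁, hdress α₁ hα₁ hF₁⟩, hα₂,
      dressingAt_of_FOmega_eq 𝔤 hT₀ hγ hα₂ hax hh hproj hF₂⟩
    -- Equal densities would have equal `F(ω)(α)`, so the shift would vanish; its coefficient of
    -- order `g` is the gradient of `Y`.
    rintro rfl
    refine grad_ne_zero hYr (stringIntVec_potential_ne_zero s a₀) ?_
    have := hc 1
    rw [if_pos rfl] at this
    rw [← this]
    funext μ a
    have e := (hF₁ μ a).symm.trans (hF₂ μ a)
    rw [left_eq_add.1 e, map_zero, Pi.zero_apply, Pi.zero_apply]
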